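/- For $n\ge 1$ and a probability distribution $\mathcal D$ on $\{0,1\}^n\times\{0,1\}$ whose marginal on $\{0,1\}^n$ is uniform, let $\varphi(z)=\mathbb E_{(x,y)\sim\mathcal D}[y\mid x=z]$, $\phi=1-2\varphi:\{0,1\}^n\to[-1,1]$, and $\hat\phi(s)=\mathbb E_{x}[\phi(x)(-1)^{s\cdot x}]$ for $s\in\{0,1\}^n$, where $x$ is uniform on $\{0,1\}^n$. Let $\rho_{\mathcal D}=\mathbb E_{f}\big[|\psi_f\rangle\langle\psi_f|\big]$ be the mixture-of-superpositions example for $\mathcal D$, an $(n+1)$-qubit state, where $|\psi_f\rangle=2^{-n/2}\sum_{x\in\{0,1\}^n}|x,f(x)\rangle$ and $f:\{0,1\}^n\to\{0,1\}$ is random with independent values, $\Pr[f(x)=1]=\varphi(x)$. There is a single quantum algorithm with the following properties, for all $n\ge1$ and all real $\delta,\varepsilon\in(0,1)$ with $\varepsilon>2^{-(n/2-2)}$, and for every such $\mathcal D$. The algorithm is given $n$, access to the binary digits of $\varepsilon$ and $\delta$, and copies of $\rho_{\mathcal D}$. On every branch of measurement outcomes it uses $$O\!\left(\frac{\log(2/(\delta\varepsilon^2))}{\varepsilon^4}\right)\text{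 copies of }\rho_{\mathcal D},\qquad O\!\left(n\,\frac{\log(2/(\delta\varepsilon^2))}{\varepsilon^4}\right)\text{ single-qubit gates},$$ and computation time and classical memory (in bits) both $$\tilde O\!\left(n\,\frac{\log(2/(\delta\varepsilon^2))}{\varepsilon^4}\right).$$ With probability at least $1-\delta$ it outputs a function $\tilde\phi:\{0,1\}^n\to[-1,1]$, represented by a list of at most $16\,\mathbb E_x[\phi(x)^2]/\varepsilon^2$ pairs (string, value), with $\tilde\phi$ zero at strings that are not listed, such that $$\|\tilde\phi-\hat\phi\|_\infty\le\varepsilon\qquad\text{and}\qquad \|\tilde\phi\|_0\le\frac{16\,\mathbb E_{x}[\phi(x)^2]}{\varepsilon^2}\le\frac{16}{\varepsilon^2},$$ where $\|\tilde\phi\|_0$ is the number of strings at which $\tilde\phi$ is nonzero. Here the implied constants are absolute, and $\tilde O$ suppresses a fixed power of $1+\log(1/\varepsilon)+\log(1+\log(1/\delta))$, hence no factor depending on $n$. The algorithm is a fixed program of a classical word RAM with words of $O(\log n+1+\log(1/\varepsilon)+\log(1+\log(1/\delta)))$ bits, in which every instruction takes one unit of time, controlling an $(n+1)$-qubit register into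 which fresh copies of $\rho_{\mathcal D}$ can be loaded and on which single-qubit gates (Hadamard and $\pi/8$ gates) and computational basis measurements of single qubits can be performed. -/

import Mathlib

noncomputable section

namespace AgnosticFourier

/-! ### Boolean Fourier analysis and labelled distributions -/

/-- The hypercube `{0,1}^n` (`true` is `1`). -/
abbrev Cube (n : ℕ) : Type := Fin n → Bool

/-- The expectation of `f x` for `x` uniform on `{0,1}^n`. -/
def unifExp {n : ℕ} (f : Cube n → ℝ) : ℝ := (∑ x, f x) / 2 ^ n

/-- The parity function `χ_s x = (-1)^(s·x)`. -/
def parity {n : ℕ} (s x : Cube n) : ℝ :=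
  (-1) ^ (Finset.univ.filter fun i => s i = true ∧ x i = true).card

/-- The Fourier coefficient of `f` at `s`. -/
def fourierCoeff {n : ℕ} (f : Cube n → ℝ) (s : Cube n) : ℝ :=
  unifExp fun x => f x * parity s x

/-- The input marginal of `D`. -/
def marginal {n : ℕ} (D : PMF (Cube n × Bool)) (x : Cube n) : ℝ :=
  (D.map Prod.fst x).toReal

/-- The conditional expectation of the `{0,1}`-valued label given the input. -/
def labelMean {n : ℕ} (D : PMF (Cube n × Bool)) (x : Cube n) : ℝ :=
  (D (x, true)).toReal / marginal D x

/-- The conditional expectation of the `{-1,1}`-valued label given the input, where the label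
`0` is renamed `1` and the label `1` is renamed `-1`. -/
def signMean {n : ℕ} (D : PMF (Cube n × Bool)) (x : Cube n) : ℝ :=
  1 - 2 * labelMean D x

/-! ### Qubits and mixture-of-superpositions examples -/

/-- Operators on `q` qubits, as matrices in the computational basis. -/
abbrev QOp (q : ℕ) : Type := Matrix (Cube q) (Cube q) ℂ

/-- The amplitudes of `∑ x, √(D_X x) |x, f x⟩`; the last of the `n + 1` qubits carries the
label. -/
def superposition {n : ℕ} (D : PMF (Cube n × Bool)) (f : Cube n → Bool) :
    Cube (n + 1) → ℂ :=
  fun v => if v (Fin.last n) = f (Fin.init v)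
    then ((Real.sqrt (marginal D (Fin.init v)) : ℝ) : ℂ) else 0

/-- The probability of `f` when the labels `f x` are drawn independently from the conditional
label distributions of `D`. -/
def functionWeight {n : ℕ} (D : PMF (Cube n × Bool)) (f : Cube n → Bool) : ℝ :=
  ∏ x, if f x = true then labelMean D x else 1 - labelMean D x

/-- The mixture-of-superpositions example
`ρ_D = 𝔼_f |ψ_f⟩⟨ψ_f|`, an `(n + 1)`-qubit density matrix. -/
def mixtureExample {n : ℕ} (D : PMF (Cube n × Bool)) : QOp (n + 1) :=
  ∑ f : Cube n → Bool, ((functionWeight D f : ℝ) : ℂ) •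
    Matrix.vecMulVec (superposition D f) (star (superposition D f))

/-- The available single-qubit gates: the Hadamard gate and the `π/8` gate. -/
inductive Gate : Type
  | hadamard
  | piEighth

/-- The unitary of a gate. -/
def Gate.toMatrix : Gate → Matrix Bool Bool ℂ
  | .hadamard => Matrix.of fun a b =>
      (if a = true ∧ b = true then -1 else 1) * (((Real.sqrt 2)⁻¹ : ℝ) : ℂ)
  | .piEighth => Matrix.diagonal fun a =>
      if a = true then Complex.exp (Complex.I * (Real.pi / 4)) else 1

/-- The operator that acts as `U` on qubit `i` and as the identity on all others. -/
def onQubit {q : ℕ} (i : Fin q) (U : Matrix Bool Bool ℂ) : QOp q :=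
  Matrix.of fun v w => if ∀ j, j ≠ i → v j = w j then U (v i) (w i) else 0

/-- The projection onto the basis vectors whose qubit `i` has value `b`. -/
def qubitProj {q : ℕ} (i : Fin q) (b : Bool) : QOp q :=
  Matrix.diagonal fun v => if v i = b then 1 else 0

/-- The state `|0…0⟩⟨0…0|`. -/
def zeroState (q : ℕ) : QOp q :=
  Matrix.diagonal fun v => if v = fun _ => false then 1 else 0

/-! ### A word RAM that controls a quantum register

A program has `K` scalar variables and `K` arrays of natural numbers and controls one register
of `n + 1` qubits. The problem size `n` and the individual binary digits of the parameters `ε`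
and `δ` can be read by instructions. The only way to learn about `D` is to put a fresh copy of
`ρ_D` into the register, to apply single-qubit gates, and to measure qubits in the computational
basis. -/

/-- The arithmetic operations; comparisons return `1` or `0`. -/
inductive BinOp : Type
  | add | sub | mul | div | mod | lt | eq

/-- The value of an operation (subtraction is truncated, division is rounded down). -/
def BinOp.eval : BinOp → ℕ → ℕ → ℕ
  | .add, a, b => a + b
  | .sub, a, b => a - b
  | .mul, a, b => a * b
  | .div, a, b => a / b
  | .mod, a, b => a % b
  | .lt, a, b => if a < b then 1 else 0
  | .eq, a, b => if a = b then 1 else 0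

/-- Elementary instructions. Names of variables and arrays are constants of the program. -/
inductive Instr (K : ℕ) : Type
  /-- `x := c` -/
  | const (x : Fin K) (c : ℕ)
  /-- `x := n` -/
  | size (x : Fin K)
  /-- `x :=` the digit of weight `2^(-y)` of `ε` -/
  | epsDigit (x y : Fin K)
  /-- `x :=` the digit of weight `2^(-y)` of `δ` -/
  | deltaDigit (x y : Fin K)
  /-- `x := y o z` -/
  | op (o : BinOp) (x y z : Fin K)
  /-- `x := A[y]` -/
  | read (x A y : Fin K)
  /-- `A[y] := x` -/
  | write (A y x : Fin K)
  /-- discard the register and replace it by a fresh copy of `ρ_D` -/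
  | fresh
  /-- apply the gate `g` to qubit number `y` -/
  | gate (g : Gate) (y : Fin K)
  /-- measure qubit number `y` and store the outcome in `x` -/
  | measure (x y : Fin K)

/-- Programs; a test `x` succeeds when the value of `x` is not `0`. -/
inductive Cmd (K : ℕ) : Type
  | prim (i : Instr K)
  | seq (c d : Cmd K)
  | ite (x : Fin K) (c d : Cmd K)
  | loop (x : Fin K) (c : Cmd K)

/-- A configuration on one branch of measurement outcomes. -/
structure State (K n : ℕ) where
  /-- the commands that are still to be executed; the machine has halted when there are none -/
  todo : List (Cmd K)
  /-- the scalar variables -/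
  var : Fin K → ℕ
  /-- the arrays -/
  arr : Fin K → ℕ → ℕ
  /-- for every array, `1 +` the largest index written so far (`0` if there is none) -/
  used : Fin K → ℕ
  /-- the state of the quantum register, with the probability of the branch as its trace -/
  reg : QOp (n + 1)
  /-- the number of copies of `ρ_D` used so far -/
  copies : ℕ
  /-- the number of single-qubit gates used so far -/
  gates : ℕ

namespace State

variable {K n : ℕ}

/-- Assign a value to a scalar variable. -/
def setVar (s : State K n) (x : Fin K) (a : ℕ) : State K n :=
  { s with var := Function.update s.var x a }

/-- Assign a value to an array cell. -/
def setArr (s : State K n) (A : Fin K) (i a : ℕ) : State K n :=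
  { s with
    arr := Function.update s.arr A (Function.update (s.arr A) i a)
    used := Function.update s.used A (max (s.used A) (i + 1)) }

/-- The probability of the branch. -/
def weight (s : State K n) : ℝ := s.reg.trace.re

/-- The number of bits of classical memory in use: every scalar variable and every cell of an
array up to the largest index written is charged one plus the length of its binary
representation. -/
def space (s : State K n) : ℕ :=
  (∑ x, (Nat.size (s.var x) + 1)) +
    ∑ A, ∑ i ∈ Finset.range (s.used A), (Nat.size (s.arr A i) + 1)

/-- All numbers in memory have at most `w` binary digits. -/
def FitsWords (s : State K n) (w : ℝ) : Prop :=
  (∀ x, (Nat.size (s.var x) : ℝ) ≤ w) ∧ ∀ A i, (Nat.size (s.arr A i) : ℝ) ≤ w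

end State

/-- The binary digit of weight `2^(-i)` of a number in `(0,1)`. -/
def digit (r : ℝ) (i : ℕ) : ℕ := ⌊r * 2 ^ i⌋₊ % 2

/-- The branches after one instruction: two for a measurement, one for anything else. Gates and
measurements on a qubit that does not exist do nothing to the register. -/
def Instr.exec {K n : ℕ} (D : PMF (Cube n × Bool)) (ε δ : ℝ) (i : Instr K)
    (s : State K n) : List (State K n) :=
  match i with
  | .const x c => [s.setVar x c]
  | .size x => [s.setVar x n]
  | .epsDigit x y => [s.setVar x (digit ε (s.var y))]
  | .deltaDigit x y => [s.setVar x (digit δ (s.var y))]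
  | .op o x y z => [s.setVar x (o.eval (s.var y) (s.var z))]
  | .read x A y => [s.setVar x (s.arr A (s.var y))]
  | .write A y x => [s.setArr A (s.var y) (s.var x)]
  | .fresh =>
      [{ s with reg := s.reg.trace • mixtureExample D, copies := s.copies + 1 }]
  | .gate g y =>
      if h : s.var y < n + 1 then
        let G := onQubit ⟨s.var y, h⟩ g.toMatrix
        [{ s with reg := G * s.reg * G.conjTranspose, gates := s.gates + 1 }]
      else [s]
  | .measure x y =>
      if h : s.var y < n + 1 then
        [false, true].map fun b =>
          let P := qubitProj ⟨s.var y, h⟩ b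
          { s.setVar x b.toNat with reg := P * s.reg * P }
      else [s.setVar x 0]

/-- The branches after one time step; nothing changes after halting. -/
def step {K n : ℕ} (D : PMF (Cube n × Bool)) (ε δ : ℝ) (s : State K n) :
    List (State K n) :=
  match s.todo with
  | [] => [s]
  | .prim i :: r => i.exec D ε δ { s with todo := r }
  | .seq c d :: r => [{ s with todo := c :: d :: r }]
  | .ite x c d :: r => [{ s with todo := (if s.var x ≠ 0 then c else d) :: r }]
  | .loop x c :: r => [{ s with todo := if s.var x ≠ 0 then c :: .loop x c :: r else r }]

/-- The branches after `t` time steps. -/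
def branches {K n : ℕ} (D : PMF (Cube n × Bool)) (ε δ : ℝ) :
    ℕ → State K n → List (State K n)
  | 0, s => [s]
  | t + 1, s => (step D ε δ s).flatMap (branches D ε δ t)

/-- The probability that the configuration after `t` time steps lies in `E`. -/
def prob {K n : ℕ} (D : PMF (Cube n × Bool)) (ε δ : ℝ) (t : ℕ) (s : State K n)
    (E : Set (State K n)) : ℝ :=
  ((branches D ε δ t s).map (E.indicator State.weight)).sum

/-- A program, together with the names of the variable and of the arrays that hold its
output: a list of pairs of a string and a number. -/
structure Algorithm (K : ℕ) where
  /-- the program -/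
  body : Cmd K
  /-- the variable that holds the number of entries of the list -/
  len : Fin K
  /-- the array of the strings: bit `j` of the `i`-th string is in cell `i * n + j` -/
  key : Fin K
  /-- the `i`-th number is `(pos[i] - neg[i]) / den[i]` -/
  pos : Fin K
  /-- see `pos` -/
  neg : Fin K
  /-- see `pos` -/
  den : Fin K

namespace Algorithm

variable {K : ℕ}

/-- The initial configuration. -/
def init (A : Algorithm K) (n : ℕ) : State K n where
  todo := [A.body]
  var := fun _ => 0
  arr := fun _ _ => 0
  used := fun _ => 0
  reg := zeroState (n + 1)
  copies := 0
  gates := 0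

/-- The `i`-th string of the output list. -/
def entryKey (A : Algorithm K) {n : ℕ} (s : State K n) (i : ℕ) : Cube n :=
  fun j => decide (s.arr A.key (i * n + j) ≠ 0)

/-- The `i`-th number of the output list. -/
def entryValue (A : Algorithm K) {n : ℕ} (s : State K n) (i : ℕ) : ℝ :=
  ((s.arr A.pos i : ℝ) - s.arr A.neg i) / s.arr A.den i

/-- The function represented by the output list: it vanishes at all strings that are not
listed. -/
def output (A : Algorithm K) {n : ℕ} (s : State K n) (t : Cube n) : ℝ :=
  ∑ i ∈ Finset.range (s.var A.len), if A.entryKey s i = t then A.entryValue s i else 0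

end Algorithm

/-! ### Complexity bounds -/

/-- `log (2 / (δ ε²)) / ε⁴`. -/
def copyBound (ε δ : ℝ) : ℝ := Real.log (2 / (δ * ε ^ 2)) / ε ^ 4

/-- The quantity whose powers are suppressed by soft-O notation; it is logarithmic in `1 / ε`,
doubly logarithmic in `1 / δ`, and independent of `n`. -/
def softFactor (ε δ : ℝ) : ℝ :=
  1 + Real.log (1 / ε) + Real.log (1 + Real.log (1 / δ))

end AgnosticFourier

end

/-! The learner takes Fourier samples to find candidate strings and ordinary samples to estimate
their coefficients. Let `a` and `d` be the positions of the first nonzero binary digits of `ε` and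
`δ`, and put `S = 2^a` and `L = d + 2a`, so that `1/S ≤ ε < 2/S` and `2^(-d) ≤ δ`. There are `k = 8
S²` slots, and each of the two phases uses `M = 256 S² L` copies.

Search. If Hadamard gates are applied to all qubits of a copy, the outcome `(s, 1)` has probability
`½ 𝔼_f[ĝ_f(s)²]` with `g_f = (-1)^f`. Since `𝔼_f[ĝ_f(s)] = φ̂(s)`, nonnegativity of the variance
bounds this below by `φ̂(s)²/2` (`le_outcomeProb_hadamard`). Call `s` heavy if `|φ̂(s)| ≥ 1/S`. By
Parseval there are at most `S²` heavy strings, each with outcome probability at least `1/(2S²)`. A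
Chernoff and union bound shows that outside an event of probability at most `δ/2` each of them
occurs more than `32 L = M/k` times (`search_success`). A Misra-Gries summary with `k` counters
keeps every string that occurs this often (`Summary.exists_of_lt_hits`), so that only `O(nk)` cells
are needed and one sample costs `O(nk)` steps.

Estimation. Measured without gates, a copy is an ordinary labelled example, and its label sign times
the parity is an unbiased estimate of `φ̂(s)`. With probability at least `1 - δ/2` all `k` empirical
means are within `1/(4S)` of their targets (`estimate_success`).

Output. An active slot is listed if its mean has absolute value at least `3/(4S)`. A listed string
then has `|φ̂| ≥ 1/(2S) ≥ ε/4`, and Parseval limits the length of the list to `16 𝔼[φ²]/ε²`. An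
unlisted string has `|φ̂| ≤ ε`: otherwise it would be heavy, hence captured, with a mean of at least
`1/S - 1/(4S)` in absolute value (`mem_success`).

The program is verified in two layers. Its classical code is deterministic and is handled by a
weakest precondition calculus with a clock and resource bounds (`Cmd.wp`). The predicate `Ok` covers
branching: it bounds resources on every branch and the total weight of the successful ones. As the
register is unnormalized, its trace is the weight of the branch, so measuring a copy averages the
guarantee of the continuation over the outcome distribution. Iteration gives `sampleExp`, and
`learner_ok` combines the two phases to `(1 - δ/2)² ≥ 1 - δ`. The time is of order `nMk`, and `Mk`
is of order `S⁴ L`, which is `O(log(2/(δε²))/ε⁴)`. -/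

noncomputable section

namespace AgnosticFourier

/-! ### Weakest preconditions of classical programs -/

/-- A configuration without the remaining commands and the quantum register, together with the
time elapsed so far. -/
structure Conf (K : ℕ) where
  /-- the scalar variables -/
  var : Fin K → ℕ
  /-- the arrays -/
  arr : Fin K → ℕ → ℕ
  /-- the used length of every array -/
  used : Fin K → ℕ
  /-- the number of copies used so far -/
  copies : ℕ
  /-- the number of gates used so far -/
  gates : ℕ
  /-- the time elapsed so far -/
  time : ℕ

/-- Bounds on the resources of a computation. -/
structure Limits where
  /-- a bound on the scalar variables -/
  word : ℕ
  /-- a bound on the array entries -/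
  cell : ℕ
  /-- a bound on the lengths of the arrays -/
  len : ℕ
  /-- a bound on the number of copies -/
  copies : ℕ
  /-- a bound on the number of gates -/
  gates : ℕ
  one_le_cell : 1 ≤ cell
  cell_le_word : cell ≤ word

/-- The state `s` respects the bounds `β`. -/
def Limits.Holds {K n : ℕ} (β : Limits) (s : State K n) : Prop :=
  (∀ x, s.var x ≤ β.word) ∧ (∀ A i, s.arr A i ≤ β.cell) ∧ (∀ A, s.used A ≤ β.len) ∧
    s.copies ≤ β.copies ∧ s.gates ≤ β.gates

theorem Limits.one_le_word (β : Limits) : 1 ≤ β.word :=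
  β.one_le_cell.trans β.cell_le_word

namespace Conf

variable {K n : ℕ}

/-- Add the remaining commands and the quantum register. -/
def toState (σ : Conf K) (r : List (Cmd K)) (ρ : QOp (n + 1)) : State K n :=
  ⟨r, σ.var, σ.arr, σ.used, ρ, σ.copies, σ.gates⟩

/-- Let one unit of time pass. -/
def tick (σ : Conf K) : Conf K := { σ with time := σ.time + 1 }

/-- Assign a value to a scalar variable in one unit of time. -/
def setVar (σ : Conf K) (x : Fin K) (a : ℕ) : Conf K :=
  { σ with var := Function.update σ.var x a, time := σ.time + 1 }

/-- Assign a value to an array cell in one unit of time. -/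
def setArr (σ : Conf K) (A : Fin K) (i a : ℕ) : Conf K :=
  { σ with
    arr := Function.update σ.arr A (Function.update (σ.arr A) i a)
    used := Function.update σ.used A (max (σ.used A) (i + 1))
    time := σ.time + 1 }

/-- The configuration `σ` respects the bounds `β`. -/
def Within (σ : Conf K) (β : Limits) : Prop :=
  (∀ x, σ.var x ≤ β.word) ∧ (∀ A i, σ.arr A i ≤ β.cell) ∧ (∀ A, σ.used A ≤ β.len) ∧
    σ.copies ≤ β.copies ∧ σ.gates ≤ β.gates

@[simp] theorem tick_var (σ : Conf K) : σ.tick.var = σ.var := rfl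
@[simp] theorem tick_arr (σ : Conf K) : σ.tick.arr = σ.arr := rfl
@[simp] theorem tick_used (σ : Conf K) : σ.tick.used = σ.used := rfl
@[simp] theorem tick_copies (σ : Conf K) : σ.tick.copies = σ.copies := rfl
@[simp] theorem tick_gates (σ : Conf K) : σ.tick.gates = σ.gates := rfl
@[simp] theorem tick_time (σ : Conf K) : σ.tick.time = σ.time + 1 := rfl

@[simp] theorem setVar_var (σ : Conf K) (x a) :
    (σ.setVar x a).var = Function.update σ.var x a := rfl
@[simp] theorem setVar_arr (σ : Conf K) (x a) : (σ.setVar x a).arr = σ.arr := rfl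
@[simp] theorem setVar_copies (σ : Conf K) (x a) : (σ.setVar x a).copies = σ.copies := rfl
@[simp] theorem setVar_gates (σ : Conf K) (x a) : (σ.setVar x a).gates = σ.gates := rfl
@[simp] theorem setVar_time (σ : Conf K) (x a) : (σ.setVar x a).time = σ.time + 1 := rfl

@[simp] theorem setArr_var (σ : Conf K) (A i a) : (σ.setArr A i a).var = σ.var := rfl
@[simp] theorem setArr_arr (σ : Conf K) (A i a) :
    (σ.setArr A i a).arr = Function.update σ.arr A (Function.update (σ.arr A) i a) := rfl
@[simp] theorem setArr_copies (σ : Conf K) (A i a) : (σ.setArr A i a).copies = σ.copies := rfl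
@[simp] theorem setArr_gates (σ : Conf K) (A i a) : (σ.setArr A i a).gates = σ.gates := rfl
@[simp] theorem setArr_time (σ : Conf K) (A i a) : (σ.setArr A i a).time = σ.time + 1 := rfl

theorem Within.tick {σ : Conf K} {β : Limits} (h : σ.Within β) : σ.tick.Within β := h

theorem Within.setVar {σ : Conf K} {β : Limits} (h : σ.Within β) {a : ℕ} (ha : a ≤ β.word)
    (x : Fin K) : (σ.setVar x a).Within β := by
  refine ⟨fun y => ?_, h.2⟩
  rw [setVar_var, Function.update_apply]
  split_ifs
  exacts [ha, h.1 y]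

theorem Within.setArr {σ : Conf K} {β : Limits} (h : σ.Within β) {i a : ℕ} (ha : a ≤ β.cell)
    (hi : i + 1 ≤ β.len) (A : Fin K) : (σ.setArr A i a).Within β := by
  refine ⟨h.1, fun B j => ?_, fun B => ?_, h.2.2.2⟩
  · simp only [setArr_arr, Function.update_apply]
    split_ifs
    · rw [Function.update_apply]
      split_ifs
      exacts [ha, h.2.1 _ _]
    · exact h.2.1 _ _
  · simp only [Conf.setArr, Function.update_apply]
    split_ifs
    exacts [max_le (h.2.2.1 _) hi, h.2.2.1 _]

end Conf

/-- The result of an operation is bounded by `w` if its operands are; for sums and products this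
is a requirement. -/
def BinOp.Fits (o : BinOp) (w a b : ℕ) : Prop :=
  match o with
  | .add => a + b ≤ w
  | .mul => a * b ≤ w
  | _ => True

theorem BinOp.Fits.eval_le {o : BinOp} {w a b : ℕ} (h : o.Fits w a b) (hw : 1 ≤ w)
    (ha : a ≤ w) : o.eval a b ≤ w := by
  cases o <;> simp only [BinOp.Fits, BinOp.eval] at h ⊢
  · exact h
  · omega
  · exact h
  · exact (Nat.div_le_self _ _).trans ha
  · exact (Nat.mod_le _ _).trans ha
  · split_ifs <;> omega
  · split_ifs <;> omega

theorem digit_le_one (r : ℝ) (i : ℕ) : digit r i ≤ 1 := by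
  unfold digit
  omega

section wp

variable {K : ℕ} (n : ℕ) (ε δ : ℝ) (β : Limits)

/-- The weakest precondition of a classical instruction. -/
def Instr.wp (i : Instr K) (Q : Conf K → Prop) (σ : Conf K) : Prop :=
  match i with
  | .const x c => c ≤ β.word ∧ Q (σ.setVar x c)
  | .size x => n ≤ β.word ∧ Q (σ.setVar x n)
  | .epsDigit x y => Q (σ.setVar x (digit ε (σ.var y)))
  | .deltaDigit x y => Q (σ.setVar x (digit δ (σ.var y)))
  | .op o x y z =>
      o.Fits β.word (σ.var y) (σ.var z) ∧ Q (σ.setVar x (o.eval (σ.var y) (σ.var z)))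
  | .read x A y => Q (σ.setVar x (σ.arr A (σ.var y)))
  | .write A y x =>
      σ.var x ≤ β.cell ∧ σ.var y + 1 ≤ β.len ∧ Q (σ.setArr A (σ.var y) (σ.var x))
  | .fresh => False
  | .gate _ _ => False
  | .measure _ _ => False

/-- The weakest precondition of a classical program with respect to termination in a
configuration that satisfies `Q`, while all bounds of `β` are respected. -/
def Cmd.wp : Cmd K → (Conf K → Prop) → Conf K → Prop
  | .prim i, Q, σ => i.wp n ε δ β Q σ
  | .seq c d, Q, σ => c.wp (d.wp Q) σ.tick
  | .ite x c d, Q, σ => (σ.var x ≠ 0 → c.wp Q σ.tick) ∧ (σ.var x = 0 → d.wp Q σ.tick)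
  | .loop x c, Q, σ =>
      ∃ m, (fun R σ => σ.var x ≠ 0 ∧ c.wp R (Conf.tick σ))^[m]
        (fun σ => σ.var x = 0 ∧ Q σ.tick) σ

/-- The instruction assigns a value to the variable `y`. -/
def Instr.assigns (i : Instr K) (y : Fin K) : Bool :=
  match i with
  | .const x _ | .size x | .epsDigit x _ | .deltaDigit x _ | .op _ x _ _ | .read x _ _
  | .measure x _ => x == y
  | _ => false

/-- The program may assign a value to the variable `y`. -/
def Cmd.assigns : Cmd K → Fin K → Bool
  | .prim i, y => i.assigns y
  | .seq c d, y => c.assigns y || d.assigns y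
  | .ite _ c d, y => c.assigns y || d.assigns y
  | .loop _ c, y => c.assigns y

/-- The instruction writes to the array `B`. -/
def Instr.writes (i : Instr K) (B : Fin K) : Bool :=
  match i with
  | .write A _ _ => A == B
  | _ => false

/-- The program may write to the array `B`. -/
def Cmd.writes : Cmd K → Fin K → Bool
  | .prim i, y => i.writes y
  | .seq c d, y => c.writes y || d.writes y
  | .ite _ c d, y => c.writes y || d.writes y
  | .loop _ c, y => c.writes y

/-- The configurations `σ` and `σ'` agree on all that `c` does not change. -/
structure Frame (c : Cmd K) (σ σ' : Conf K) : Prop where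
  var : ∀ y, c.assigns y = false → σ'.var y = σ.var y
  arr : ∀ A, c.writes A = false → σ'.arr A = σ.arr A
  copies : σ'.copies = σ.copies
  gates : σ'.gates = σ.gates

variable {n ε δ β}

theorem Frame.refl (c : Cmd K) (σ : Conf K) : Frame c σ σ :=
  ⟨fun _ _ => rfl, fun _ _ => rfl, rfl, rfl⟩

theorem Frame.trans {c : Cmd K} {σ σ' σ'' : Conf K} (h : Frame c σ σ') (h' : Frame c σ' σ'') :
    Frame c σ σ'' :=
  ⟨fun y hy => (h'.var y hy).trans (h.var y hy), fun A hA => (h'.arr A hA).trans (h.arr A hA),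
    h'.copies.trans h.copies, h'.gates.trans h.gates⟩

theorem Frame.mono {c d : Cmd K} {σ σ' : Conf K} (h : Frame c σ σ')
    (hv : ∀ y, d.assigns y = false → c.assigns y = false)
    (ha : ∀ y, d.writes y = false → c.writes y = false) : Frame d σ σ' :=
  ⟨fun y hy => h.var y (hv y hy), fun A hA => h.arr A (ha A hA), h.copies, h.gates⟩

theorem Instr.wp_mono {i : Instr K} {Q R : Conf K → Prop} (hQR : ∀ σ, Q σ → R σ) {σ : Conf K}
    (h : i.wp n ε δ β Q σ) : i.wp n ε δ β R σ := by
  cases i <;> simp only [Instr.wp] at h ⊢ <;> grind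

theorem Cmd.wp_mono {c : Cmd K} {Q R : Conf K → Prop} {σ : Conf K}
    (h : c.wp n ε δ β Q σ) (hQR : ∀ σ, Q σ → R σ) : c.wp n ε δ β R σ := by
  induction c generalizing Q R σ with
  | prim i => exact Instr.wp_mono hQR h
  | seq c d hc hd => exact hc h fun σ hσ => hd hσ hQR
  | ite x c d hc hd => exact ⟨fun hx => hc (h.1 hx) hQR, fun hx => hd (h.2 hx) hQR⟩
  | loop x c hc =>
    obtain ⟨m, h⟩ := h
    refine ⟨m, ?_⟩
    induction m generalizing σ with
    | zero => exact ⟨h.1, hQR _ h.2⟩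
    | succ m ih =>
      rw [Function.iterate_succ_apply'] at h ⊢
      exact ⟨h.1, hc h.2 fun σ hσ => ih hσ⟩

theorem Instr.wp_frame {i : Instr K} {Q : Conf K → Prop} {σ : Conf K}
    (h : i.wp n ε δ β Q σ) :
    i.wp n ε δ β (fun σ' => Q σ' ∧ Frame (.prim i) σ σ') σ := by
  have hv : ∀ x a, i.assigns x = true → Frame (.prim i) σ (σ.setVar x a) := fun x a hx => by
    refine ⟨fun y hy => ?_, fun _ _ => rfl, rfl, rfl⟩
    have : y ≠ x := by
      rintro rfl
      simp only [Cmd.assigns] at hy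
      simp [hx] at hy
    simp [Function.update_of_ne this]
  have ha : ∀ A j a, i.writes A = true → Frame (.prim i) σ (σ.setArr A j a) := fun A j a hx => by
    refine ⟨fun _ _ => rfl, fun y hy => ?_, rfl, rfl⟩
    have : y ≠ A := by
      rintro rfl
      simp only [Cmd.writes] at hy
      simp [hx] at hy
    simp [Function.update_of_ne this]
  cases i <;> simp only [Instr.wp] at h ⊢
  case write =>
    exact ⟨h.1, h.2.1, h.2.2, ha _ _ _ (by simp [Instr.writes])⟩
  all_goals first
    | exact ⟨h, hv _ _ (by simp [Instr.assigns])⟩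
    | exact ⟨h.1, h.2, hv _ _ (by simp [Instr.assigns])⟩

theorem Frame.tick_left {c : Cmd K} {σ σ' : Conf K} (h : Frame c σ.tick σ') : Frame c σ σ' :=
  ⟨h.var, h.arr, h.copies, h.gates⟩

/-- Specifications can then mention only what a program changes. Everything else is recovered from
the syntactic tests `assigns` and `writes`, which evaluate by `rfl`. -/
theorem Cmd.wp_frame {c : Cmd K} {Q : Conf K → Prop} {σ : Conf K} (h : c.wp n ε δ β Q σ) :
    c.wp n ε δ β (fun σ' => Q σ' ∧ Frame c σ σ') σ := by
  induction c generalizing Q σ with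
  | prim i => exact Instr.wp_frame h
  | seq c d hc hd =>
    refine wp_mono (c := c) (hc h) fun σ' h' => wp_mono (hd h'.1) fun σ'' h'' => ⟨h''.1, ?_⟩
    refine Frame.trans (σ' := σ') (h'.2.tick_left.mono ?_ ?_) (h''.2.mono ?_ ?_) <;>
      simp +contextual [Cmd.assigns, Cmd.writes]
  | ite x c d hc hd =>
    refine ⟨fun hx => wp_mono (hc (h.1 hx)) fun σ' h' => ⟨h'.1, ?_⟩,
      fun hx => wp_mono (hd (h.2 hx)) fun σ' h' => ⟨h'.1, ?_⟩⟩ <;>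
    · refine h'.2.tick_left.mono ?_ ?_ <;> simp +contextual [Cmd.assigns, Cmd.writes]
  | loop x c hc =>
    obtain ⟨m, h⟩ := h
    -- The frame is measured from the configuration `σ₀` at loop entry, which stays fixed while the
    -- induction moves `σ`.
    suffices H : ∀ σ₀, Frame c σ₀ σ → (fun R σ => σ.var x ≠ 0 ∧ c.wp n ε δ β R (Conf.tick σ))^[m]
        (fun σ => σ.var x = 0 ∧ Q σ.tick ∧ Frame (.loop x c) σ₀ σ.tick) σ from
      ⟨m, H σ (Frame.refl _ _)⟩
    induction m generalizing σ with
    | zero => exact fun σ₀ h₀ => ⟨h.1, h.2, h₀.var, h₀.arr, h₀.copies, h₀.gates⟩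
    | succ m ih =>
      intro σ₀ h₀
      rw [Function.iterate_succ_apply'] at h ⊢
      exact ⟨h.1, wp_mono (hc h.2) fun σ' h' => ih h'.1 _ (h₀.trans h'.2.tick_left)⟩

theorem Cmd.wp_and_frame {c : Cmd K} {Q R : Conf K → Prop} {σ : Conf K}
    (h : c.wp n ε δ β Q σ) (hR : ∀ σ', Q σ' → Frame c σ σ' → R σ') : c.wp n ε δ β R σ :=
  wp_mono (wp_frame h) fun σ' h' => hR σ' h'.1 h'.2

/-- The index of the invariant is the number of rounds still to come, so it also serves as the
termination measure. -/
theorem Cmd.wp_loop {x : Fin K} {c : Cmd K} {Q : Conf K → Prop} (I : ℕ → Conf K → Prop)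
    (hstep : ∀ m σ, I (m + 1) σ → σ.var x ≠ 0 ∧ c.wp n ε δ β (I m) σ.tick)
    (hzero : ∀ σ, I 0 σ → σ.var x = 0 ∧ Q σ.tick) {m : ℕ} {σ : Conf K} (h : I m σ) :
    (Cmd.loop x c).wp n ε δ β Q σ := by
  refine ⟨m, ?_⟩
  induction m generalizing σ with
  | zero => exact hzero σ h
  | succ m ih =>
    rw [Function.iterate_succ_apply']
    exact ⟨(hstep m σ h).1, wp_mono (hstep m σ h).2 fun σ' h' => ih h'⟩

/-- Repeat `c` while the variable `x` counts down to `0`; the variable `o` has the value `1`. -/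
def forLoop (o x : Fin K) (c : Cmd K) : Cmd K :=
  .loop x (.seq (.prim (.op .sub x x o)) c)

/-- The configuration in which the body of a loop is entered. -/
def Conf.enter (σ : Conf K) (x : Fin K) (j : ℕ) : Conf K :=
  { σ with var := Function.update σ.var x j, time := σ.time + 3 }

@[simp] theorem Conf.enter_var (σ : Conf K) (x a) :
    (σ.enter x a).var = Function.update σ.var x a := rfl
@[simp] theorem Conf.enter_arr (σ : Conf K) (x a) : (σ.enter x a).arr = σ.arr := rfl
@[simp] theorem Conf.enter_time (σ : Conf K) (x a) : (σ.enter x a).time = σ.time + 3 := rfl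
@[simp] theorem Conf.enter_copies (σ : Conf K) (x a) : (σ.enter x a).copies = σ.copies := rfl
@[simp] theorem Conf.enter_gates (σ : Conf K) (x a) : (σ.enter x a).gates = σ.gates := rfl

/-- The body runs with counter values `N - 1, …, 0`, hence `I j` describes the situation when the
indices from `j` on have been processed. Each round has an overhead of three steps (test,
sequencing, decrement), and the last failing test costs one more, which is why `I 0` has to survive
a tick. -/
theorem Cmd.wp_forLoop {o x : Fin K} {c : Cmd K} {σ : Conf K} (I : ℕ → Conf K → Prop) {N τ : ℕ}
    (ho : σ.var o = 1) (hN : σ.var x = N)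
    (hfo : (forLoop o x c).assigns o = false) (hfx : c.assigns x = false)
    (hI : ∀ σ, I 0 σ → I 0 σ.tick)
    (hbody : ∀ j σ', j < N → Frame (forLoop o x c) σ σ' → I (j + 1) σ' →
      c.wp n ε δ β (fun σ'' => I j σ'' ∧ σ''.time ≤ σ'.time + 3 + τ) (σ'.enter x j))
    (h : I N σ) :
    (forLoop o x c).wp n ε δ β
      (fun σ' => I 0 σ' ∧ σ'.time ≤ σ.time + N * (τ + 3) + 1) σ := by
  refine wp_loop (fun m σ' => (Frame (forLoop o x c) σ σ' ∧ σ'.var x = m) ∧ m ≤ N ∧ I m σ' ∧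
    σ'.time + m * (τ + 3) ≤ σ.time + N * (τ + 3)) ?_ ?_
    (m := N) ⟨⟨Frame.refl _ _, hN⟩, le_rfl, h, le_rfl⟩
  · rintro m σ' ⟨⟨hF, hx⟩, hm, hI', ht⟩
    refine ⟨by omega, trivial, ?_⟩
    have ho' : σ'.var o = 1 := (hF.var o hfo).trans ho
    have he : σ'.tick.tick.setVar x
        (BinOp.sub.eval (σ'.tick.tick.var x) (σ'.tick.tick.var o)) = σ'.enter x m := by
      simp [BinOp.eval, hx, ho', Conf.enter, Conf.setVar, Conf.tick]
    rw [he]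
    refine wp_and_frame (hbody m σ' hm hF hI') fun σ'' h'' hF' => ⟨⟨hF.trans ?_, ?_⟩, ?_, h''.1, ?_⟩
    · refine ⟨fun y hy => ?_, fun A hA => ?_, hF'.copies, hF'.gates⟩
      · simp only [forLoop, Cmd.assigns, Instr.assigns, Bool.or_eq_false_iff,
          beq_eq_false_iff_ne] at hy
        rw [hF'.var y hy.2, Conf.enter_var, Function.update_of_ne (Ne.symm hy.1)]
      · simp only [forLoop, Cmd.writes, Bool.or_eq_false_iff] at hA
        exact hF'.arr A hA.2
    · simp [hF'.var x hfx]
    · omega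
    · have := h''.2
      rw [add_mul] at ht
      omega
  · rintro σ' ⟨⟨hF, hx⟩, hm, hI', ht⟩
    exact ⟨hx, hI _ hI', by simp; omega⟩

end wp

/-! ### Programs that use the quantum register -/

section Ok

variable {K n : ℕ}

theorem branches_of_todo_eq_nil (D : PMF (Cube n × Bool)) (ε δ : ℝ) {s : State K n}
    (hs : s.todo = []) (t : ℕ) : branches D ε δ t s = [s] := by
  induction t with
  | zero => rfl
  | succ t ih =>
    have : step D ε δ s = [s] := by simp [step, hs]
    simp [branches, this, ih]

variable (D : PMF (Cube n × Bool)) (ε δ : ℝ) (β : Limits) (τ : ℕ) (E : Set (State K n))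

/-- From `σ` with remaining commands `r` and quantum register `ρ`, the computation halts until
time `τ` and respects the bounds `β` on all branches, and the branches that end in `E` have total
weight at least `b`. -/
structure Ok (r : List (Cmd K)) (σ : Conf K) (ρ : QOp (n + 1)) (b : ℝ) : Prop where
  time : σ.time ≤ τ
  halts : ∀ s ∈ branches D ε δ (τ - σ.time) (σ.toState r ρ), s.todo = []
  holds : ∀ t, ∀ s ∈ branches D ε δ t (σ.toState r ρ), β.Holds s
  prob : b ≤ prob D ε δ (τ - σ.time) (σ.toState r ρ) E

variable {D ε δ β τ E}

theorem Ok.nil {σ : Conf K} {ρ : QOp (n + 1)} {b : ℝ} (hτ : σ.time ≤ τ) (hσ : σ.Within β)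
    (hb : b ≤ E.indicator State.weight (σ.toState [] ρ)) : Ok D ε δ β τ E [] σ ρ b := by
  have h := branches_of_todo_eq_nil D ε δ (s := σ.toState (n := n) [] ρ) rfl
  refine ⟨hτ, ?_, fun t => ?_, ?_⟩
  · rw [h]
    simp [Conf.toState]
  · rw [h]
    simp only [List.mem_singleton, forall_eq]
    exact hσ
  · simpa [AgnosticFourier.prob, h] using hb

theorem Ok.mono {r : List (Cmd K)} {σ : Conf K} {ρ : QOp (n + 1)} {b b' : ℝ}
    (h : Ok D ε δ β τ E r σ ρ b) (hb : b' ≤ b) : Ok D ε δ β τ E r σ ρ b' :=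
  ⟨h.time, h.halts, h.holds, hb.trans h.prob⟩

/-- All branches are examined at the common deadline `τ`, so a step just shifts the remaining time
by one. The truncated subtraction is harmless because the later configuration is still within the
deadline. -/
theorem Ok.of_step {r r' : List (Cmd K)} {σ σ' : Conf K} {ρ ρ' : QOp (n + 1)} {b : ℝ}
    (hσ : σ.Within β) (hs : step D ε δ (σ.toState r ρ) = [σ'.toState r' ρ'])
    (ht : σ'.time = σ.time + 1) (h : Ok D ε δ β τ E r' σ' ρ' b) :
    Ok D ε δ β τ E r σ ρ b := by
  have h1 := h.time
  have e : τ - σ.time = (τ - σ'.time) + 1 := by omega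
  refine ⟨by omega, ?_, ?_, ?_⟩
  · rw [e]
    simpa [branches, hs] using h.halts
  · rintro (_ | t) s hst
    · obtain rfl : s = _ := by simpa [branches] using hst
      exact hσ
    · exact h.holds t s (by simpa [branches, hs] using hst)
  · rw [e]
    simpa [AgnosticFourier.prob, branches, hs] using h.prob

/-- `prob` is a sum over branches, so the guaranteed weights of the two outcomes add up without
renormalization. -/
theorem Ok.of_step_pair {r r₀ r₁ : List (Cmd K)} {σ σ₀ σ₁ : Conf K} {ρ ρ₀ ρ₁ : QOp (n + 1)}
    {b₀ b₁ : ℝ} (hσ : σ.Within β)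
    (hs : step D ε δ (σ.toState r ρ) = [σ₀.toState r₀ ρ₀, σ₁.toState r₁ ρ₁])
    (ht₀ : σ₀.time = σ.time + 1) (ht₁ : σ₁.time = σ.time + 1)
    (h₀ : Ok D ε δ β τ E r₀ σ₀ ρ₀ b₀) (h₁ : Ok D ε δ β τ E r₁ σ₁ ρ₁ b₁) :
    Ok D ε δ β τ E r σ ρ (b₀ + b₁) := by
  have h1 := h₀.time
  have e : τ - σ.time = (τ - σ₀.time) + 1 := by omega
  have e' : τ - σ₁.time = τ - σ₀.time := by omega
  have g := h₁.halts
  have g' := h₁.prob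
  rw [e'] at g g'
  refine ⟨by omega, ?_, ?_, ?_⟩
  · rw [e]
    simp only [branches, hs, List.flatMap_cons, List.flatMap_nil, List.append_nil,
      List.mem_append]
    exact fun s hs => hs.elim (h₀.halts s) (g s)
  · rintro (_ | t) s hst
    · obtain rfl : s = _ := by simpa [branches] using hst
      exact hσ
    · simp only [branches, hs, List.flatMap_cons, List.flatMap_nil, List.append_nil,
        List.mem_append] at hst
      exact hst.elim (h₀.holds t s) (h₁.holds t s)
  · rw [e]
    simpa [AgnosticFourier.prob, branches, hs] using add_le_add h₀.prob g'

theorem Ok.seq {c d : Cmd K} {r : List (Cmd K)} {σ : Conf K} {ρ : QOp (n + 1)} {b : ℝ}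
    (hσ : σ.Within β) (h : Ok D ε δ β τ E (c :: d :: r) σ.tick ρ b) :
    Ok D ε δ β τ E (.seq c d :: r) σ ρ b :=
  .of_step (σ' := σ.tick) hσ rfl rfl h

theorem Ok.loop_zero {x : Fin K} {c : Cmd K} {r : List (Cmd K)} {σ : Conf K} {ρ : QOp (n + 1)}
    {b : ℝ} (hσ : σ.Within β) (hx : σ.var x = 0) (h : Ok D ε δ β τ E r σ.tick ρ b) :
    Ok D ε δ β τ E (.loop x c :: r) σ ρ b :=
  .of_step hσ (by simp [step, Conf.toState, hx]) rfl h

theorem Ok.loop_ne_zero {x : Fin K} {c : Cmd K} {r : List (Cmd K)} {σ : Conf K}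
    {ρ : QOp (n + 1)} {b : ℝ} (hσ : σ.Within β) (hx : σ.var x ≠ 0)
    (h : Ok D ε δ β τ E (c :: .loop x c :: r) σ.tick ρ b) :
    Ok D ε δ β τ E (.loop x c :: r) σ ρ b :=
  .of_step hσ (by simp [step, Conf.toState, hx]) rfl h

theorem Ok.prim {i : Instr K} {Q : Conf K → Prop} {r : List (Cmd K)} {σ : Conf K}
    {ρ : QOp (n + 1)} {b : ℝ} (hσ : σ.Within β) (h : i.wp n ε δ β Q σ)
    (hr : ∀ σ', Q σ' → σ'.Within β → Ok D ε δ β τ E r σ' ρ b) :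
    Ok D ε δ β τ E (.prim i :: r) σ ρ b := by
  have one := β.one_le_word
  cases i <;> simp only [Instr.wp] at h
  case write => exact .of_step hσ rfl rfl (hr _ h.2.2 (hσ.setArr h.1 h.2.1 _))
  case epsDigit =>
    exact .of_step hσ rfl rfl (hr _ h (hσ.setVar ((digit_le_one _ _).trans one) _))
  case deltaDigit =>
    exact .of_step hσ rfl rfl (hr _ h (hσ.setVar ((digit_le_one _ _).trans one) _))
  case op => exact .of_step hσ rfl rfl (hr _ h.2 (hσ.setVar (h.1.eval_le one (hσ.1 _)) _))
  case read =>
    exact .of_step hσ rfl rfl (hr _ h (hσ.setVar ((hσ.2.1 _ _).trans β.cell_le_word) _))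
  all_goals exact .of_step hσ rfl rfl (hr _ h.2 (hσ.setVar h.1 _))

/-- The bridge between the two layers: classical code neither branches nor touches the register, so
the guarantee `b` of the remaining commands passes through unchanged. -/
theorem Ok.of_wp {c : Cmd K} {Q : Conf K → Prop} {r : List (Cmd K)} {σ : Conf K}
    {ρ : QOp (n + 1)} {b : ℝ} (hσ : σ.Within β) (h : c.wp n ε δ β Q σ)
    (hr : ∀ σ', Q σ' → σ'.Within β → Frame c σ σ' → Ok D ε δ β τ E r σ' ρ b) :
    Ok D ε δ β τ E (c :: r) σ ρ b := by
  suffices H : ∀ (r : List (Cmd K)) (Q : Conf K → Prop) (σ : Conf K), σ.Within β →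
      c.wp n ε δ β Q σ → (∀ σ', Q σ' → σ'.Within β → Ok D ε δ β τ E r σ' ρ b) →
      Ok D ε δ β τ E (c :: r) σ ρ b from
    H r _ σ hσ (Cmd.wp_frame h) fun σ' h' hw => hr σ' h'.1 hw h'.2
  clear hr h hσ
  induction c with
  | prim i => exact fun r Q σ hσ h hr => .prim hσ h hr
  | seq c d hc hd =>
    exact fun r Q σ hσ h hr =>
      .seq hσ (hc _ _ _ hσ.tick h fun σ' h' hw => hd _ _ _ hw h' hr)
  | ite x c d hc hd =>
    intro r Q σ hσ h hr
    by_cases hx : σ.var x = 0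
    · exact .of_step hσ (σ' := σ.tick) (r' := d :: r) (ρ' := ρ)
        (by simp [step, Conf.toState, hx]) rfl (hd _ _ _ hσ.tick (h.2 hx) hr)
    · exact .of_step hσ (σ' := σ.tick) (r' := c :: r) (ρ' := ρ)
        (by simp [step, Conf.toState, hx]) rfl (hc _ _ _ hσ.tick (h.1 hx) hr)
  | loop x c hc =>
    rintro r Q σ hσ ⟨m, h⟩ hr
    induction m generalizing σ with
    | zero => exact .loop_zero hσ h.1 (hr _ h.2 hσ.tick)
    | succ m ih =>
      rw [Function.iterate_succ_apply'] at h
      exact .loop_ne_zero hσ h.1 (hc _ _ _ hσ.tick h.2 fun σ' h' hw => ih _ hw h')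

/-- Load a fresh copy. -/
def Conf.load (σ : Conf K) : Conf K := { σ with copies := σ.copies + 1, time := σ.time + 1 }

@[simp] theorem Conf.load_var (σ : Conf K) : σ.load.var = σ.var := rfl
@[simp] theorem Conf.load_arr (σ : Conf K) : σ.load.arr = σ.arr := rfl
@[simp] theorem Conf.load_time (σ : Conf K) : σ.load.time = σ.time + 1 := rfl
@[simp] theorem Conf.load_copies (σ : Conf K) : σ.load.copies = σ.copies + 1 := rfl
@[simp] theorem Conf.load_gates (σ : Conf K) : σ.load.gates = σ.gates := rfl

/-- Apply a gate. -/
def Conf.gate (σ : Conf K) : Conf K := { σ with gates := σ.gates + 1, time := σ.time + 1 }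

@[simp] theorem Conf.gate_var (σ : Conf K) : σ.gate.var = σ.var := rfl
@[simp] theorem Conf.gate_arr (σ : Conf K) : σ.gate.arr = σ.arr := rfl
@[simp] theorem Conf.gate_time (σ : Conf K) : σ.gate.time = σ.time + 1 := rfl
@[simp] theorem Conf.gate_copies (σ : Conf K) : σ.gate.copies = σ.copies := rfl
@[simp] theorem Conf.gate_gates (σ : Conf K) : σ.gate.gates = σ.gates + 1 := rfl

theorem Conf.Within.load {σ : Conf K} (h : σ.Within β) (hc : σ.copies + 1 ≤ β.copies) :
    σ.load.Within β :=
  ⟨h.1, h.2.1, h.2.2.1, hc, h.2.2.2.2⟩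

theorem Conf.Within.gate {σ : Conf K} (h : σ.Within β) (hc : σ.gates + 1 ≤ β.gates) :
    σ.gate.Within β :=
  ⟨h.1, h.2.1, h.2.2.1, h.2.2.2.1, hc⟩

theorem Ok.fresh {r : List (Cmd K)} {σ : Conf K} {ρ : QOp (n + 1)} {b : ℝ} (hσ : σ.Within β)
    (h : Ok D ε δ β τ E r σ.load (ρ.trace • mixtureExample D) b) :
    Ok D ε δ β τ E (.prim .fresh :: r) σ ρ b :=
  .of_step hσ rfl rfl h

theorem Ok.gate {g : Gate} {y : Fin K} {r : List (Cmd K)} {σ : Conf K} {ρ : QOp (n + 1)} {b : ℝ}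
    (hσ : σ.Within β) (i : Fin (n + 1)) (hi : σ.var y = i)
    (h : Ok D ε δ β τ E r σ.gate
      (onQubit i g.toMatrix * ρ * (onQubit i g.toMatrix).conjTranspose) b) :
    Ok D ε δ β τ E (.prim (.gate g y) :: r) σ ρ b := by
  refine .of_step hσ ?_ rfl h
  have := i.2
  simp [step, Conf.toState, Instr.exec, hi, Conf.gate, Nat.lt_succ_iff.1 this]

theorem Ok.measure {x y : Fin K} {r : List (Cmd K)} {σ : Conf K} {ρ : QOp (n + 1)}
    {b : Bool → ℝ} (hσ : σ.Within β) (i : Fin (n + 1)) (hi : σ.var y = i)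
    (h : ∀ a, (σ.setVar x a.toNat).Within β → Ok D ε δ β τ E r (σ.setVar x a.toNat)
      (qubitProj i a * ρ * qubitProj i a) (b a)) :
    Ok D ε δ β τ E (.prim (.measure x y) :: r) σ ρ (b false + b true) := by
  have hw : ∀ a : Bool, (σ.setVar x a.toNat).Within β := fun a =>
    hσ.setVar ((by cases a <;> simp : a.toNat ≤ 1).trans β.one_le_word) x
  refine .of_step_pair hσ ?_ rfl rfl (h false (hw _)) (h true (hw _))
  have := i.2
  simp [step, Conf.toState, Instr.exec, hi, Conf.setVar, State.setVar, Nat.lt_succ_iff.1 this]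

end Ok

end AgnosticFourier

namespace AgnosticFourier

/-! ### Tensor products of single-qubit operators -/

section Tensor

open Matrix

variable {q : ℕ}

/-- The tensor product of single-qubit operators. -/
def tensor (A : Fin q → Matrix Bool Bool ℂ) : QOp q :=
  Matrix.of fun v w => ∏ i, A i (v i) (w i)

theorem tensor_apply (A : Fin q → Matrix Bool Bool ℂ) (v w : Cube q) :
    tensor A v w = ∏ i, A i (v i) (w i) := rfl

theorem tensor_mul (A B : Fin q → Matrix Bool Bool ℂ) :
    tensor A * tensor B = tensor fun i => A i * B i := by
  ext v w
  simp only [Matrix.mul_apply, tensor_apply, ← Finset.prod_mul_distrib]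
  rw [Finset.prod_univ_sum, Fintype.piFinset_univ]

theorem tensor_one : tensor (fun _ => 1 : Fin q → Matrix Bool Bool ℂ) = 1 := by
  ext v w
  simp only [tensor_apply, Matrix.one_apply, Finset.prod_boole, Finset.mem_univ, true_imp_iff,
    funext_iff]

theorem conjTranspose_tensor (A : Fin q → Matrix Bool Bool ℂ) :
    (tensor A)ᴴ = tensor fun i => (A i)ᴴ := by
  ext v w
  simp [tensor_apply, Matrix.conjTranspose_apply]

/-- In tensor form, products and adjoints of gates on different qubits are computed factor by
factor. -/
theorem onQubit_eq_tensor (i : Fin q) (U : Matrix Bool Bool ℂ) :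
    onQubit i U = tensor (Function.update (fun _ => 1) i U) := by
  ext v w
  rw [tensor_apply, ← Finset.mul_prod_erase _ _ (Finset.mem_univ i), Function.update_self]
  have : ∏ j ∈ Finset.univ.erase i,
      Function.update (fun _ => 1 : Fin q → Matrix Bool Bool ℂ) i U j (v j) (w j) =
      ∏ j ∈ Finset.univ.erase i, if v j = w j then 1 else 0 :=
    Finset.prod_congr rfl fun j hj => by
      rw [Function.update_of_ne (Finset.ne_of_mem_erase hj), Matrix.one_apply]
  rw [this, Finset.prod_boole]
  simp [onQubit]

/-- Hadamard gates on all qubits from number `j` on. -/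
def hadamardFrom (q j : ℕ) : QOp q :=
  tensor fun i => if j ≤ i then Gate.hadamard.toMatrix else 1

theorem hadamardFrom_of_le {j : ℕ} (h : q ≤ j) : hadamardFrom q j = 1 := by
  rw [hadamardFrom, ← tensor_one]
  congr
  funext i
  rw [if_neg (by have := i.2; omega)]

/-- One round of the gate loop, which runs through the qubits downwards. -/
theorem onQubit_mul_hadamardFrom (i : Fin q) :
    onQubit i Gate.hadamard.toMatrix * hadamardFrom q (i + 1) = hadamardFrom q i := by
  rw [onQubit_eq_tensor, hadamardFrom, hadamardFrom, tensor_mul]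
  congr
  funext j
  rcases eq_or_ne j i with rfl | h
  · simp
  · have : (j : ℕ) ≠ i := fun h' => h (Fin.ext h')
    rw [Function.update_of_ne h, one_mul]
    congr 1
    exact propext ⟨fun _ => by omega, fun _ => by omega⟩

theorem hadamard_conjTranspose_mul_self :
    Gate.hadamard.toMatrixᴴ * Gate.hadamard.toMatrix = 1 := by
  have h : (((Real.sqrt 2)⁻¹ : ℝ) : ℂ) * (((Real.sqrt 2)⁻¹ : ℝ) : ℂ) = 1 / 2 := by
    rw [← Complex.ofReal_mul, ← mul_inv, Real.mul_self_sqrt (by norm_num)]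
    norm_num
  ext a b
  cases a <;> cases b <;>
    simp [Matrix.mul_apply, Gate.toMatrix, Matrix.conjTranspose_apply, -Complex.ofReal_inv, h]
  all_goals norm_num

theorem hadamardFrom_conjTranspose_mul_self (j : ℕ) :
    (hadamardFrom q j)ᴴ * hadamardFrom q j = 1 := by
  rw [hadamardFrom, conjTranspose_tensor, tensor_mul, ← tensor_one]
  congr
  funext i
  split_ifs
  · exact hadamard_conjTranspose_mul_self
  · simp

theorem parity_eq_prod {n : ℕ} (s x : Cube n) :
    parity s x = ∏ i, if s i = true ∧ x i = true then -1 else 1 := by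
  rw [Finset.prod_ite]
  simp [parity]

theorem hadamardFrom_zero_apply (v w : Cube q) :
    hadamardFrom q 0 v w = ((parity v w * (Real.sqrt 2)⁻¹ ^ q : ℝ) : ℂ) := by
  simp only [hadamardFrom, tensor_apply, Nat.zero_le, if_true, Gate.toMatrix, Matrix.of_apply,
    Finset.prod_mul_distrib, parity_eq_prod]
  push_cast
  congr 1
  · exact Finset.prod_congr rfl fun i _ => by split_ifs <;> simp
  · simp

/-- Used twice: for Parseval's identity, and to see that outcome probabilities sum to `1`. -/
theorem sum_normSq_mulVec {ι : Type*} [Fintype ι] [DecidableEq ι] {U : Matrix ι ι ℂ}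
    (hU : Uᴴ * U = 1) (ψ : ι → ℂ) :
    ∑ v, Complex.normSq ((U *ᵥ ψ) v) = ∑ v, Complex.normSq (ψ v) := by
  have h : ∀ φ : ι → ℂ, ((∑ v, Complex.normSq (φ v) : ℝ) : ℂ) = star φ ⬝ᵥ φ := fun φ => by
    simp [dotProduct, Complex.normSq_eq_conj_mul_self]
  apply Complex.ofReal_injective
  rw [h, h, star_mulVec, ← dotProduct_mulVec, mulVec_mulVec, hU, one_mulVec]

theorem inv_sqrt_two_pow_mul_self (n : ℕ) :
    ((Real.sqrt 2)⁻¹ ^ n) * ((Real.sqrt 2)⁻¹ ^ n) = (2 ^ n : ℝ)⁻¹ := by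
  rw [← mul_pow, ← mul_inv, Real.mul_self_sqrt (by norm_num), inv_pow]

/-- Parseval's identity. -/
theorem sum_fourierCoeff_sq {n : ℕ} (f : Cube n → ℝ) :
    ∑ s, fourierCoeff f s ^ 2 = unifExp fun x => f x ^ 2 := by
  have h := sum_normSq_mulVec (hadamardFrom_conjTranspose_mul_self (q := n) 0)
    (fun x => ((f x : ℝ) : ℂ))
  -- Up to normalization the Hadamard transform of `f` is its Fourier transform: the entries are
  -- `2^(n/2)` times the coefficients.
  have e : ∀ s, (hadamardFrom n 0 *ᵥ fun x => ((f x : ℝ) : ℂ)) s =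
      ((fourierCoeff f s * 2 ^ n * (Real.sqrt 2)⁻¹ ^ n : ℝ) : ℂ) := fun s => by
    simp only [mulVec, dotProduct, hadamardFrom_zero_apply, ← Complex.ofReal_mul,
      ← Complex.ofReal_sum, fourierCoeff, unifExp]
    rw [div_mul_cancel₀ _ (by positivity), Finset.sum_mul]
    refine congrArg _ (Finset.sum_congr rfl fun x _ => ?_)
    ring
  have e2 : ∀ s, Complex.normSq ((hadamardFrom n 0 *ᵥ fun x => ((f x : ℝ) : ℂ)) s) =
      fourierCoeff f s ^ 2 * 2 ^ n := fun s => by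
    rw [e, Complex.normSq_ofReal]
    calc _ = fourierCoeff f s ^ 2 * 2 ^ n * 2 ^ n *
          (((Real.sqrt 2)⁻¹ ^ n) * ((Real.sqrt 2)⁻¹ ^ n)) := by ring
      _ = _ := by
        rw [inv_sqrt_two_pow_mul_self, mul_inv_cancel_right₀ (by positivity)]
  simp only [e2, Complex.normSq_ofReal, ← Finset.sum_mul] at h
  rw [unifExp, eq_div_iff (by positivity), h]
  exact Finset.sum_congr rfl fun x _ => (sq _).symm

end Tensor

/-! ### Measurement statistics of mixture-of-superpositions examples -/

section Mixture

open Matrix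

variable {n : ℕ} (D : PMF (Cube n × Bool))

/-- The probability of the outcome `v` if a copy of `ρ_D` is transformed by `U` and measured. -/
def outcomeProb (U : QOp (n + 1)) (v : Cube (n + 1)) : ℝ :=
  ∑ f, functionWeight D f * Complex.normSq ((U *ᵥ superposition D f) v)

theorem conj_mixtureExample_apply (U : QOp (n + 1)) (v : Cube (n + 1)) :
    (U * mixtureExample D * Uᴴ) v v = (outcomeProb D U v : ℂ) := by
  simp only [mixtureExample, Matrix.mul_sum, Matrix.sum_mul, Matrix.sum_apply, Matrix.mul_smul,
    Matrix.smul_mul, Matrix.smul_apply, outcomeProb, Complex.ofReal_sum, Complex.ofReal_mul,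
    smul_eq_mul]
  refine Finset.sum_congr rfl fun f _ => ?_
  rw [Matrix.mul_vecMulVec, Matrix.vecMulVec_mul, vecMulVec_apply, ← Matrix.star_mulVec,
    Pi.star_apply, Complex.star_def, Complex.mul_conj]

theorem marginal_nonneg (x : Cube n) : 0 ≤ marginal D x := ENNReal.toReal_nonneg

theorem marginal_eq_add (x : Cube n) :
    marginal D x = (D (x, true)).toReal + (D (x, false)).toReal := by
  rw [marginal, PMF.map_apply, ← ENNReal.toReal_add (PMF.apply_ne_top _ _) (PMF.apply_ne_top _ _)]
  congr 1
  rw [tsum_fintype, Fintype.sum_prod_type, Finset.sum_eq_single x]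
  · simp
  · intro y _ hy
    simp [hy.symm]
  · simp

theorem labelMean_nonneg (x : Cube n) : 0 ≤ labelMean D x :=
  div_nonneg ENNReal.toReal_nonneg (marginal_nonneg D x)

theorem labelMean_le_one (x : Cube n) : labelMean D x ≤ 1 := by
  -- This form of the quotient bound includes a vanishing marginal, where the label mean is `0` by
  -- convention.
  refine div_le_one_of_le₀ ?_ (marginal_nonneg D x)
  rw [marginal_eq_add]
  exact le_add_of_nonneg_right ENNReal.toReal_nonneg

theorem signMean_sq_le_one (x : Cube n) : signMean D x ^ 2 ≤ 1 := by
  have h0 := labelMean_nonneg D x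
  have h1 := labelMean_le_one D x
  rw [signMean]
  nlinarith

theorem unifExp_signMean_sq_le_one : unifExp (fun x => signMean D x ^ 2) ≤ 1 := by
  rw [unifExp, div_le_one (by positivity)]
  calc _ ≤ ∑ _x : Cube n, (1 : ℝ) := Finset.sum_le_sum fun x _ => signMean_sq_le_one D x
    _ = _ := by simp

theorem functionWeight_nonneg (f : Cube n → Bool) : 0 ≤ functionWeight D f := by
  refine Finset.prod_nonneg fun x _ => ?_
  have h0 := labelMean_nonneg D x
  have h1 := labelMean_le_one D x
  split_ifs <;> linarith

/-- The sign of a label. -/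
def boolSign (b : Bool) : ℝ := if b = true then -1 else 1

theorem sum_functionWeight : ∑ f, functionWeight D f = 1 := by
  have h := Finset.prod_univ_sum (fun _ : Cube n => (Finset.univ : Finset Bool))
    (fun x b => if b = true then labelMean D x else 1 - labelMean D x)
  rw [Fintype.piFinset_univ] at h
  simp only [functionWeight]
  rw [← h]
  simp

/-- The labels are independent: inserting the sign as an extra factor at `x` makes the sum over `f`
a product of sums over labels, and all factors except the one at `x` equal `1`. -/
theorem sum_functionWeight_mul_boolSign (x : Cube n) :
    ∑ f, functionWeight D f * boolSign (f x) = signMean D x := by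
  have h := Finset.prod_univ_sum (fun _ : Cube n => (Finset.univ : Finset Bool))
    (fun y b => (if b = true then labelMean D y else 1 - labelMean D y) *
      if y = x then boolSign b else 1)
  rw [Fintype.piFinset_univ] at h
  have e : ∀ f : Cube n → Bool, functionWeight D f * boolSign (f x) =
      ∏ y, (if f y = true then labelMean D y else 1 - labelMean D y) *
        if y = x then boolSign (f y) else 1 := fun f => by
    rw [Finset.prod_mul_distrib, functionWeight]
    simp
  simp only [e]
  rw [← h, Finset.prod_eq_single x]
  · simp [boolSign, signMean]
    ring
  · intro y _ hy
    simp [hy]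
  · simp

theorem sum_cube_succ {M : Type*} [AddCommMonoid M] (F : Cube (n + 1) → M) :
    ∑ v, F v = ∑ x : Cube n, ∑ b, F (Fin.snoc x b) := by
  rw [← Fintype.sum_equiv (Fin.snocEquiv fun _ => Bool) (fun p => F (Fin.snoc p.2 p.1)) F
    fun _ => rfl, Fintype.sum_prod_type_right]

theorem superposition_snoc (f : Cube n → Bool) (x : Cube n) (b : Bool) :
    superposition D f (Fin.snoc x b) =
      if b = f x then ((Real.sqrt (marginal D x) : ℝ) : ℂ) else 0 := by
  simp [superposition]

theorem sum_marginal : ∑ x, marginal D x = 1 := by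
  have h := D.tsum_coe
  rw [tsum_fintype] at h
  simp only [marginal_eq_add, ← ENNReal.toReal_add (PMF.apply_ne_top _ _) (PMF.apply_ne_top _ _)]
  rw [← ENNReal.toReal_sum fun x _ =>
    ENNReal.add_ne_top.2 ⟨PMF.apply_ne_top _ _, PMF.apply_ne_top _ _⟩]
  rw [Fintype.sum_prod_type] at h
  simp only [Fintype.sum_bool] at h
  rw [h, ENNReal.toReal_one]

theorem sum_normSq_superposition (f : Cube n → Bool) :
    ∑ v, Complex.normSq (superposition D f v) = 1 := by
  rw [sum_cube_succ, ← sum_marginal D]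
  refine Finset.sum_congr rfl fun x _ => ?_
  simp only [superposition_snoc, apply_ite Complex.normSq, Complex.normSq_ofReal, map_zero,
    Real.mul_self_sqrt (marginal_nonneg D x)]
  simp

theorem outcomeProb_nonneg (U : QOp (n + 1)) (v : Cube (n + 1)) : 0 ≤ outcomeProb D U v :=
  Finset.sum_nonneg fun f _ => mul_nonneg (functionWeight_nonneg D f) (Complex.normSq_nonneg _)

theorem sum_outcomeProb {U : QOp (n + 1)} (hU : Uᴴ * U = 1) : ∑ v, outcomeProb D U v = 1 := by
  simp only [outcomeProb]
  rw [Finset.sum_comm]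
  simp only [← Finset.mul_sum, sum_normSq_mulVec hU, sum_normSq_superposition, mul_one,
    sum_functionWeight]

variable {D}

theorem marginal_eq (hD : D.map Prod.fst = PMF.uniformOfFintype (Cube n)) (x : Cube n) :
    marginal D x = (2 ^ n)⁻¹ := by
  simp [marginal, hD, PMF.uniformOfFintype_apply]

theorem sum_functionWeight_mul_unifExp (s : Cube n) :
    ∑ f, functionWeight D f * unifExp (fun x => boolSign (f x) * parity s x) =
      fourierCoeff (signMean D) s := by
  simp only [fourierCoeff, unifExp, ← sum_functionWeight_mul_boolSign, mul_div_assoc',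
    ← Finset.sum_div, Finset.mul_sum, Finset.sum_mul]
  rw [Finset.sum_comm]
  simp only [mul_assoc]

/-- Fourier sampling finds `s` with probability at least half of the squared coefficient. -/
theorem le_outcomeProb_hadamard (hD : D.map Prod.fst = PMF.uniformOfFintype (Cube n))
    (s : Cube n) :
    fourierCoeff (signMean D) s ^ 2 / 2 ≤
      outcomeProb D (hadamardFrom (n + 1) 0) (Fin.snoc s true) := by
  have hs : ((Real.sqrt 2)⁻¹ ^ n) * Real.sqrt (2 ^ n)⁻¹ = (2 ^ n : ℝ)⁻¹ := by
    rw [← inv_sqrt_two_pow_mul_self, Real.sqrt_mul_self (by positivity)]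
  -- The last bit of the outcome is `1`, so the parity picks up the sign of the label. This turns
  -- the superposition over `|x, f x⟩` into the phases `(-1)^(f x)`.
  have hp : ∀ (x : Cube n) b, parity (Fin.snoc s true : Cube (n + 1)) (Fin.snoc x b) =
      parity s x * boolSign b := fun x b => by
    simp [parity_eq_prod, Fin.prod_univ_castSucc, boolSign]
  have e : ∀ f, (hadamardFrom (n + 1) 0 *ᵥ superposition D f) (Fin.snoc s true) =
      ((unifExp (fun x => boolSign (f x) * parity s x) * (Real.sqrt 2)⁻¹ : ℝ) : ℂ) := fun f => by
    simp only [mulVec, dotProduct, hadamardFrom_zero_apply, sum_cube_succ, superposition_snoc,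
      marginal_eq hD, hp, mul_ite, mul_zero, Finset.sum_ite_eq',
      Finset.mem_univ, if_true, ← Complex.ofReal_mul, ← Complex.ofReal_sum, unifExp]
    rw [div_eq_mul_inv, Finset.sum_mul, Finset.sum_mul]
    refine congrArg _ (Finset.sum_congr rfl fun x _ => ?_)
    calc _ = parity s x * boolSign (f x) * ((Real.sqrt 2)⁻¹ ^ n * Real.sqrt (2 ^ n)⁻¹) *
          (Real.sqrt 2)⁻¹ := by ring
      _ = _ := by
        rw [hs]
        ring
  have h2 : ((Real.sqrt 2)⁻¹ : ℝ) * (Real.sqrt 2)⁻¹ = 1 / 2 := by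
    rw [← mul_inv, Real.mul_self_sqrt (by norm_num)]
    norm_num
  have hμ := sum_functionWeight_mul_unifExp (D := D) s
  set μ := fourierCoeff (signMean D) s
  set Z : (Cube n → Bool) → ℝ := fun f => unifExp (fun x => boolSign (f x) * parity s x)
  have hp : outcomeProb D (hadamardFrom (n + 1) 0) (Fin.snoc s true) =
      (∑ f, functionWeight D f * Z f ^ 2) / 2 := by
    rw [outcomeProb, Finset.sum_div]
    refine Finset.sum_congr rfl fun f _ => ?_
    rw [e, Complex.normSq_ofReal, mul_mul_mul_comm, h2]
    ring
  -- Jensen's inequality for the square, as nonnegativity of the variance of `Z` around its mean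
  -- `μ`.
  have hv : 0 ≤ ∑ f, functionWeight D f * (Z f - μ) ^ 2 :=
    Finset.sum_nonneg fun f _ => mul_nonneg (functionWeight_nonneg D f) (sq_nonneg _)
  have he : ∑ f, functionWeight D f * (Z f - μ) ^ 2 =
      ∑ f, functionWeight D f * Z f ^ 2 - μ ^ 2 := by
    have : ∀ f, functionWeight D f * (Z f - μ) ^ 2 = functionWeight D f * Z f ^ 2 -
        2 * μ * (functionWeight D f * Z f) + μ ^ 2 * functionWeight D f := fun f => by ring
    have hμ' : ∑ f, functionWeight D f * Z f = μ := hμ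
    simp only [this, Finset.sum_add_distrib, Finset.sum_sub_distrib, ← Finset.mul_sum, hμ',
      sum_functionWeight]
    ring
  rw [hp]
  linarith

/-- The sign by which a labelled example contributes to the estimate of the coefficient at `s`. -/
def exampleSign (s : Cube n) (v : Cube (n + 1)) : ℝ :=
  boolSign (v (Fin.last n)) * parity s (Fin.init v)

theorem exampleSign_eq (s : Cube n) (v : Cube (n + 1)) :
    exampleSign s v = 1 ∨ exampleSign s v = -1 := by
  rw [exampleSign, boolSign, parity]
  rcases neg_one_pow_eq_or ℝ
    (Finset.univ.filter fun i => s i = true ∧ (Fin.init v : Cube n) i = true).card with h | h <;>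
  rw [h] <;> split_ifs <;> simp

/-- Without gates (`U = 1`) the measurement yields a uniform `x` with a label drawn from its
conditional distribution, so each copy gives an unbiased estimate of every coefficient at once. -/
theorem sum_outcomeProb_mul_exampleSign (hD : D.map Prod.fst = PMF.uniformOfFintype (Cube n))
    (s : Cube n) :
    ∑ v, outcomeProb D 1 v * exampleSign s v = fourierCoeff (signMean D) s := by
  rw [← sum_functionWeight_mul_unifExp]
  simp only [outcomeProb, one_mulVec, Finset.sum_mul]
  rw [Finset.sum_comm]
  refine Finset.sum_congr rfl fun f _ => ?_
  simp only [mul_assoc, ← Finset.mul_sum]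
  congr 1
  rw [sum_cube_succ, unifExp, Finset.sum_div]
  refine Finset.sum_congr rfl fun x _ => ?_
  simp only [superposition_snoc, apply_ite Complex.normSq, Complex.normSq_ofReal, map_zero,
    marginal_eq hD, exampleSign, Fin.snoc_last, Fin.init_snoc, ite_mul, zero_mul,
    Finset.sum_ite_eq', Finset.mem_univ, if_true]
  rw [Real.mul_self_sqrt (by positivity)]
  ring

end Mixture

end AgnosticFourier

namespace AgnosticFourier

/-! ### Independent samples -/

section Sampling

variable {Ω ι : Type*}

theorem prod_map_half_eq [DecidableEq Ω] (a : Ω) (h : List Ω) :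
    (h.map fun v => if v = a then (1 / 2 : ℝ) else 1).prod = (1 / 2) ^ h.count a := by
  induction h with
  | nil => simp
  | cons v h ih =>
    rw [List.map_cons, List.prod_cons, ih, List.count_cons]
    rcases eq_or_ne v a with rfl | hv
    · simp [pow_succ']
    · simp [hv]

theorem prod_map_exp (f : Ω → ℝ) (h : List Ω) :
    (h.map fun v => Real.exp (f v)).prod = Real.exp (h.map f).sum := by
  induction h with
  | nil => simp
  | cons v h ih => simp [ih, Real.exp_add]

theorem sum_map_mul_sub (c μ : ℝ) (Z : Ω → ℝ) (h : List Ω) :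
    (h.map fun v => c * (Z v - μ)).sum = c * ((h.map Z).sum - h.length * μ) := by
  induction h with
  | nil => simp
  | cons v h ih =>
    simp only [List.map_cons, List.sum_cons, ih, List.length_cons, Nat.cast_succ]
    ring

variable [Fintype Ω]

/-- The expectation of `V` if `t` independent samples from `p` are added to the list `h`. -/
def sampleExp (p : Ω → ℝ) : ℕ → (List Ω → ℝ) → List Ω → ℝ
  | 0, V, h => V h
  | t + 1, V, h => ∑ v, p v * sampleExp p t V (v :: h)

theorem sampleExp_mono {p : Ω → ℝ} (hp : ∀ v, 0 ≤ p v) {t : ℕ} {V W : List Ω → ℝ} {h : List Ω}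
    (hVW : ∀ h', h'.length = h.length + t → V h' ≤ W h') :
    sampleExp p t V h ≤ sampleExp p t W h := by
  induction t generalizing h with
  | zero => exact hVW h rfl
  | succ t ih =>
    refine Finset.sum_le_sum fun v _ => mul_le_mul_of_nonneg_left (ih fun h' hh => hVW h' ?_) (hp v)
    rw [hh, List.length_cons]
    omega

/-- Independence: the expectation of a product over samples is a power. All tail bounds below are
reduced to this identity. -/
theorem sampleExp_prod (p : Ω → ℝ) (t : ℕ) (g : Ω → ℝ) (h : List Ω) :
    sampleExp p t (fun h => (h.map g).prod) h = (h.map g).prod * (∑ v, p v * g v) ^ t := by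
  induction t generalizing h with
  | zero => simp [sampleExp]
  | succ t ih =>
    simp only [sampleExp, ih, List.map_cons, List.prod_cons]
    rw [pow_succ', mul_left_comm, Finset.sum_mul]
    refine Finset.sum_congr rfl fun v _ => by ring

theorem sampleExp_const_sub_sum {p : Ω → ℝ} (hp : ∑ v, p v = 1) (t : ℕ) (a c : ℝ) (S : Finset ι)
    (W : ι → List Ω → ℝ) (h : List Ω) :
    sampleExp p t (fun h => a - ∑ i ∈ S, c * W i h) h =
      a - ∑ i ∈ S, c * sampleExp p t (W i) h := by
  induction t generalizing h with
  | zero => rfl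
  | succ t ih =>
    simp only [sampleExp, ih, mul_sub, Finset.sum_sub_distrib, ← Finset.sum_mul, hp, one_mul,
      Finset.mul_sum]
    rw [Finset.sum_comm]
    simp only [mul_left_comm]

/-- A union bound with exponential moments. -/
theorem one_sub_le_sampleExp {p : Ω → ℝ} (hp : ∀ v, 0 ≤ p v) (hp1 : ∑ v, p v = 1) {t : ℕ}
    {S : Finset ι} {c B : ℝ} {g : ι → Ω → ℝ} {V : List Ω → ℝ}
    (hB : ∀ i ∈ S, c * (∑ v, p v * g i v) ^ t ≤ B)
    (hV : ∀ h : List Ω, h.length = t → 1 - ∑ i ∈ S, c * (h.map (g i)).prod ≤ V h) :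
    1 - S.card * B ≤ sampleExp p t V [] := by
  refine le_trans ?_ (sampleExp_mono hp fun h hh => hV h (by simpa using hh))
  rw [sampleExp_const_sub_sum hp1]
  simp only [sampleExp_prod, List.map_nil, List.prod_nil, one_mul]
  have := Finset.sum_le_card_nsmul S _ B hB
  rw [nsmul_eq_mul] at this
  linarith

/-- Values of probability at least `2 q` are seen often. -/
theorem one_sub_le_sampleExp_count [DecidableEq Ω] {p : Ω → ℝ} (hp : ∀ v, 0 ≤ p v)
    (hp1 : ∑ v, p v = 1) {t m : ℕ} {q : ℝ} (S : Finset ι) (a : ι → Ω)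
    (ha : ∀ i ∈ S, 2 * q ≤ p (a i)) {V : List Ω → ℝ} (hV0 : ∀ h, 0 ≤ V h)
    (hV : ∀ h : List Ω, h.length = t → (∀ i ∈ S, m < h.count (a i)) → 1 ≤ V h) :
    1 - S.card * (2 ^ m * Real.exp (-(q * t))) ≤ sampleExp p t V [] := by
  refine one_sub_le_sampleExp hp hp1 (c := 2 ^ m)
    (g := fun i v => if v = a i then (1 / 2 : ℝ) else 1) (fun i hi => ?_) fun h hh => ?_
  · refine mul_le_mul_of_nonneg_left ?_ (by positivity)
    have hs : ∑ v, p v * (if v = a i then (1 / 2 : ℝ) else 1) = 1 - p (a i) / 2 := by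
      have : ∀ v, p v * (if v = a i then (1 / 2 : ℝ) else 1) =
          p v - if v = a i then p v / 2 else 0 := fun v => by split_ifs <;> ring
      simp only [this, Finset.sum_sub_distrib, hp1, Finset.sum_ite_eq',
        Finset.mem_univ, if_true]
    have h1 : p (a i) ≤ 1 := hp1 ▸ Finset.single_le_sum (fun v _ => hp v) (Finset.mem_univ _)
    have h2 := ha i hi
    -- Each sample multiplies the expectation of `2^(-count)` by `1 - p/2 ≤ 1 - q ≤ exp (-q)`.
    have h3 : (1 : ℝ) - p (a i) / 2 ≤ Real.exp (-q) := by
      have := Real.add_one_le_exp (-q)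
      linarith
    rw [hs]
    calc _ ≤ Real.exp (-q) ^ t := pow_le_pow_left₀ (by linarith) h3 t
      _ = _ := by rw [← Real.exp_nat_mul]; congr 1; ring
  · simp only [prod_map_half_eq]
    by_cases hc : ∀ i ∈ S, m < h.count (a i)
    · have : 0 ≤ ∑ i ∈ S, (2 : ℝ) ^ m * (1 / 2) ^ h.count (a i) :=
        Finset.sum_nonneg fun i _ => by positivity
      have := hV h hh hc
      linarith
    · push Not at hc
      obtain ⟨i, hi, hm⟩ := hc
      -- Markov's inequality in pointwise form: if some count is at most `m`, its term in the union
      -- bound is already at least `1`, and `V` is nonnegative.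
      have h1 : (1 : ℝ) ≤ 2 ^ m * (1 / 2) ^ h.count (a i) := by
        rw [one_div, inv_pow, ← div_eq_mul_inv, one_le_div (by positivity)]
        exact pow_le_pow_right₀ one_le_two hm
      have h2 := Finset.single_le_sum
        (f := fun i => (2 : ℝ) ^ m * (1 / 2) ^ h.count (a i)) (fun i _ => by positivity) hi
      have := hV0 h
      linarith

/-- The exponential moment of a centred sign. As `|c| ≤ 1/2` and `|Z - μ| ≤ 2`, the inequality `exp
x ≤ 1 + x + x²` for `|x| ≤ 1` applies. The linear term has mean zero, and the variance `1 - μ²` is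
at most `1`. -/
theorem sum_mul_exp_le {p : Ω → ℝ} (hp : ∀ v, 0 ≤ p v) (hp1 : ∑ v, p v = 1) {Z : Ω → ℝ}
    (hZ : ∀ v, Z v = 1 ∨ Z v = -1) {c : ℝ} (hc : |c| ≤ 1 / 2) :
    ∑ v, p v * Real.exp (c * (Z v - ∑ w, p w * Z w)) ≤ Real.exp (c ^ 2) := by
  set μ := ∑ w, p w * Z w with hμ
  have hZ1 : ∀ v, |Z v| ≤ 1 := fun v => by rcases hZ v with h | h <;> simp [h]
  have hZ2 : ∀ v, Z v ^ 2 = 1 := fun v => by rcases hZ v with h | h <;> simp [h]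
  have hμ1 : |μ| ≤ 1 := by
    refine (Finset.abs_sum_le_sum_abs _ _).trans ?_
    rw [← hp1]
    refine Finset.sum_le_sum fun v _ => ?_
    rw [abs_mul, abs_of_nonneg (hp v)]
    exact mul_le_of_le_one_right (hp v) (hZ1 v)
  calc _ ≤ ∑ v, p v * (1 + c * (Z v - μ) + (c * (Z v - μ)) ^ 2) := by
        refine Finset.sum_le_sum fun v _ => mul_le_mul_of_nonneg_left ?_ (hp v)
        have h1 : |c * (Z v - μ)| ≤ 1 := by
          rw [abs_mul]
          have := abs_sub (Z v) μ
          nlinarith [hZ1 v, abs_nonneg (Z v - μ), abs_nonneg c]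
        have := (abs_le.1 (Real.abs_exp_sub_one_sub_id_le h1)).2
        linarith
    _ = 1 + c ^ 2 * (1 - μ ^ 2) := by
        have : ∀ v, p v * (1 + c * (Z v - μ) + (c * (Z v - μ)) ^ 2) =
            p v * (1 - c * μ + c ^ 2 * (1 + μ ^ 2)) + (p v * Z v) * (c - 2 * c ^ 2 * μ) :=
          fun v => by linear_combination p v * c ^ 2 * hZ2 v
        simp only [this, Finset.sum_add_distrib, ← Finset.sum_mul, hp1, ← hμ]
        ring
    _ ≤ 1 + c ^ 2 := by nlinarith [sq_nonneg c, sq_nonneg μ, sq_nonneg (c * μ)]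
    _ ≤ _ := by linarith [Real.add_one_le_exp (c ^ 2)]

/-- Empirical means of signs are close to their expectations. -/
theorem one_sub_le_sampleExp_mean {p : Ω → ℝ} (hp : ∀ v, 0 ≤ p v) (hp1 : ∑ v, p v = 1) {t : ℕ}
    (S : Finset ι) {Z : ι → Ω → ℝ} (hZ : ∀ i v, Z i v = 1 ∨ Z i v = -1) {c : ℝ} (hc0 : 0 ≤ c)
    (hc : c ≤ 1 / 2) {V : List Ω → ℝ} (hV0 : ∀ h, 0 ≤ V h)
    (hV : ∀ h : List Ω, h.length = t →
      (∀ i ∈ S, |(h.map (Z i)).sum - t * ∑ v, p v * Z i v| ≤ 2 * c * t) → 1 ≤ V h) :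
    1 - 2 * S.card * Real.exp (-(c ^ 2 * t)) ≤ sampleExp p t V [] := by
  -- The Boolean index distinguishes the upper and the lower tail. The threshold `2 c t` contributes
  -- `exp (-2c²t)` and the exponential moment at most `exp (c²t)`, which leaves `exp (-c²t)`.
  have h := one_sub_le_sampleExp hp hp1 (t := t) (S := S ×ˢ (Finset.univ : Finset Bool))
    (c := Real.exp (-(2 * c ^ 2 * t))) (B := Real.exp (-(c ^ 2 * t)))
    (g := fun i v => Real.exp ((if i.2 then c else -c) * (Z i.1 v - ∑ w, p w * Z i.1 w)))
    (V := V) (fun i _ => ?_) fun h hh => ?_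
  · rw [Finset.card_product, Finset.card_univ, Fintype.card_bool] at h
    push_cast at h
    linarith
  · have h1 : ∑ v, p v * Real.exp ((if i.2 then c else -c) * (Z i.1 v - ∑ w, p w * Z i.1 w)) ≤
        Real.exp (c ^ 2) := by
      refine (sum_mul_exp_le hp hp1 (hZ i.1) ?_).trans (le_of_eq ?_)
      · split_ifs <;> simpa [abs_of_nonneg hc0] using hc
      · split_ifs <;> simp
    calc _ ≤ Real.exp (-(2 * c ^ 2 * t)) * Real.exp (c ^ 2) ^ t := by
          refine mul_le_mul_of_nonneg_left (pow_le_pow_left₀ ?_ h1 t) (Real.exp_nonneg _)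
          exact Finset.sum_nonneg fun v _ => mul_nonneg (hp v) (Real.exp_nonneg _)
      _ = _ := by
          rw [← Real.exp_nat_mul, ← Real.exp_add]
          congr 1
          ring
  · simp only [prod_map_exp, sum_map_mul_sub, ← Real.exp_add, hh]
    by_cases hc' : ∀ i ∈ S, |(h.map (Z i)).sum - t * ∑ v, p v * Z i v| ≤ 2 * c * t
    · have h1 := hV h hh hc'
      refine le_trans ?_ h1
      rw [sub_le_self_iff]
      exact Finset.sum_nonneg fun i _ => Real.exp_nonneg _
    · push Not at hc'
      obtain ⟨i, hi, hm⟩ := hc'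
      have key : ∃ b : Bool, 1 ≤ Real.exp (-(2 * c ^ 2 * t) + (if b then c else -c) *
          ((h.map (Z i)).sum - t * ∑ v, p v * Z i v)) := by
        rcases lt_abs.1 hm with h' | h'
        · refine ⟨true, Real.one_le_exp ?_⟩
          simp only [if_true]
          nlinarith
        · refine ⟨false, Real.one_le_exp ?_⟩
          simp only [Bool.false_eq_true, if_false]
          nlinarith
      obtain ⟨b, hb⟩ := key
      have h2 := Finset.single_le_sum (s := S ×ˢ (Finset.univ : Finset Bool))
        (f := fun i : ι × Bool => Real.exp (-(2 * c ^ 2 * t) + (if i.2 then c else -c) *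
          ((h.map (Z i.1)).sum - t * ∑ v, p v * Z i.1 v)))
        (fun i _ => Real.exp_nonneg _) (a := (i, b)) (by simp [hi])
      have := hV0 h
      linarith

end Sampling

/-! ### Frequent strings -/

section Summary

variable {n : ℕ}

/-- The number of occurrences of the string `s` with label `1` in the list `h`. -/
def hits (h : List (Cube (n + 1))) (s : Cube n) : ℕ := h.count (Fin.snoc s true)

/-- The `k` counters `cnt` with strings `key` are a summary of the frequent strings with label
`1` in the list `h`, in the sense of Misra and Gries. -/
structure Summary (k : ℕ) (h : List (Cube (n + 1))) (cnt : ℕ → ℕ) (key : ℕ → Cube n) : Prop where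
  counts : ∃ N, ∑ i ∈ Finset.range k, cnt i + (k + 1) * N ≤ h.length ∧
    ∀ s, hits h s ≤ N ∨ ∃ i < k, 0 < cnt i ∧ key i = s ∧ hits h s ≤ N + cnt i
  inj : ∀ i < k, ∀ j < k, 0 < cnt i → 0 < cnt j → key i = key j → i = j

theorem hits_cons (v : Cube (n + 1)) (h : List (Cube (n + 1))) (s : Cube n) :
    hits (v :: h) s = hits h s + if v (Fin.last n) = true ∧ Fin.init v = s then 1 else 0 := by
  have : v = Fin.snoc s true ↔ v (Fin.last n) = true ∧ Fin.init v = s := by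
    constructor
    · rintro rfl
      simp
    · rintro ⟨h1, rfl⟩
      rw [← h1, Fin.snoc_init_self]
  simp [hits, List.count_cons, this]

theorem Summary.nil (k : ℕ) {cnt : ℕ → ℕ} (hc : ∀ i < k, cnt i = 0) (key : ℕ → Cube n) :
    Summary k [] cnt key where
  counts := ⟨0, by simpa using hc, fun s => .inl (by simp [hits])⟩
  inj i hi _ _ h := by simp [hc i hi] at h

variable {k : ℕ} {h : List (Cube (n + 1))} {cnt cnt' : ℕ → ℕ} {key key' : ℕ → Cube n}
  {v : Cube (n + 1)}

theorem Summary.cnt_le (H : Summary k h cnt key) {i : ℕ} (hi : i < k) : cnt i ≤ h.length := by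
  obtain ⟨N, h1, -⟩ := H.counts
  have := Finset.single_le_sum (f := cnt) (fun _ _ => Nat.zero_le _) (Finset.mem_range.2 hi)
  nlinarith

/-- The number `N` in the invariant counts rounds of decrements. Each is paid for by `k + 1` list
elements, so `N` is at most `length / (k + 1)`, and a string with more hits cannot have lost its
slot. -/
theorem Summary.exists_of_lt_hits (H : Summary k h cnt key) {m : ℕ}
    (hm : h.length < (k + 1) * (m + 1)) {s : Cube n} (hs : m < hits h s) :
    ∃ i < k, 0 < cnt i ∧ key i = s := by
  obtain ⟨N, h1, h2⟩ := H.counts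
  have : N < m + 1 := by
    by_contra hN
    have : (k + 1) * (m + 1) ≤ (k + 1) * N := Nat.mul_le_mul_left _ (by omega)
    omega
  rcases h2 s with h | ⟨i, hi, hc, hk, -⟩
  · omega
  · exact ⟨i, hi, hc, hk⟩

theorem Summary.congr (H : Summary k h cnt key) (hc : ∀ i < k, cnt' i = cnt i)
    (hk : ∀ i < k, key' i = key i) : Summary k h cnt' key' where
  counts := by
    obtain ⟨N, h1, h2⟩ := H.counts
    refine ⟨N, ?_, fun s => (h2 s).imp_right ?_⟩
    · rwa [Finset.sum_congr rfl fun i hi => hc i (Finset.mem_range.1 hi)]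
    · rintro ⟨i, hi, h3⟩
      exact ⟨i, hi, by rwa [hc i hi, hk i hi]⟩
  inj i hi j hj := by
    rw [hc i hi, hc j hj, hk i hi, hk j hj]
    exact H.inj i hi j hj

theorem Summary.skip (H : Summary k h cnt key) (hv : v (Fin.last n) = false) :
    Summary k (v :: h) cnt key where
  counts := by
    obtain ⟨N, h1, h2⟩ := H.counts
    refine ⟨N, by rw [List.length_cons]; omega, fun s => ?_⟩
    simpa [hits_cons, hv] using h2 s
  inj := H.inj

theorem sum_update_succ {j : ℕ} (hj : j < k) :
    ∑ i ∈ Finset.range k, Function.update cnt j (cnt j + 1) i =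
      ∑ i ∈ Finset.range k, cnt i + 1 := by
  rw [Finset.sum_update_of_mem (Finset.mem_range.2 hj),
    ← Finset.add_sum_erase _ _ (Finset.mem_range.2 hj), Finset.sdiff_singleton_eq_erase]
  omega

theorem Summary.hit (H : Summary k h cnt key) {j : ℕ} (hj : j < k)
    (hcj : 0 < cnt j) (hkj : key j = Fin.init v) :
    Summary k (v :: h) (Function.update cnt j (cnt j + 1)) key where
  counts := by
    obtain ⟨N, h1, h2⟩ := H.counts
    refine ⟨N, by rw [sum_update_succ hj, List.length_cons]; omega, fun s => ?_⟩
    rw [hits_cons]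
    rcases h2 s with h | ⟨i, hi, hc, hk, hle⟩
    · by_cases hs : v (Fin.last n) = true ∧ Fin.init v = s
      · refine .inr ⟨j, hj, by simp, hkj.trans hs.2, ?_⟩
        rw [if_pos hs, Function.update_self]
        omega
      · exact .inl (by rwa [if_neg hs])
    · refine .inr ⟨i, hi, ?_, hk, ?_⟩
      · rw [Function.update_apply]
        split_ifs <;> omega
      · by_cases hs : v (Fin.last n) = true ∧ Fin.init v = s
        · obtain rfl : i = j := H.inj i hi j hj hc hcj (by rw [hk, hkj, hs.2])
          rw [if_pos hs, Function.update_self]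
          omega
        · rw [if_neg hs, Function.update_apply]
          split_ifs with hij
          · subst hij
            omega
          · omega
  inj i hi l hl hci hcl := by
    refine H.inj i hi l hl ?_ ?_ <;> grind

/-- The new string occupied no slot, so its earlier hits were at most `N`, and a counter of `1`
accounts for the current one. -/
theorem Summary.insert (H : Summary k h cnt key)
    (hnew : ∀ i < k, 0 < cnt i → key i ≠ Fin.init v) {j : ℕ} (hj : j < k) (hcj : cnt j = 0) :
    Summary k (v :: h) (Function.update cnt j 1) (Function.update key j (Fin.init v)) where
  counts := by
    obtain ⟨N, h1, h2⟩ := H.counts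
    refine ⟨N, ?_, fun s => ?_⟩
    · have := sum_update_succ (cnt := cnt) hj
      rw [hcj] at this
      rw [this, List.length_cons]
      omega
    rw [hits_cons]
    rcases h2 s with h | ⟨i, hi, hc, hk, hle⟩
    · by_cases hs : v (Fin.last n) = true ∧ Fin.init v = s
      · refine .inr ⟨j, hj, by simp, by simp [hs.2], ?_⟩
        rw [if_pos hs, Function.update_self]
        omega
      · exact .inl (by rwa [if_neg hs])
    · have hij : i ≠ j := by
        rintro rfl
        omega
      have hs : ¬(v (Fin.last n) = true ∧ Fin.init v = s) := fun hs =>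
        hnew i hi hc (by rw [hk, hs.2])
      refine .inr ⟨i, hi, ?_⟩
      rw [Function.update_of_ne hij, Function.update_of_ne hij, if_neg hs]
      exact ⟨hc, hk, hle⟩
  inj i hi l hl hci hcl hil := by
    rcases eq_or_ne i j with rfl | hij <;> rcases eq_or_ne l i with rfl | hlj
    · rfl
    · rw [Function.update_self, Function.update_of_ne hlj] at hil
      rw [Function.update_of_ne hlj] at hcl
      exact absurd hil.symm (hnew l hl hcl)
    · rfl
    · rw [Function.update_of_ne hij] at hci hil
      rcases eq_or_ne l j with rfl | hlj'
      · rw [Function.update_self] at hil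
        exact absurd hil (hnew i hi hci)
      · rw [Function.update_of_ne hlj'] at hcl hil
        exact H.inj i hi l hl hci hcl hil

theorem Summary.decrement (H : Summary k h cnt key) (hpos : ∀ i < k, 0 < cnt i)
    (hnew : ∀ i < k, key i ≠ Fin.init v) :
    Summary k (v :: h) (fun i => cnt i - 1) key where
  counts := by
    obtain ⟨N, h1, h2⟩ := H.counts
    -- The counters lose `k` in total and the list gains one element, which together pay for the
    -- increase of `(k + 1) N`.
    refine ⟨N + 1, ?_, fun s => ?_⟩
    · have : ∑ i ∈ Finset.range k, cnt i = ∑ i ∈ Finset.range k, (cnt i - 1) + k := by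
        rw [Finset.sum_congr rfl fun i hi =>
          (Nat.sub_add_cancel (hpos i (Finset.mem_range.1 hi)) : cnt i - 1 + 1 = cnt i).symm,
          Finset.sum_add_distrib]
        simp
      rw [List.length_cons]
      nlinarith
    · rw [hits_cons]
      rcases h2 s with h | ⟨i, hi, hc, hk, hle⟩
      · left
        split_ifs <;> omega
      · have hs : ¬(v (Fin.last n) = true ∧ Fin.init v = s) := fun hs =>
          hnew i hi (by rw [hk, hs.2])
        rw [if_neg hs]
        -- If the counter drops to `0` the slot is given up, but then its string has at most `N + 1`
        -- hits and needs no slot.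
        rcases Nat.eq_or_lt_of_le hc with h1 | h1
        · left
          omega
        · exact .inr ⟨i, hi, by omega, hk, by omega⟩
  inj i hi j hj _ _ := H.inj i hi j hj (hpos i hi) (hpos j hj)

end Summary

end AgnosticFourier

namespace AgnosticFourier

/-! ### The program -/

infixr:60 " ;; " => Cmd.seq

notation "vOne" => (0 : Fin 32)
notation "vZero" => (1 : Fin 32)
notation "vSize" => (2 : Fin 32)
notation "vQubits" => (3 : Fin 32)
notation "vScale" => (4 : Fin 32)
notation "vSlots" => (5 : Fin 32)
notation "vSamples" => (6 : Fin 32)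
notation "vI" => (7 : Fin 32)
notation "vJ" => (8 : Fin 32)
notation "vT" => (9 : Fin 32)
notation "vA" => (10 : Fin 32)
notation "vB" => (11 : Fin 32)
notation "vC" => (12 : Fin 32)
notation "vP" => (13 : Fin 32)
notation "vY" => (14 : Fin 32)
notation "vSame" => (15 : Fin 32)
notation "vFound" => (16 : Fin 32)
notation "vFoundAt" => (17 : Fin 32)
notation "vHole" => (18 : Fin 32)
notation "vHoleAt" => (19 : Fin 32)
notation "vLen" => (20 : Fin 32)
notation "vLog" => (21 : Fin 32)

notation "aBits" => (0 : Fin 32)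
notation "aKey" => (1 : Fin 32)
notation "aCnt" => (2 : Fin 32)
notation "aPos" => (3 : Fin 32)
notation "aNeg" => (4 : Fin 32)
notation "aOutKey" => (5 : Fin 32)
notation "aOutPos" => (6 : Fin 32)
notation "aOutNeg" => (7 : Fin 32)
notation "aOutDen" => (8 : Fin 32)

/-- Do nothing that matters. -/
def skipCmd : Cmd 32 := .prim (.const vC 0)

/-- Copy a scalar variable. -/
def setTo (x y : Fin 32) : Cmd 32 := .prim (.op .add x y vZero)

/-- `P := i * n + j`, where `j` is the value of the variable `vJ`. -/
def index (i : Fin 32) : Cmd 32 := .prim (.op .mul vP i vSize) ;; .prim (.op .add vP vP vJ)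

/-- Compare the string in slot `vI` with the current sample. -/
def compareSlot : Cmd 32 :=
  setTo vSame vOne ;; setTo vJ vSize ;;
  forLoop vOne vJ
    (index vI ;; .prim (.read vA aKey vP) ;; .prim (.read vB aBits vJ) ;;
      .prim (.op .eq vA vA vB) ;; .prim (.op .mul vSame vSame vA))

/-- Search the slots for the current sample and for a slot with counter `0`. -/
def scanSlots : Cmd 32 :=
  setTo vFound vZero ;; setTo vHole vZero ;; setTo vI vSlots ;;
  forLoop vOne vI
    (compareSlot ;; .prim (.read vC aCnt vI) ;;
      .ite vC (.ite vSame (setTo vFound vOne ;; setTo vFoundAt vI) skipCmd)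
        (setTo vHole vOne ;; setTo vHoleAt vI))

/-- Increment a cell of an array. -/
def increment (A i : Fin 32) : Cmd 32 :=
  .prim (.read vC A i) ;; .prim (.op .add vC vC vOne) ;; .prim (.write A i vC)

/-- Store the current sample in slot `vHoleAt`. -/
def storeSample : Cmd 32 :=
  setTo vJ vSize ;;
  forLoop vOne vJ
    (index vHoleAt ;; .prim (.read vB aBits vJ) ;; .prim (.write aKey vP vB))

/-- Decrement all counters. -/
def decrementAll : Cmd 32 :=
  setTo vI vSlots ;;
  forLoop vOne vI
    (.prim (.read vC aCnt vI) ;; .prim (.op .sub vC vC vOne) ;; .prim (.write aCnt vI vC))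

/-- Update the counters for the current sample. -/
def updateCounters : Cmd 32 :=
  scanSlots ;;
  .ite vFound (increment aCnt vFoundAt)
    (.ite vHole (.prim (.write aCnt vHoleAt vOne) ;; storeSample) decrementAll)

/-- Compute the parity of the current sample with respect to the string in slot `vI`. -/
def slotParity : Cmd 32 :=
  .prim (.read vY aBits vSize) ;; setTo vJ vSize ;;
  forLoop vOne vJ
    (index vI ;; .prim (.read vA aKey vP) ;; .prim (.read vB aBits vJ) ;;
      .prim (.op .mul vA vA vB) ;; .prim (.op .add vY vY vA)) ;;
  .prim (.op .add vB vOne vOne) ;; .prim (.op .mod vY vY vB)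

/-- Update the estimates of all coefficients for the current sample. -/
def updateEstimates : Cmd 32 :=
  setTo vI vSlots ;;
  forLoop vOne vI (slotParity ;; .ite vY (increment aNeg vI) (increment aPos vI))

/-- Append the string in slot `vI` to the output. -/
def copyKey : Cmd 32 :=
  setTo vJ vSize ;;
  forLoop vOne vJ
    (index vI ;; .prim (.read vA aKey vP) ;; index vLen ;; .prim (.write aOutKey vP vA))

/-- Append slot `vI` to the output. -/
def copySlot : Cmd 32 :=
  .prim (.write aOutPos vLen vA) ;; .prim (.write aOutNeg vLen vB) ;;
  .prim (.write aOutDen vLen vSamples) ;; copyKey ;; .prim (.op .add vLen vLen vOne)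

/-- Output the slots with large estimates. -/
def outputSlots : Cmd 32 :=
  setTo vI vSlots ;;
  forLoop vOne vI
    (.prim (.read vC aCnt vI) ;;
      .ite vC
        (.prim (.read vA aPos vI) ;; .prim (.read vB aNeg vI) ;;
          .prim (.op .sub vC vA vB) ;; .prim (.op .sub vY vB vA) ;; .prim (.op .add vC vC vY) ;;
          .prim (.const vY 4) ;; .prim (.op .mul vC vY vC) ;; .prim (.op .mul vC vC vScale) ;;
          .prim (.const vY 3) ;; .prim (.op .mul vY vY vSamples) ;; .prim (.op .lt vC vC vY) ;;
          .ite vC skipCmd copySlot)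
        skipCmd)

/-- Proceed to the first nonzero digit of `ε`. -/
def epsLoop : Cmd 32 :=
  .loop vA (.prim (.op .add vI vI vOne) ;; .prim (.op .add vScale vScale vScale) ;;
    .prim (.epsDigit vA vI) ;; .prim (.op .eq vA vA vZero))

/-- Find the first nonzero digit of `ε`. -/
def findEps : Cmd 32 :=
  .prim (.const vI 1) ;; .prim (.const vScale 2) ;; .prim (.epsDigit vA vI) ;;
  .prim (.op .eq vA vA vZero) ;; epsLoop

/-- Proceed to the first nonzero digit of `δ`. -/
def deltaLoop : Cmd 32 :=
  .loop vA (.prim (.op .add vLog vLog vOne) ;; .prim (.deltaDigit vA vLog) ;;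
    .prim (.op .eq vA vA vZero))

/-- Find the first nonzero digit of `δ`. -/
def findDelta : Cmd 32 :=
  .prim (.const vLog 1) ;; .prim (.deltaDigit vA vLog) ;; .prim (.op .eq vA vA vZero) ;;
  deltaLoop

/-- Compute the parameters. -/
def prepare : Cmd 32 :=
  .prim (.const vOne 1) ;; .prim (.size vSize) ;; .prim (.op .add vQubits vSize vOne) ;;
  findEps ;; findDelta ;;
  .prim (.op .add vLog vLog vI) ;; .prim (.op .add vLog vLog vI) ;;
  .prim (.op .mul vA vScale vScale) ;; .prim (.const vB 8) ;; .prim (.op .mul vSlots vA vB) ;;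
  .prim (.const vB 256) ;; .prim (.op .mul vSamples vA vB) ;;
  .prim (.op .mul vSamples vSamples vLog)

/-- Apply Hadamard gates to all qubits. -/
def applyHadamards : Cmd 32 :=
  setTo vJ vQubits ;; forLoop vOne vJ (.prim (.gate .hadamard vJ))

/-- Measure all qubits. -/
def measureAll : Cmd 32 :=
  setTo vJ vQubits ;;
  forLoop vOne vJ (.prim (.measure vB vJ) ;; .prim (.write aBits vJ vB))

/-- Search for large Fourier coefficients by Fourier sampling. -/
def searchPhase : Cmd 32 :=
  setTo vT vSamples ;;
  forLoop vOne vT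
    (.prim .fresh ;; applyHadamards ;; measureAll ;; .prim (.read vY aBits vSize) ;;
      .ite vY updateCounters skipCmd)

/-- Estimate the Fourier coefficients at the strings in the slots. -/
def estimatePhase : Cmd 32 :=
  setTo vT vSamples ;; forLoop vOne vT (.prim .fresh ;; measureAll ;; updateEstimates)

/-- The learning algorithm. -/
def learner : Algorithm 32 where
  body := prepare ;; searchPhase ;; estimatePhase ;; outputSlots
  len := vLen
  key := aOutKey
  pos := aOutPos
  neg := aOutNeg
  den := aOutDen

/-! ### Specifications of the classical parts -/

/-- The parameters of the program are stored in their variables. -/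
structure Ready (n k M S : ℕ) (σ : Conf 32) : Prop where
  one : σ.var vOne = 1
  zero : σ.var vZero = 0
  size : σ.var vSize = n
  qubits : σ.var vQubits = n + 1
  scale : σ.var vScale = S
  slots : σ.var vSlots = k
  samples : σ.var vSamples = M

theorem Ready.frame {n k M S : ℕ} {σ σ' : Conf 32} (h : Ready n k M S σ) {c : Cmd 32}
    (hF : Frame c σ σ')
    (hc : ([vOne, vZero, vSize, vQubits, vScale, vSlots, vSamples].all
      fun y => !c.assigns y) = true) : Ready n k M S σ' := by
  simp only [List.all_cons, Bool.and_eq_true, Bool.not_eq_true', List.all_nil] at hc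
  obtain ⟨h1, h2, h3, h4, h5, h6, h7, -⟩ := hc
  exact ⟨(hF.var _ h1).trans h.one, (hF.var _ h2).trans h.zero, (hF.var _ h3).trans h.size,
    (hF.var _ h4).trans h.qubits, (hF.var _ h5).trans h.scale, (hF.var _ h6).trans h.slots,
    (hF.var _ h7).trans h.samples⟩

theorem Ready.tick {n k M S : ℕ} {σ : Conf 32} (h : Ready n k M S σ) : Ready n k M S σ.tick :=
  ⟨h.one, h.zero, h.size, h.qubits, h.scale, h.slots, h.samples⟩

theorem Ready.setVar {n k M S : ℕ} {σ : Conf 32} (h : Ready n k M S σ) {x : Fin 32} {a : ℕ}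
    (hx : vSamples < x) : Ready n k M S (σ.setVar x a) := by
  have : ∀ y ≤ vSamples, (σ.setVar x a).var y = σ.var y := fun y hy => by
    rw [Conf.setVar_var, Function.update_of_ne (hy.trans_lt hx).ne]
  constructor <;> rw [this _ (by decide)]
  exacts [h.one, h.zero, h.size, h.qubits, h.scale, h.slots, h.samples]

theorem Ready.enter {n k M S : ℕ} {σ : Conf 32} (h : Ready n k M S σ) {x : Fin 32} {a : ℕ}
    (hx : vSamples < x) : Ready n k M S (σ.enter x a) := by
  have h := h.setVar (a := a) hx
  exact ⟨h.one, h.zero, h.size, h.qubits, h.scale, h.slots, h.samples⟩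

/-- The bounds `β` leave enough room for the program. -/
structure Limits.Large (β : Limits) (n k M S : ℕ) : Prop where
  word_base : 300 + n ≤ β.word
  word_index : k * n + k + n ≤ β.word
  word_value : 4 * M * S ≤ β.word
  word_samples : 4 * M ≤ β.word
  cell : M ≤ β.cell
  len_bits : n + 1 ≤ β.len
  len_slots : k + 1 ≤ β.len
  len_index : k * n + 1 ≤ β.len

variable {n k M S : ℕ} {ε δ : ℝ} {β : Limits}

theorem index_lt {i j : ℕ} (hi : i < k) (hj : j < n) : i * n + j < k * n := by
  calc i * n + j < i * n + n := by omega
    _ = (i + 1) * n := by ring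
    _ ≤ _ := Nat.mul_le_mul_right _ hi

/-- Cells of different slots are disjoint, so writing one string leaves the others intact. -/
theorem index_inj {i j a b : ℕ} (ha : a < n) (hb : b < n) (h : i * n + a = j * n + b) :
    i = j ∧ a = b := by
  have h1 : (i * n + a) / n = i := by
    rw [add_comm, Nat.add_mul_div_right _ _ (by omega), Nat.div_eq_of_lt ha, zero_add]
  have h2 : (j * n + b) / n = j := by
    rw [add_comm, Nat.add_mul_div_right _ _ (by omega), Nat.div_eq_of_lt hb, zero_add]
  obtain rfl : i = j := by rw [← h1, h, h2]
  exact ⟨rfl, by omega⟩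

/-- Loops count down, so the indices already treated are those from `j` on. This splits off the one
treated in the current round. -/
theorem forall_ge_iff {j m : ℕ} (hj : j < m) {P : ℕ → Prop} :
    (∀ i, j ≤ i → i < m → P i) ↔ P j ∧ ∀ i, j + 1 ≤ i → i < m → P i := by
  refine ⟨fun h => ⟨h j le_rfl hj, fun i hi => h i (by omega)⟩, fun h i hi hm => ?_⟩
  rcases Nat.eq_or_lt_of_le hi with rfl | hi
  exacts [h.1, h.2 i hi hm]

/-- The string in slot `i` of the array `a` agrees with the string `b`. -/
def Matches (n : ℕ) (a b : ℕ → ℕ) (i : ℕ) : Prop := ∀ j < n, a (i * n + j) = b j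

theorem compareSlot_wp (hβ : β.Large n k M S) {σ : Conf 32} (hσ : Ready n k M S σ)
    (hi : σ.var vI < k) :
    compareSlot.wp n ε δ β (fun σ' => (σ'.var vSame ≠ 0 ↔
      Matches n (σ.arr aKey) (σ.arr aBits) (σ.var vI)) ∧
      σ'.time ≤ σ.time + 14 * n + 8) σ := by
  have hw := hβ.word_base
  simp only [compareSlot, setTo, Cmd.wp, Instr.wp, BinOp.Fits, BinOp.eval]
  simp [hσ.one, hσ.zero, hσ.size]
  refine ⟨by omega, by omega, ?_⟩
  refine Cmd.wp_mono (Cmd.wp_forLoop (N := n) (τ := 11) (fun j σ' => σ'.var vSame ≤ 1 ∧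
    (σ'.var vSame ≠ 0 ↔ ∀ j', j ≤ j' → j' < n →
      σ.arr aKey (σ.var vI * n + j') = σ.arr aBits j')) hσ.one rfl rfl rfl (fun _ => id) ?_ ?_) ?_
  · rintro j σ' hj hF ⟨h1, h2⟩
    have hR := ((hσ.tick.setVar (by decide)).tick.setVar (by decide)).frame hF rfl
    have hk : σ'.arr aKey = σ.arr aKey := hF.arr _ rfl
    have hb : σ'.arr aBits = σ.arr aBits := hF.arr _ rfl
    have hv : σ'.var vI = σ.var vI := hF.var _ rfl
    have := index_lt hi hj
    have := hβ.word_index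
    simp [index, Cmd.wp, Instr.wp, BinOp.Fits, BinOp.eval, hR.size, hv, hk, hb]
    refine ⟨by omega, by omega, by split_ifs <;> omega, by split_ifs <;> omega, ?_⟩
    rw [forall_ge_iff hj]
    exact and_congr_right fun _ => h2
  · simp
    intro j' h1 h2
    omega
  · rintro σ' ⟨⟨h1, h2⟩, h3⟩
    refine ⟨by simpa [Matches] using h2, ?_⟩
    simp at h3
    omega

theorem scanSlots_wp (hβ : β.Large n k M S) {σ : Conf 32} (hσ : Ready n k M S σ) :
    scanSlots.wp n ε δ β (fun σ' =>
      ((σ'.var vFound ≠ 0 → σ'.var vFoundAt < k ∧ σ.arr aCnt (σ'.var vFoundAt) ≠ 0 ∧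
        Matches n (σ.arr aKey) (σ.arr aBits) (σ'.var vFoundAt)) ∧
      (σ'.var vFound = 0 → ∀ i < k, σ.arr aCnt i ≠ 0 →
        ¬Matches n (σ.arr aKey) (σ.arr aBits) i) ∧
      (σ'.var vHole ≠ 0 → σ'.var vHoleAt < k ∧ σ.arr aCnt (σ'.var vHoleAt) = 0) ∧
      (σ'.var vHole = 0 → ∀ i < k, σ.arr aCnt i ≠ 0)) ∧
      σ'.time ≤ σ.time + k * (14 * n + 30) + 10) σ := by
  have hw := hβ.word_base
  have hw' := hβ.word_index
  simp only [scanSlots, setTo, Cmd.wp, Instr.wp, BinOp.Fits, BinOp.eval]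
  simp [hσ.zero, hσ.slots]
  refine ⟨by omega, ?_⟩
  refine Cmd.wp_mono (Cmd.wp_forLoop (N := k) (τ := 14 * n + 27) (fun i₀ σ' =>
      (σ'.var vFound ≠ 0 → σ'.var vFoundAt < k ∧ σ.arr aCnt (σ'.var vFoundAt) ≠ 0 ∧
        Matches n (σ.arr aKey) (σ.arr aBits) (σ'.var vFoundAt)) ∧
      (σ'.var vFound = 0 → ∀ i, i₀ ≤ i → i < k → σ.arr aCnt i ≠ 0 →
        ¬Matches n (σ.arr aKey) (σ.arr aBits) i) ∧
      (σ'.var vHole ≠ 0 → σ'.var vHoleAt < k ∧ σ.arr aCnt (σ'.var vHoleAt) = 0) ∧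
      (σ'.var vHole = 0 → ∀ i, i₀ ≤ i → i < k → σ.arr aCnt i ≠ 0))
    hσ.one rfl rfl rfl (fun _ => id) ?_ ?_) ?_
  · rintro i σ' hi hF ⟨h1, h2, h3, h4⟩
    have hR := (((hσ.tick.setVar (by decide)).tick.setVar (by decide)).tick.setVar
      (by decide)).frame hF rfl
    have hk : σ'.arr aKey = σ.arr aKey := hF.arr _ rfl
    have hb : σ'.arr aBits = σ.arr aBits := hF.arr _ rfl
    have hc : σ'.arr aCnt = σ.arr aCnt := hF.arr _ rfl
    rw [Cmd.wp]
    refine Cmd.wp_and_frame (compareSlot_wp hβ (hR.enter (by decide)).tick (by simpa using hi))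
      fun σ₁ hσ₁ hF₁ => ?_
    have hR₁ := ((hR.enter (x := vI) (a := i) (by decide)).tick).frame hF₁ rfl
    have e1 : σ₁.arr aCnt = σ.arr aCnt := (hF₁.arr _ rfl).trans hc
    have e2 : σ₁.var vFound = σ'.var vFound := hF₁.var _ rfl
    have e3 : σ₁.var vFoundAt = σ'.var vFoundAt := hF₁.var _ rfl
    have e4 : σ₁.var vHole = σ'.var vHole := hF₁.var _ rfl
    have e5 : σ₁.var vHoleAt = σ'.var vHoleAt := hF₁.var _ rfl
    have e6 : σ₁.var vI = i := hF₁.var _ rfl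
    obtain ⟨hs, ht⟩ := hσ₁
    simp [hk, hb] at hs ht
    simp [skipCmd, Cmd.wp, Instr.wp, BinOp.Fits, BinOp.eval, hR₁.one, hR₁.zero, e1, e2, e3,
      e4, e5, e6]
    simp only [forall_ge_iff hi]
    have hiw : i ≤ β.word := by omega
    have hiw' : 1 ≤ β.word := by omega
    have ht' : σ₁.time + 6 < σ'.time + 3 + (14 * n + 27) := by omega
    clear hF hF₁ hR hR₁ hσ hβ
    grind
  · simp
    exact ⟨fun i h1 h2 => by omega, fun i h1 h2 => by omega⟩
  · rintro σ' ⟨⟨h1, h2, h3, h4⟩, h5⟩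
    refine ⟨⟨h1, fun h i hi => h2 h i (Nat.zero_le _) hi, h3,
      fun h i hi => h4 h i (Nat.zero_le _) hi⟩, ?_⟩
    simp only [Conf.setVar_time, Conf.tick_time] at h5
    rw [show 14 * n + 27 + 3 = 14 * n + 30 by omega] at h5
    omega

theorem decrementAll_wp (hβ : β.Large n k M S) {σ : Conf 32} (hσ : Ready n k M S σ)
    (hc : ∀ i < k, σ.arr aCnt i ≤ M) :
    decrementAll.wp n ε δ β (fun σ' =>
      (∀ i < k, σ'.arr aCnt i = σ.arr aCnt i - 1) ∧ σ'.time ≤ σ.time + 9 * k + 4) σ := by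
  have hw := hβ.word_index
  have hl := hβ.len_slots
  have hM := hβ.cell
  simp only [decrementAll, setTo, Cmd.wp, Instr.wp, BinOp.Fits, BinOp.eval]
  simp [hσ.zero, hσ.slots]
  refine ⟨by omega, ?_⟩
  refine Cmd.wp_mono (Cmd.wp_forLoop (N := k) (τ := 6) (fun i₀ σ' => ∀ i, σ'.arr aCnt i =
    if i₀ ≤ i ∧ i < k then σ.arr aCnt i - 1 else σ.arr aCnt i)
    hσ.one rfl rfl rfl (fun _ => id) ?_ ?_) ?_
  · rintro i σ' hi hF h1
    have hR := (hσ.tick.setVar (by decide)).frame hF rfl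
    simp [Cmd.wp, Instr.wp, BinOp.Fits, BinOp.eval, hR.one]
    have h2 := h1 i
    have h3 := hc i hi
    refine ⟨?_, by omega, fun j => ?_⟩
    · split_ifs at h2 <;> omega
    · have h4 := h1 j
      rw [Function.update_apply]
      grind
  · simp
  · rintro σ' ⟨h1, h2⟩
    refine ⟨fun i hi => by simp [h1, hi], ?_⟩
    simp at h2
    omega

theorem storeSample_wp (hβ : β.Large n k M S) {σ : Conf 32} (hσ : Ready n k M S σ)
    (hi : σ.var vHoleAt < k) (hb : ∀ j < n, σ.arr aBits j ≤ 1) (ha : ∀ p, σ.arr aKey p ≤ 1) :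
    storeSample.wp n ε δ β (fun σ' =>
      (Matches n (σ'.arr aKey) (σ.arr aBits) (σ.var vHoleAt) ∧
      (∀ i ≠ σ.var vHoleAt, ∀ j < n, σ'.arr aKey (i * n + j) = σ.arr aKey (i * n + j)) ∧
      ∀ p, σ'.arr aKey p ≤ 1) ∧ σ'.time ≤ σ.time + 12 * n + 4) σ := by
  have hw := hβ.word_base
  have hw' := hβ.word_index
  have hl := hβ.len_index
  have hc := β.one_le_cell
  simp only [storeSample, setTo, Cmd.wp, Instr.wp, BinOp.Fits, BinOp.eval]
  simp [hσ.zero, hσ.size]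
  refine ⟨by omega, ?_⟩
  refine Cmd.wp_mono (Cmd.wp_forLoop (N := n) (τ := 9) (fun j₀ σ' =>
    (∀ j, j₀ ≤ j → j < n → σ'.arr aKey (σ.var vHoleAt * n + j) = σ.arr aBits j) ∧
    (∀ i ≠ σ.var vHoleAt, ∀ j < n, σ'.arr aKey (i * n + j) = σ.arr aKey (i * n + j)) ∧
      ∀ p, σ'.arr aKey p ≤ 1)
    hσ.one rfl rfl rfl (fun _ => id) ?_ ?_) ?_
  · rintro j σ' hj hF ⟨h1, h2, h3⟩
    have hR := (hσ.tick.setVar (by decide)).frame hF rfl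
    have eb : σ'.arr aBits = σ.arr aBits := hF.arr _ rfl
    have ev : σ'.var vHoleAt = σ.var vHoleAt := hF.var _ rfl
    have := index_lt hi hj
    have hbj := hb j hj
    simp [index, Cmd.wp, Instr.wp, BinOp.Fits, BinOp.eval, hR.size, ev, eb]
    refine ⟨by omega, by omega, by omega, by omega, fun j' h4 h5 => ?_, fun i h4 j' h5 => ?_,
      fun p => ?_⟩
    · rw [Function.update_apply]
      split_ifs with h6
      · rw [show j' = j by omega]
      · exact h1 j' (by omega) h5
    · rw [Function.update_of_ne fun h6 => h4 (index_inj h5 hj h6).1]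
      exact h2 i h4 j' h5
    · rw [Function.update_apply]
      split_ifs
      exacts [hbj, h3 p]
  · simp [ha]
    intro j h1 h2
    omega
  · rintro σ' ⟨⟨h1, h2, h3⟩, h4⟩
    refine ⟨⟨fun j hj => h1 j (Nat.zero_le _) hj, h2, h3⟩, ?_⟩
    simp at h4
    omega

/-- The array `b` holds the bits of `v`. -/
def Stored (v : Cube (n + 1)) (b : ℕ → ℕ) : Prop := ∀ i : Fin (n + 1), b i = (v i).toNat

/-- The string in slot `i` of the array `a`. -/
def slotKey (n : ℕ) (a : ℕ → ℕ) (i : ℕ) : Cube n := fun j => decide (a (i * n + j) ≠ 0)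

theorem Stored.le_one {v : Cube (n + 1)} {b : ℕ → ℕ} (h : Stored v b) {j : ℕ} (hj : j < n + 1) :
    b j ≤ 1 := by
  rw [show b j = _ from h ⟨j, hj⟩]
  exact Bool.toNat_le _

/-- The machine compares numbers, whereas `slotKey` only distinguishes zero from nonzero. They agree
since all cells of the key array are at most `1`, a fact that is therefore carried through the whole
search. -/
theorem Stored.matches_iff {v : Cube (n + 1)} {a b : ℕ → ℕ} (h : Stored v b)
    (ha : ∀ p, a p ≤ 1) (i : ℕ) : Matches n a b i ↔ slotKey n a i = Fin.init v := by
  rw [funext_iff, Matches, Fin.forall_iff]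
  refine forall₂_congr fun j hj => ?_
  have h1 := h ⟨j, by omega⟩
  have h2 := ha (i * n + j)
  simp only at h1
  simp only [slotKey, Fin.init, Fin.castSucc_mk, h1]
  generalize v ⟨j, _⟩ = c
  have : a (i * n + j) = 0 ∨ a (i * n + j) = 1 := by omega
  rcases this with h | h <;> cases c <;> simp [h]

/-- The three branches of the code are the three Misra-Gries steps `Summary.hit`, `Summary.insert`
and `Summary.decrement`. The results of the scan are exactly their hypotheses. -/
theorem updateCounters_wp (hβ : β.Large n k M S) {σ : Conf 32} (hσ : Ready n k M S σ)
    {h : List (Cube (n + 1))} {v : Cube (n + 1)}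
    (hb : Stored v (σ.arr aBits)) (ha : ∀ p, σ.arr aKey p ≤ 1)
    (hs : Summary k h (σ.arr aCnt) (slotKey n (σ.arr aKey))) (hM : h.length < M) :
    updateCounters.wp n ε δ β (fun σ' =>
      (Summary k (v :: h) (σ'.arr aCnt) (slotKey n (σ'.arr aKey)) ∧ ∀ p, σ'.arr aKey p ≤ 1) ∧
      σ'.time ≤ σ.time + k * (14 * n + 40) + 12 * n + 30) σ := by
  have hw := hβ.word_samples
  have hcell := hβ.cell
  have hl := hβ.len_slots
  have ht : k * (14 * n + 40) = k * (14 * n + 30) + 10 * k := by ring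
  rw [updateCounters, Cmd.wp]
  refine Cmd.wp_and_frame (scanSlots_wp hβ hσ.tick) fun σ₁ hσ₁ hF₁ => ?_
  have hR₁ := hσ.tick.frame hF₁ rfl
  obtain ⟨⟨h1, h2, h3, h4⟩, h5⟩ := hσ₁
  have e0 : σ₁.arr aBits = σ.arr aBits := hF₁.arr _ rfl
  have e1 : σ₁.arr aKey = σ.arr aKey := hF₁.arr _ rfl
  have e2 : σ₁.arr aCnt = σ.arr aCnt := hF₁.arr _ rfl
  simp only [Conf.tick_arr, Conf.tick_time, hb.matches_iff ha] at h1 h2 h3 h4 h5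
  refine ⟨fun hf => ?_, fun hf => ⟨fun hh => ?_, fun hh => ?_⟩⟩
  · obtain ⟨h6, h7, h8⟩ := h1 hf
    have h9 := hs.cnt_le h6
    simp [increment, Cmd.wp, Instr.wp, BinOp.Fits, BinOp.eval, hR₁.one, e1, e2]
    exact ⟨by omega, by omega, by omega, ⟨hs.hit h6 (by omega) h8, ha⟩, by omega⟩
  · obtain ⟨h6, h7⟩ := h3 hh
    rw [Cmd.wp]
    simp only [Cmd.wp, Instr.wp, Conf.tick_var, hR₁.one]
    refine ⟨β.one_le_cell, by omega, ?_⟩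
    set σ₂ := σ₁.tick.tick.tick.setArr aCnt (σ₁.var vHoleAt) 1 with hσ₂
    have hR₂ : Ready n k M S σ₂ :=
      ⟨hR₁.one, hR₁.zero, hR₁.size, hR₁.qubits, hR₁.scale, hR₁.slots, hR₁.samples⟩
    refine Cmd.wp_and_frame (storeSample_wp hβ hR₂ h6
      (fun j hj => e0.symm ▸ hb.le_one (by omega)) (e1.symm ▸ ha)) fun σ₃ hσ₃ hF₃ => ?_
    obtain ⟨⟨h8, h9, h10⟩, h11⟩ := hσ₃
    have e3 : σ₃.arr aCnt = Function.update (σ.arr aCnt) (σ₁.var vHoleAt) 1 := by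
      rw [hF₃.arr _ rfl, ← e2]
      simp [hσ₂]
    have e4 : σ₂.arr aBits = σ.arr aBits := e0
    have e5 : σ₂.arr aKey = σ.arr aKey := e1
    have e6 : σ₂.var vHoleAt = σ₁.var vHoleAt := rfl
    rw [e4, hb.matches_iff h10, e6] at h8
    rw [e6, e5] at h9
    refine ⟨⟨?_, h10⟩, ?_⟩
    · rw [e3]
      refine (hs.insert (fun i hi hc => h2 hf i hi hc.ne') h6 h7).congr (fun _ _ => rfl)
        fun i hi => ?_
      rw [Function.update_apply]
      split_ifs with h12
      · rw [h12, h8]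
      · funext j
        rw [slotKey, h9 i h12 j j.2, slotKey]
    · simp [hσ₂] at h11
      omega
  · refine Cmd.wp_and_frame (decrementAll_wp hβ hR₁.tick.tick
      fun i hi => ?_) fun σ₃ hσ₃ hF₃ => ?_
    · have := hs.cnt_le hi
      simp only [Conf.tick_arr, e2]
      omega
    obtain ⟨h6, h7⟩ := hσ₃
    have e3 : σ₃.arr aKey = σ.arr aKey := (hF₃.arr _ rfl).trans e1
    simp only [Conf.tick_arr, e2, Conf.tick_time] at h6 h7
    rw [e3]
    refine ⟨⟨(hs.decrement (fun i hi => Nat.pos_of_ne_zero (h4 hh i hi))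
      fun i hi => h2 hf i hi (h4 hh i hi)).congr h6 fun _ _ => rfl, ha⟩, ?_⟩
    omega

end AgnosticFourier

/-! ### Classical code for parities, estimates and the output list -/

namespace AgnosticFourier

variable {n k M S : ℕ} {ε δ : ℝ} {β : Limits}

/-- The exponent is the natural number that the program accumulates before reducing it modulo `2`.
-/
theorem exampleSign_eq_neg_one_pow (s : Cube n) (v : Cube (n + 1)) :
    exampleSign s v = (-1) ^ ((v (Fin.last n)).toNat +
      ∑ j, (s j).toNat * (Fin.init v j : Bool).toNat) := by
  have : (Finset.univ.filter fun j => s j = true ∧ (Fin.init v : Cube n) j = true).card =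
      ∑ j, (s j).toNat * ((Fin.init v : Cube n) j).toNat := by
    rw [Finset.card_filter]
    refine Finset.sum_congr rfl fun j _ => ?_
    cases s j <;> cases (Fin.init v : Cube n) j <;> simp
  rw [exampleSign, parity, this, pow_add, boolSign]
  cases v (Fin.last n) <;> simp

theorem slotParity_wp (hβ : β.Large n k M S) {σ : Conf 32} (hσ : Ready n k M S σ)
    (hi : σ.var vI < k) {v : Cube (n + 1)} (hb : Stored v (σ.arr aBits))
    (ha : ∀ p, σ.arr aKey p ≤ 1) :
    slotParity.wp n ε δ β (fun σ' => (σ'.var vY ≠ 0 ↔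
      exampleSign (slotKey n (σ.arr aKey) (σ.var vI)) v ≠ 1) ∧
      σ'.time ≤ σ.time + 14 * n + 12) σ := by
  have hw := hβ.word_base
  have hw' := hβ.word_index
  simp only [slotParity, setTo, Cmd.wp, Instr.wp, BinOp.Fits, BinOp.eval]
  simp [hσ.zero, hσ.size]
  refine ⟨by omega, ?_⟩
  refine Cmd.wp_and_frame (Cmd.wp_forLoop (N := n) (τ := 11) (fun j₀ σ' =>
    σ'.var vY = σ.arr aBits n + ∑ j ∈ Finset.Ico j₀ n,
      σ.arr aKey (σ.var vI * n + j) * σ.arr aBits j)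
    hσ.one rfl rfl rfl (fun _ => id) ?_ ?_) ?_
  · rintro j σ' hj hF h1
    have hR := (((hσ.tick.setVar (by decide)).tick.setVar (by decide)).tick).frame hF rfl
    have eb : σ'.arr aBits = σ.arr aBits := hF.arr _ rfl
    have ek : σ'.arr aKey = σ.arr aKey := hF.arr _ rfl
    have ev : σ'.var vI = σ.var vI := hF.var _ rfl
    have := index_lt hi hj
    have hle : ∀ j < n, σ.arr aKey (σ.var vI * n + j) * σ.arr aBits j ≤ 1 := fun j hj =>
      Nat.mul_le_mul (ha _) (hb.le_one (by omega))
    -- The sum has at most `n` terms, each at most `1`, so the accumulator fits into a word.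
    have hsum : ∑ j ∈ Finset.Ico (j + 1) n,
        σ.arr aKey (σ.var vI * n + j) * σ.arr aBits j ≤ n - (j + 1) := by
      refine (Finset.sum_le_card_nsmul _ _ 1 fun j hj => hle j (Finset.mem_Ico.1 hj).2).trans ?_
      simp
    have hb' := hb.le_one (show n < n + 1 by omega)
    have hj' := hle j hj
    simp [index, Cmd.wp, Instr.wp, BinOp.Fits, BinOp.eval, hR.size, ev, eb, ek, h1]
    rw [Finset.sum_eq_sum_Ico_succ_bot hj]
    refine ⟨by omega, by omega, by omega, by omega, by omega⟩
  · simp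
  · rintro σ' ⟨h1, h2⟩ hF
    have hR := (((hσ.tick.setVar (by decide)).tick.setVar (by decide)).tick).frame hF rfl
    simp [hR.one, h1] at h2 ⊢
    refine ⟨by omega, ?_, by omega⟩
    have e : σ.arr aBits n + ∑ j ∈ Finset.range n, σ.arr aKey (σ.var vI * n + j) * σ.arr aBits j =
        (v (Fin.last n)).toNat + ∑ j, (slotKey n (σ.arr aKey) (σ.var vI) j).toNat *
          (Fin.init v j : Bool).toNat := by
      rw [Finset.sum_range]
      congr 1
      · exact hb (Fin.last n)
      · refine Finset.sum_congr rfl fun j _ => ?_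
        have h3 : σ.arr aBits j = (v j.castSucc).toNat := hb j.castSucc
        rw [h3]
        congr 1
        have := ha (σ.var vI * n + j)
        simp only [slotKey]
        have h4 : σ.arr aKey (σ.var vI * n + j) = 0 ∨ σ.arr aKey (σ.var vI * n + j) = 1 := by
          omega
        rcases h4 with h4 | h4 <;> simp [h4]
    rw [exampleSign_eq_neg_one_pow, ← e]
    generalize σ.arr aBits n + _ = m
    rcases Nat.even_or_odd m with hm | hm
    · simp [hm, Nat.even_iff.1 hm]
    · simp [hm, Nat.odd_iff.1 hm]
      norm_num

theorem updateEstimates_wp (hβ : β.Large n k M S) {σ : Conf 32} (hσ : Ready n k M S σ)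
    {v : Cube (n + 1)} (hb : Stored v (σ.arr aBits)) (ha : ∀ p, σ.arr aKey p ≤ 1)
    (hM : ∀ i < k, σ.arr aPos i < M ∧ σ.arr aNeg i < M) :
    updateEstimates.wp n ε δ β (fun σ' => (∀ i < k,
      (exampleSign (slotKey n (σ.arr aKey) i) v = 1 →
        σ'.arr aPos i = σ.arr aPos i + 1 ∧ σ'.arr aNeg i = σ.arr aNeg i) ∧
      (exampleSign (slotKey n (σ.arr aKey) i) v ≠ 1 →
        σ'.arr aPos i = σ.arr aPos i ∧ σ'.arr aNeg i = σ.arr aNeg i + 1)) ∧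
      σ'.time ≤ σ.time + k * (14 * n + 30) + 4) σ := by
  have hw := hβ.word_samples
  have hw' := hβ.word_index
  have hl := hβ.len_slots
  have hcell := hβ.cell
  simp only [updateEstimates, setTo, Cmd.wp, Instr.wp, BinOp.Fits, BinOp.eval]
  simp [hσ.zero, hσ.slots]
  refine ⟨by omega, ?_⟩
  refine Cmd.wp_mono (Cmd.wp_forLoop (N := k) (τ := 14 * n + 27) (fun i₀ σ' => ∀ i < k,
      (i₀ ≤ i ∧ exampleSign (slotKey n (σ.arr aKey) i) v = 1 →
        σ'.arr aPos i = σ.arr aPos i + 1 ∧ σ'.arr aNeg i = σ.arr aNeg i) ∧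
      (i₀ ≤ i ∧ exampleSign (slotKey n (σ.arr aKey) i) v ≠ 1 →
        σ'.arr aPos i = σ.arr aPos i ∧ σ'.arr aNeg i = σ.arr aNeg i + 1) ∧
      (i < i₀ → σ'.arr aPos i = σ.arr aPos i ∧ σ'.arr aNeg i = σ.arr aNeg i))
    hσ.one rfl rfl rfl (fun _ => id) ?_ ?_) ?_
  · rintro i σ' hi hF h1
    have hR := (hσ.tick.setVar (by decide)).frame hF rfl
    have eb : σ'.arr aBits = σ.arr aBits := hF.arr _ rfl
    have ek : σ'.arr aKey = σ.arr aKey := hF.arr _ rfl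
    have hR' := (hR.enter (x := vI) (a := i) (by decide)).tick
    rw [Cmd.wp]
    refine Cmd.wp_and_frame (slotParity_wp hβ hR' (by simpa using hi) (by simpa [eb] using hb)
      (by simpa [ek] using ha)) fun σ₁ hσ₁ hF₁ => ?_
    have hR₁ := hR'.frame hF₁ rfl
    have e1 : σ₁.var vI = i := hF₁.var _ rfl
    have e2 : σ₁.arr aPos = σ'.arr aPos := hF₁.arr _ rfl
    have e3 : σ₁.arr aNeg = σ'.arr aNeg := hF₁.arr _ rfl
    obtain ⟨h2, h3⟩ := hσ₁
    simp [ek] at h2 h3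
    obtain ⟨h4, h5⟩ := (h1 i hi).2.2 (by omega)
    obtain ⟨h6, h7⟩ := hM i hi
    refine ⟨fun hy => ?_, fun hy => ?_⟩
    · have hy' := h2.1 hy
      simp [increment, Cmd.wp, Instr.wp, BinOp.Fits, BinOp.eval, hR₁.one, e1, e2, e3]
      refine ⟨by omega, by omega, by omega, fun j hj => ?_, by omega⟩
      have h8 := h1 j hj
      rw [Function.update_apply]
      grind
    · have hy' := not_imp_comm.1 h2.2 (not_not.2 hy)
      simp [increment, Cmd.wp, Instr.wp, BinOp.Fits, BinOp.eval, hR₁.one, e1, e2, e3]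
      refine ⟨by omega, by omega, by omega, fun j hj => ?_, by omega⟩
      have h8 := h1 j hj
      rw [Function.update_apply]
      grind
  · simp
    intro i hi
    exact ⟨fun h => by omega, fun h => by omega⟩
  · rintro σ' ⟨h1, h2⟩
    refine ⟨fun i hi => ⟨fun h => (h1 i hi).1 ⟨Nat.zero_le _, h⟩,
      fun h => (h1 i hi).2.1 ⟨Nat.zero_le _, h⟩⟩, ?_⟩
    simp only [Conf.setVar_time, Conf.tick_time] at h2
    rw [show 14 * n + 27 + 3 = 14 * n + 30 by omega] at h2
    omega

theorem copyKey_wp (hβ : β.Large n k M S) {σ : Conf 32} (hσ : Ready n k M S σ)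
    (hi : σ.var vI < k) (hlen : σ.var vLen < k) (ha : ∀ p, σ.arr aKey p ≤ 1) :
    copyKey.wp n ε δ β (fun σ' =>
      ((∀ j < n, σ'.arr aOutKey (σ.var vLen * n + j) = σ.arr aKey (σ.var vI * n + j)) ∧
      ∀ l ≠ σ.var vLen, ∀ j < n, σ'.arr aOutKey (l * n + j) = σ.arr aOutKey (l * n + j)) ∧
      σ'.time ≤ σ.time + 16 * n + 4) σ := by
  have hw := hβ.word_base
  have hw' := hβ.word_index
  have hl := hβ.len_index
  have hc := β.one_le_cell
  simp only [copyKey, setTo, Cmd.wp, Instr.wp, BinOp.Fits, BinOp.eval]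
  simp [hσ.zero, hσ.size]
  refine ⟨by omega, ?_⟩
  refine Cmd.wp_mono (Cmd.wp_forLoop (N := n) (τ := 13) (fun j₀ σ' =>
    (∀ j, j₀ ≤ j → j < n →
      σ'.arr aOutKey (σ.var vLen * n + j) = σ.arr aKey (σ.var vI * n + j)) ∧
    ∀ l ≠ σ.var vLen, ∀ j < n, σ'.arr aOutKey (l * n + j) = σ.arr aOutKey (l * n + j))
    hσ.one rfl rfl rfl (fun _ => id) ?_ ?_) ?_
  · rintro j σ' hj hF ⟨h1, h2⟩
    have hR := (hσ.tick.setVar (by decide)).frame hF rfl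
    have ek : σ'.arr aKey = σ.arr aKey := hF.arr _ rfl
    have ev : σ'.var vI = σ.var vI := hF.var _ rfl
    have el : σ'.var vLen = σ.var vLen := hF.var _ rfl
    have := index_lt hi hj
    have := index_lt hlen hj
    have h3 := ha (σ.var vI * n + j)
    simp [index, Cmd.wp, Instr.wp, BinOp.Fits, BinOp.eval, hR.size, ev, el, ek]
    refine ⟨by omega, by omega, by omega, by omega, by omega, by omega,
      fun j' h4 h5 => ?_, fun i h4 j' h5 => ?_⟩
    · rw [Function.update_apply]
      split_ifs with h6
      · rw [show j' = j by omega]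
      · exact h1 j' (by omega) h5
    · rw [Function.update_of_ne fun h6 => h4 (index_inj h5 hj h6).1]
      exact h2 i h4 j' h5
  · simp
    intro j h1 h2
    omega
  · rintro σ' ⟨⟨h1, h2⟩, h4⟩
    refine ⟨⟨fun j hj => h1 j (Nat.zero_le _) hj, h2⟩, ?_⟩
    simp at h4
    omega

/-- Slot `i` belongs to the output. -/
def Selected (M S : ℕ) (σ : Conf 32) (i : ℕ) : Prop :=
  σ.arr aCnt i ≠ 0 ∧
    3 * M ≤ 4 * ((σ.arr aPos i - σ.arr aNeg i) + (σ.arr aNeg i - σ.arr aPos i)) * S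

/-- Entry `l` of the output of `σ'` is slot `i` of `σ`. -/
structure IsCopy (n M : ℕ) (σ σ' : Conf 32) (l i : ℕ) : Prop where
  key : ∀ j < n, σ'.arr aOutKey (l * n + j) = σ.arr aKey (i * n + j)
  pos : σ'.arr aOutPos l = σ.arr aPos i
  neg : σ'.arr aOutNeg l = σ.arr aNeg i
  den : σ'.arr aOutDen l = M

/-- The output of `σ'` consists of the selected slots of `σ` from number `i₀` on. -/
def Collected (n k M S : ℕ) (σ σ' : Conf 32) (i₀ : ℕ) : Prop :=
  ∃ g : ℕ → ℕ, σ'.var vLen + i₀ ≤ k ∧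
    (∀ l < σ'.var vLen, i₀ ≤ g l ∧ g l < k ∧ Selected M S σ (g l) ∧ IsCopy n M σ σ' l (g l)) ∧
    (∀ l < σ'.var vLen, ∀ l' < σ'.var vLen, g l = g l' → l = l') ∧
    ∀ i, i₀ ≤ i → i < k → Selected M S σ i → ∃ l < σ'.var vLen, g l = i

theorem Collected.congr {σ σ' σ'' : Conf 32} {i : ℕ} (h : Collected n k M S σ σ' i)
    (hv : σ''.var vLen = σ'.var vLen) (ha : σ''.arr = σ'.arr) : Collected n k M S σ σ'' i := by
  obtain ⟨g, h1, h2, h3, h4⟩ := h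
  refine ⟨g, by rwa [hv], fun l hl => ?_, by rwa [hv], by rwa [hv]⟩
  obtain ⟨h5, h6, h7, h8⟩ := h2 l (hv ▸ hl)
  exact ⟨h5, h6, h7, ⟨ha ▸ h8.key, ha ▸ h8.pos, ha ▸ h8.neg, ha ▸ h8.den⟩⟩

theorem Collected.skip {σ σ' σ'' : Conf 32} {i : ℕ} (h : Collected n k M S σ σ' (i + 1))
    (hi : ¬Selected M S σ i) (hv : σ''.var vLen = σ'.var vLen) (ha : σ''.arr = σ'.arr) :
    Collected n k M S σ σ'' i := by
  obtain ⟨g, h1, h2, h3, h4⟩ := h.congr hv ha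
  refine ⟨g, by omega, fun l hl => ?_, h3, fun i' hi' hk hs => ?_⟩
  · obtain ⟨h5, h6⟩ := h2 l hl
    exact ⟨by omega, h6⟩
  · rcases Nat.eq_or_lt_of_le hi' with rfl | hlt
    · exact absurd hs hi
    · exact h4 i' hlt hk hs

/-- Slots are visited in decreasing order, so all earlier entries come from slots beyond `i`. This
keeps the assignment of entries to slots injective. -/
theorem Collected.append {σ σ' σ'' : Conf 32} {i : ℕ} (h : Collected n k M S σ σ' (i + 1))
    (hi : i < k) (hs : Selected M S σ i) (hv : σ''.var vLen = σ'.var vLen + 1)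
    (hnew : IsCopy n M σ σ'' (σ'.var vLen) i)
    (hold : ∀ l ≠ σ'.var vLen, ∀ i', IsCopy n M σ σ' l i' → IsCopy n M σ σ'' l i') :
    Collected n k M S σ σ'' i := by
  obtain ⟨g, h1, h2, h3, h4⟩ := h
  refine ⟨Function.update g (σ'.var vLen) i, by omega, fun l hl => ?_, fun l hl l' hl' hg => ?_,
    fun i' hi' hk hs => ?_⟩
  · rcases eq_or_ne l (σ'.var vLen) with rfl | hne
    · rw [Function.update_self]
      exact ⟨le_rfl, hi, hs, hnew⟩
    · rw [Function.update_of_ne hne]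
      obtain ⟨h5, h6, h7, h8⟩ := h2 l (by omega)
      exact ⟨by omega, h6, h7, hold l hne _ h8⟩
  · rw [Function.update_apply, Function.update_apply] at hg
    split_ifs at hg with h5 h6 h6
    · rw [h5, h6]
    · have := (h2 l' (by omega)).1
      omega
    · have := (h2 l (by omega)).1
      omega
    · exact h3 l (by omega) l' (by omega) hg
  · rcases Nat.eq_or_lt_of_le hi' with rfl | hlt
    · exact ⟨σ'.var vLen, by omega, by simp⟩
    · obtain ⟨l, hl, hg⟩ := h4 i' hlt hk hs
      exact ⟨l, by omega, by rw [Function.update_of_ne (by omega), hg]⟩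

theorem copySlot_wp (hβ : β.Large n k M S) {σ σ₀ : Conf 32} (hσ : Ready n k M S σ)
    (ha : ∀ p, σ.arr aKey p ≤ 1) {i : ℕ} (hi : i < k) (hv : σ.var vI = i)
    (hpos : σ₀.arr aPos i = σ.var vA) (hneg : σ₀.arr aNeg i = σ.var vB)
    (hkey : σ₀.arr aKey = σ.arr aKey) (hA : σ.var vA ≤ M) (hB : σ.var vB ≤ M)
    (hs : Selected M S σ₀ i) (hc : Collected n k M S σ₀ σ (i + 1)) :
    copySlot.wp n ε δ β (fun σ' => Collected n k M S σ₀ σ' i ∧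
      σ'.time ≤ σ.time + 16 * n + 12) σ := by
  -- Each slot visited contributes at most one entry, so the list never outgrows the space reserved
  -- for `k` strings.
  have hlen : σ.var vLen + 1 ≤ k := by
    obtain ⟨g, h1, -⟩ := hc
    omega
  have hl := hβ.len_slots
  have hw := hβ.word_index
  have hcell := hβ.cell
  simp only [copySlot, Cmd.wp, Instr.wp, Conf.tick_var, Conf.setArr_var, hσ.samples]
  refine ⟨by omega, by omega, by omega, by omega, by omega, by omega, ?_⟩
  set σ₁ := ((((σ.tick.setArr aOutPos (σ.var vLen) (σ.var vA)).tick.setArr aOutNeg (σ.var vLen)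
    (σ.var vB)).tick.setArr aOutDen (σ.var vLen) M).tick) with hσ₁
  have hR₁ : Ready n k M S σ₁ :=
    ⟨hσ.one, hσ.zero, hσ.size, hσ.qubits, hσ.scale, hσ.slots, hσ.samples⟩
  refine Cmd.wp_and_frame (copyKey_wp hβ hR₁ (by simpa [hσ₁, hv] using hi)
    (by simpa [hσ₁] using hlen) (by simpa [hσ₁] using ha)) fun σ₂ hσ₂ hF => ?_
  have hR₂ := hR₁.frame hF rfl
  obtain ⟨⟨h1, h2⟩, h3⟩ := hσ₂
  have e1 : σ₂.var vLen = σ.var vLen := hF.var _ rfl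
  have e2 : σ₂.arr aOutPos = Function.update (σ.arr aOutPos) (σ.var vLen) (σ.var vA) :=
    hF.arr _ rfl
  have e3 : σ₂.arr aOutNeg = Function.update (σ.arr aOutNeg) (σ.var vLen) (σ.var vB) :=
    hF.arr _ rfl
  have e4 : σ₂.arr aOutDen = Function.update (σ.arr aOutDen) (σ.var vLen) M :=
    hF.arr _ rfl
  have e5 : σ₁.arr aKey = σ.arr aKey := rfl
  have e6 : σ₁.arr aOutKey = σ.arr aOutKey := rfl
  have e7 : σ₁.var vLen = σ.var vLen := rfl
  have e8 : σ₁.var vI = σ.var vI := rfl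
  have e9 : σ₁.time = σ.time + 6 + 1 := rfl
  rw [e5, e7, e8, hv] at h1
  rw [e6, e7] at h2
  simp only [BinOp.Fits, BinOp.eval, hR₂.one, e1]
  refine ⟨by omega, hc.append hi hs (by simp) ?_ ?_, ?_⟩
  · exact ⟨by simpa [hkey] using h1, by simp [e2, hpos], by simp [e3, hneg], by simp [e4]⟩
  · intro l hl i' h
    exact ⟨fun j hj => (h2 l hl j hj).trans (h.key j hj), by simpa [e2, hl] using h.pos,
      by simpa [e3, hl] using h.neg, by simpa [e4, hl] using h.den⟩
  · simp
    omega

theorem outputSlots_wp (hβ : β.Large n k M S) {σ : Conf 32} (hσ : Ready n k M S σ)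
    (ha : ∀ p, σ.arr aKey p ≤ 1) (hlen : σ.var vLen = 0)
    (hM : ∀ i < k, σ.arr aPos i + σ.arr aNeg i ≤ M) :
    outputSlots.wp n ε δ β (fun σ' => Collected n k M S σ σ' 0 ∧
      σ'.time ≤ σ.time + k * (16 * n + 50) + 4) σ := by
  have hw := hβ.word_samples
  have hw' := hβ.word_index
  have hwv := hβ.word_value
  have hwb := hβ.word_base
  have hl := hβ.len_slots
  have hcell := hβ.cell
  simp only [outputSlots, setTo, Cmd.wp, Instr.wp, BinOp.Fits, BinOp.eval]
  simp [hσ.zero, hσ.slots]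
  refine ⟨by omega, ?_⟩
  refine Cmd.wp_mono (Cmd.wp_forLoop (N := k) (τ := 16 * n + 47)
    (fun i₀ σ' => Collected n k M S σ σ' i₀) hσ.one rfl rfl rfl
    (fun _ h => h.congr rfl rfl) ?_ ?_) ?_
  · rintro i σ' hi hF h1
    have hR := (hσ.tick.setVar (by decide)).frame hF rfl
    have ek : σ'.arr aKey = σ.arr aKey := hF.arr _ rfl
    have ec : σ'.arr aCnt = σ.arr aCnt := hF.arr _ rfl
    have ep : σ'.arr aPos = σ.arr aPos := hF.arr _ rfl
    have en : σ'.arr aNeg = σ.arr aNeg := hF.arr _ rfl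
    have h2 := hM i hi
    -- One of the two truncated differences vanishes, so `d` is the absolute difference. The test `4
    -- d S < 3 M` compares `d / M` with `3/(4S)` in integers.
    set d := (σ.arr aPos i - σ.arr aNeg i) + (σ.arr aNeg i - σ.arr aPos i) with hd
    have hdM : d ≤ M := by omega
    have hdS : 4 * d * S ≤ 4 * M * S := by gcongr
    have hsel : Selected M S σ i ↔ σ.arr aCnt i ≠ 0 ∧ 3 * M ≤ 4 * d * S := Iff.rfl
    simp [skipCmd, Cmd.wp, Instr.wp, BinOp.Fits, BinOp.eval, ec, ep, en, hR.scale,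
      hR.samples, ← hd]
    refine ⟨fun hc => ⟨by omega, by omega, by omega, by omega, by omega, by omega,
      fun hlt => ⟨h1.skip (fun h => by have := (hsel.1 h).2; omega) rfl rfl, by omega⟩,
      fun hle => ?_⟩, fun hc => ⟨h1.skip (fun h => (hsel.1 h).1 hc) rfl rfl, by omega⟩⟩
    refine Cmd.wp_mono (copySlot_wp hβ (σ₀ := σ) ?_ ?_ hi ?_ ?_ ?_ ?_ ?_ ?_
      (hsel.2 ⟨hc, hle⟩) ?_) fun σ₁ h3 => ⟨h3.1, ?_⟩
    · exact ⟨hR.one, hR.zero, hR.size, hR.qubits, hR.scale, hR.slots, hR.samples⟩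
    · exact ek ▸ ha
    · rfl
    · rfl
    · rfl
    · exact ek.symm
    · exact (Nat.le_add_right _ _).trans h2
    · exact (Nat.le_add_left _ _).trans h2
    · exact h1.congr rfl rfl
    · have := h3.2
      simp at this
      omega
  · exact ⟨fun _ => 0, by simp [hlen], by simp [hlen], by simp [hlen], fun i h1 h2 => by omega⟩
  · rintro σ' ⟨h1, h2⟩
    refine ⟨h1, ?_⟩
    simp only [Conf.setVar_time, Conf.tick_time] at h2
    rw [show 16 * n + 47 + 3 = 16 * n + 50 by omega] at h2
    omega

end AgnosticFourier

/-! ### Leading binary digits and the parameters -/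

namespace AgnosticFourier

variable {n k M S : ℕ} {ε δ : ℝ} {β : Limits}

/-- The least `a` with `1 ≤ r 2^a`: minimality gives `r 2^a < 2` and zero integer parts before `a`,
and `r < 1` excludes `a = 0`. Thus `2^a` is a computable approximation of `1/r` within a factor of
two. -/
theorem exists_first_digit {r : ℝ} (h0 : 0 < r) (h1 : r < 1) :
    ∃ a : ℕ, 1 ≤ a ∧ 1 ≤ r * 2 ^ a ∧ r * 2 ^ a < 2 ∧ digit r a = 1 ∧
      ∀ i < a, digit r i = 0 := by
  have hex : ∃ a : ℕ, 1 ≤ r * 2 ^ a := by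
    obtain ⟨a, ha⟩ := pow_unbounded_of_one_lt (1 / r) one_lt_two
    refine ⟨a, ?_⟩
    rw [div_lt_iff₀ h0] at ha
    linarith
  classical
  obtain ⟨a, ha, hmin⟩ : ∃ a : ℕ, 1 ≤ r * 2 ^ a ∧ ∀ i < a, r * 2 ^ i < 1 :=
    ⟨Nat.find hex, Nat.find_spec hex, fun i hi => not_le.1 (Nat.find_min hex hi)⟩
  have ha1 : 1 ≤ a := by
    rcases Nat.eq_zero_or_pos a with rfl | h
    · norm_num at ha
      linarith
    · exact h
  have ha2 : r * 2 ^ a < 2 := by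
    have := hmin (a - 1) (by omega)
    rw [show a = a - 1 + 1 by omega, pow_succ]
    linarith
  refine ⟨a, ha1, ha, ha2, ?_, fun i hi => ?_⟩
  · have : ⌊r * 2 ^ a⌋₊ = 1 := by
      rw [Nat.floor_eq_iff (by positivity)]
      norm_num
      exact ⟨ha, ha2⟩
    rw [digit, this]
  · rw [digit, Nat.floor_eq_zero.2 (hmin i hi)]

theorem findEps_wp {σ : Conf 32} (hone : σ.var vOne = 1) (hzero : σ.var vZero = 0) {a : ℕ}
    (ha : 1 ≤ a) (hd : digit ε a = 1) (hd0 : ∀ i < a, digit ε i = 0) (hw : 2 ^ a ≤ β.word) :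
    findEps.wp n ε δ β (fun σ' => (σ'.var vI = a ∧ σ'.var vScale = 2 ^ a) ∧
      σ'.time ≤ σ.time + 8 * a + 10) σ := by
  have h2 : 2 ≤ 2 ^ a := by
    calc 2 = 2 ^ 1 := rfl
      _ ≤ 2 ^ a := Nat.pow_le_pow_right (by norm_num) ha
  simp only [findEps, Cmd.wp, Instr.wp, BinOp.Fits, BinOp.eval]
  simp [hzero]
  refine ⟨by omega, by omega, ?_⟩
  -- The search starts at digit `1`, so `a - 1` rounds remain. The test variable is `1` as long as
  -- the current digit is `0`.
  refine Cmd.wp_loop (m := a - 1) (fun m σ' => σ'.var vOne = 1 ∧ σ'.var vZero = 0 ∧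
    σ'.var vI + m = a ∧ σ'.var vScale = 2 ^ (σ'.var vI) ∧
    σ'.var vA = (if digit ε (σ'.var vI) = 0 then 1 else 0) ∧
    σ'.time + 8 * m ≤ σ.time + 8 * a + 7) ?_ ?_ ?_
  · rintro m σ' ⟨h1, h3, h4, h5, h6, h7⟩
    have h8 := hd0 (σ'.var vI) (by omega)
    rw [if_pos h8] at h6
    refine ⟨by omega, ?_⟩
    have h9 : 2 ^ (σ'.var vI) + 2 ^ (σ'.var vI) = 2 ^ (σ'.var vI + 1) := by ring
    have h10 : 2 ^ (σ'.var vI + 1) ≤ 2 ^ a := Nat.pow_le_pow_right (by norm_num) (by omega)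
    have h11 : a < 2 ^ a := Nat.lt_two_pow_self
    simp [Cmd.wp, Instr.wp, BinOp.Fits, BinOp.eval, h1, h3, h5]
    refine ⟨by omega, by omega, by omega, by omega, by omega⟩
  · rintro σ' ⟨h1, h3, h4, h5, h6, h7⟩
    have h8 : σ'.var vI = a := by omega
    rw [h8, hd] at h6
    rw [h8] at h5
    refine ⟨by simpa using h6, ⟨h8, h5⟩, ?_⟩
    simp
    omega
  · simp [hone, hzero]
    omega

theorem findDelta_wp {σ : Conf 32} (hone : σ.var vOne = 1) (hzero : σ.var vZero = 0) {d : ℕ}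
    (ha : 1 ≤ d) (hd : digit δ d = 1) (hd0 : ∀ i < d, digit δ i = 0) (hw : d ≤ β.word) :
    findDelta.wp n ε δ β (fun σ' => σ'.var vLog = d ∧ σ'.time ≤ σ.time + 6 * d + 10) σ := by
  simp only [findDelta, Cmd.wp, Instr.wp, BinOp.Fits, BinOp.eval]
  simp [hzero]
  refine ⟨by omega, ?_⟩
  refine Cmd.wp_loop (m := d - 1) (fun m σ' => σ'.var vOne = 1 ∧ σ'.var vZero = 0 ∧
    σ'.var vLog + m = d ∧
    σ'.var vA = (if digit δ (σ'.var vLog) = 0 then 1 else 0) ∧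
    σ'.time + 6 * m ≤ σ.time + 6 * d + 7) ?_ ?_ ?_
  · rintro m σ' ⟨h1, h3, h4, h6, h7⟩
    have h8 := hd0 (σ'.var vLog) (by omega)
    rw [if_pos h8] at h6
    refine ⟨by omega, ?_⟩
    simp [Cmd.wp, Instr.wp, BinOp.Fits, BinOp.eval, h1, h3]
    refine ⟨by omega, by omega, by omega⟩
  · rintro σ' ⟨h1, h3, h4, h6, h7⟩
    have h8 : σ'.var vLog = d := by omega
    rw [h8, hd] at h6
    refine ⟨by simpa using h6, h8, ?_⟩
    simp
    omega
  · simp [hone, hzero]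
    omega

/-- The numbers of slots and of samples for `a` and `d` leading digits of `ε` and `δ`. -/
def slotCount (a : ℕ) : ℕ := 2 ^ a * 2 ^ a * 8

/-- The number of samples per phase. -/
def sampleCount (a d : ℕ) : ℕ := 2 ^ a * 2 ^ a * 256 * (d + a + a)

theorem le_sampleCount {a d : ℕ} (hd : 1 ≤ d) :
    2 ^ a * 2 ^ a * 256 ≤ sampleCount a d ∧ d + a + a ≤ sampleCount a d := by
  have h1 : 0 < 2 ^ a * 2 ^ a := by positivity
  constructor
  · exact Nat.le_mul_of_pos_right _ (by omega)
  · exact Nat.le_mul_of_pos_left _ (by positivity)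

theorem two_pow_le_mul_self (a : ℕ) : 2 ^ a ≤ 2 ^ a * 2 ^ a :=
  Nat.le_mul_of_pos_left _ (by positivity)

theorem prepare_wp {a d : ℕ} (hβ : β.Large n (slotCount a) (sampleCount a d) (2 ^ a))
    {σ : Conf 32} (hzero : σ.var vZero = 0)
    (ha : 1 ≤ a) (hda : digit ε a = 1) (hda0 : ∀ i < a, digit ε i = 0)
    (hd : 1 ≤ d) (hdd : digit δ d = 1) (hdd0 : ∀ i < d, digit δ i = 0) :
    prepare.wp n ε δ β (fun σ' => Ready n (slotCount a) (sampleCount a d) (2 ^ a) σ' ∧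
      σ'.time ≤ σ.time + 8 * a + 6 * d + 60) σ := by
  have hw := hβ.word_samples
  have hwb := hβ.word_base
  obtain ⟨hM1, hM2⟩ := le_sampleCount (a := a) hd
  have hS := two_pow_le_mul_self a
  have hS1 : 0 < 2 ^ a := by positivity
  simp only [prepare, Cmd.wp]
  simp only [Instr.wp, BinOp.Fits, BinOp.eval]
  refine ⟨by omega, by omega, by simp; omega, ?_⟩
  refine Cmd.wp_and_frame (findEps_wp (a := a) (by simp) (by simpa using hzero) ha hda hda0
    (by omega)) fun σ₁ ⟨⟨h1, h2⟩, h3⟩ hF₁ => ?_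
  have e1 : σ₁.var vOne = 1 := hF₁.var _ rfl
  have e2 : σ₁.var vZero = 0 := (hF₁.var _ rfl).trans hzero
  have e3 : σ₁.var vSize = n := hF₁.var _ rfl
  have e4 : σ₁.var vQubits = n + 1 := hF₁.var _ rfl
  refine Cmd.wp_and_frame (findDelta_wp (d := d) (by simpa using e1) (by simpa using e2) hd hdd
    hdd0 (by omega)) fun σ₂ ⟨h4, h5⟩ hF₂ => ?_
  have g1 : σ₂.var vOne = 1 := (hF₂.var _ rfl).trans e1
  have g2 : σ₂.var vZero = 0 := (hF₂.var _ rfl).trans e2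
  have g3 : σ₂.var vSize = n := (hF₂.var _ rfl).trans e3
  have g4 : σ₂.var vQubits = n + 1 := (hF₂.var _ rfl).trans e4
  have g5 : σ₂.var vI = a := (hF₂.var _ rfl).trans h1
  have g6 : σ₂.var vScale = 2 ^ a := (hF₂.var _ rfl).trans h2
  simp at h3 h5
  simp [h4, g5, g6]
  rw [sampleCount] at hM1 hM2 hw ⊢
  refine ⟨by omega, by omega, by omega, by omega, by omega, by omega, by omega, by omega, ?_,
    by omega⟩
  constructor <;> simp [g1, g2, g3, g4, g6, slotCount]

/-! ### Specifications of the quantum parts -/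

section Quantum

variable {D : PMF (Cube n × Bool)} {τ : ℕ} {E : Set (State 32 n)}

theorem Ok.forLoop_succ {o x : Fin 32} {c : Cmd 32} {r : List (Cmd 32)} {σ : Conf 32}
    {ρ : QOp (n + 1)} {b : ℝ} {j : ℕ} (hσ : σ.Within β) (ho : σ.var o = 1)
    (hx : σ.var x = j + 1)
    (h : (σ.enter x j).Within β → Ok D ε δ β τ E (c :: forLoop o x c :: r) (σ.enter x j) ρ b) :
    Ok D ε δ β τ E (forLoop o x c :: r) σ ρ b := by
  refine .loop_ne_zero hσ (by omega) (.seq hσ.tick ?_)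
  refine .prim (Q := fun σ' => σ' = σ.enter x j) hσ.tick.tick ⟨trivial, ?_⟩ ?_
  · simp [BinOp.eval, hx, ho, Conf.enter, Conf.setVar, Conf.tick]
  · rintro σ' rfl hw
    exact h hw

/-- With counter `j`, the gates have been applied to the qubits from `j` on, and the register is
conjugated by `hadamardFrom (n + 1) j`. -/
theorem Ok.applyHadamards {r : List (Cmd 32)} {σ : Conf 32} {ρ : QOp (n + 1)} {b : ℝ}
    (hβ : β.Large n k M S) (hσ : σ.Within β) (hR : Ready n k M S σ)
    (hg : σ.gates + (n + 1) ≤ β.gates)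
    (h : ∀ σ' : Conf 32, σ'.Within β → (∀ y ≠ vJ, σ'.var y = σ.var y) → σ'.arr = σ.arr →
      σ'.copies = σ.copies → σ'.gates = σ.gates + (n + 1) →
      σ'.time ≤ σ.time + 4 * (n + 1) + 3 →
      Ok D ε δ β τ E r σ'
        (hadamardFrom (n + 1) 0 * ρ * (hadamardFrom (n + 1) 0).conjTranspose) b) :
    Ok D ε δ β τ E (applyHadamards :: r) σ ρ b := by
  have hw := hβ.word_base
  refine .seq hσ (.of_wp hσ.tick (Q := fun σ' => σ' = σ.tick.setVar vJ (n + 1)) ?_ ?_)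
  · simp [setTo, Cmd.wp, Instr.wp, BinOp.Fits, BinOp.eval, hR.qubits, hR.zero]
    omega
  rintro σ₀ rfl hσ₀ -
  suffices H : ∀ j, j ≤ n + 1 → ∀ σ' : Conf 32, σ'.Within β → σ'.var vJ = j →
      (∀ y ≠ vJ, σ'.var y = σ.var y) → σ'.arr = σ.arr → σ'.copies = σ.copies →
      σ'.gates + j = σ.gates + (n + 1) →
      σ'.time + 4 * j ≤ σ.time + 4 * (n + 1) + 2 →
      Ok D ε δ β τ E (forLoop vOne vJ (.prim (.gate .hadamard vJ)) :: r) σ'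
        (hadamardFrom (n + 1) j * ρ * (hadamardFrom (n + 1) j).conjTranspose) b by
    have := H (n + 1) le_rfl _ hσ₀ (by simp)
      (fun y hy => by simp [Function.update_of_ne hy]) rfl rfl rfl (by simp; omega)
    simpa [hadamardFrom_of_le] using this
  intro j
  induction j with
  | zero =>
    intro _ σ' hσ' hj hv ha hc hg' ht
    exact .loop_zero hσ' hj (h _ hσ'.tick hv ha hc hg' (by simp; omega))
  | succ j ih =>
    intro hjn σ' hσ' hj hv ha hc hg' ht
    refine .forLoop_succ hσ' ((hv _ (by decide)).trans hR.one) hj fun hw' => ?_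
    refine .gate hw' ⟨j, by omega⟩ (by simp) ?_
    have := ih (by omega) (σ'.enter vJ j).gate (hw'.gate (by simp; omega)) (by simp)
      (fun y hy => by simpa [Function.update_of_ne hy] using hv y hy) ha hc
      (by simp; omega) (by simp; omega)
    rw [← onQubit_mul_hadamardFrom (q := n + 1) ⟨j, by omega⟩, Matrix.conjTranspose_mul] at this
    simpa only [Matrix.mul_assoc] using this

/-- The vectors `v` and `w` agree from position `j` on. -/
def AgreeFrom {q : ℕ} (j : ℕ) (v w : Cube q) : Prop := ∀ i, j ≤ i.1 → v i = w i

theorem agreeFrom_update {q : ℕ} (i : Fin q) (v w : Cube q) (a : Bool) :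
    AgreeFrom i.1 w (Function.update v i a) ↔ w i = a ∧ AgreeFrom (i.1 + 1) w v := by
  constructor
  · intro h
    refine ⟨by simpa using h i le_rfl, fun l hl => ?_⟩
    have := h l (by omega)
    rwa [Function.update_of_ne (by rintro rfl; omega)] at this
  · rintro ⟨h1, h2⟩ l hl
    rcases eq_or_ne l i with rfl | hne
    · simpa using h1
    · have : (l : ℕ) ≠ i := fun h => hne (Fin.ext h)
      rw [Function.update_of_ne hne]
      exact h2 l (by omega)

theorem qubitProj_conj_apply {q : ℕ} (i : Fin q) (a : Bool) (ρ : QOp q) (w : Cube q) :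
    (qubitProj i a * ρ * qubitProj i a) w w = if w i = a then ρ w w else 0 := by
  rw [qubitProj, Matrix.mul_diagonal, Matrix.diagonal_mul]
  split_ifs <;> simp

-- Only the diagonal of the register has to be followed, because it determines both the outcome
-- probabilities and the trace. After the qubits from `j` on have been measured, the diagonal is the
-- original one restricted to the basis vectors that agree with the outcomes. When all are measured,
-- one entry remains.
open Classical in
theorem Ok.measureAll {r : List (Cmd 32)} {σ : Conf 32} {ρ : QOp (n + 1)}
    {b : Cube (n + 1) → ℝ}
    (hβ : β.Large n k M S) (hσ : σ.Within β) (hR : Ready n k M S σ)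
    (h : ∀ (σ' : Conf 32) (v : Cube (n + 1)) (ρ' : QOp (n + 1)), σ'.Within β →
      (∀ y, y ≠ vJ → y ≠ vB → σ'.var y = σ.var y) →
      (∀ A ≠ aBits, σ'.arr A = σ.arr A) → Stored v (σ'.arr aBits) →
      σ'.copies = σ.copies → σ'.gates = σ.gates →
      σ'.time ≤ σ.time + 6 * (n + 1) + 3 → ρ'.trace = ρ v v →
      Ok D ε δ β τ E r σ' ρ' (b v)) :
    Ok D ε δ β τ E (measureAll :: r) σ ρ (∑ v, b v) := by
  have hw := hβ.word_base
  have hl := hβ.len_bits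
  have hc1 := β.one_le_cell
  refine .seq hσ (.of_wp hσ.tick (Q := fun σ' => σ' = σ.tick.setVar vJ (n + 1)) ?_ ?_)
  · simp [setTo, Cmd.wp, Instr.wp, BinOp.Fits, BinOp.eval, hR.qubits, hR.zero]
    omega
  rintro σ₀ rfl hσ₀ -
  suffices H : ∀ j, j ≤ n + 1 → ∀ (σ' : Conf 32) (v : Cube (n + 1)) (ρ' : QOp (n + 1)),
      σ'.Within β → σ'.var vJ = j →
      (∀ y, y ≠ vJ → y ≠ vB → σ'.var y = σ.var y) → (∀ A ≠ aBits, σ'.arr A = σ.arr A) →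
      (∀ i : Fin (n + 1), j ≤ i → σ'.arr aBits i = (v i).toNat) →
      σ'.copies = σ.copies → σ'.gates = σ.gates →
      σ'.time + 6 * j ≤ σ.time + 6 * (n + 1) + 2 →
      (∀ w, ρ' w w = if AgreeFrom j w v then ρ w w else 0) →
      Ok D ε δ β τ E (forLoop vOne vJ
        (.prim (.measure vB vJ) ;; .prim (.write aBits vJ vB)) :: r) σ' ρ'
        (∑ w, if AgreeFrom j w v then b w else 0) by
    -- Before the first measurement agreement is vacuous, so any vector can stand for the outcomes.
    have hA : ∀ w : Cube (n + 1), AgreeFrom (n + 1) w (fun _ => false) := fun w i hi => by omega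
    have := H (n + 1) le_rfl _ (fun _ => false) ρ hσ₀ (by simp)
      (fun y hy _ => by simp [Function.update_of_ne hy]) (fun _ _ => rfl)
      (fun i hi => by omega) rfl rfl (by simp; omega) (fun w => by rw [if_pos (hA w)])
    simpa only [hA, if_true] using this
  intro j
  induction j with
  | zero =>
    intro _ σ' v ρ' hσ' hj hv ha hb hc hg ht hρ
    have hA : ∀ w, AgreeFrom 0 w v ↔ w = v := fun w => by simp [AgreeFrom, funext_iff]
    simp only [hA] at hρ ⊢
    rw [Finset.sum_ite_eq' Finset.univ v b, if_pos (Finset.mem_univ _)]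
    refine .loop_zero hσ' hj (h _ v ρ' hσ'.tick hv ha (fun i => hb i (Nat.zero_le _)) hc hg
      (by simp; omega) ?_)
    simp [Matrix.trace, hρ]
  | succ j ih =>
    intro hjn σ' v ρ' hσ' hj hv ha hb hc hg ht hρ
    refine .forLoop_succ hσ' ((hv _ (by decide) (by decide)).trans hR.one) hj fun hw' => ?_
    refine .seq hw' ?_
    set i : Fin (n + 1) := ⟨j, by omega⟩ with hi
    -- The guarantee is split according to the value of the qubit about to be measured.
    have hsplit : (∑ w, if AgreeFrom (j + 1) w v then b w else 0) =
        (∑ w, if AgreeFrom j w (Function.update v i false) then b w else 0) +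
        ∑ w, if AgreeFrom j w (Function.update v i true) then b w else 0 := by
      rw [← Finset.sum_add_distrib]
      refine Finset.sum_congr rfl fun w _ => ?_
      rw [agreeFrom_update i, agreeFrom_update i]
      cases w i <;> simp [hi]
    rw [hsplit]
    refine .measure (b := fun a => ∑ w, if AgreeFrom j w (Function.update v i a) then b w else 0)
      hw'.tick i (by simp [hi]) fun a hwa => ?_
    have ha1 : a.toNat ≤ 1 := Bool.toNat_le _
    refine .of_wp hwa (Q := fun σ'' => σ'' =
      ((σ'.enter vJ j).tick.setVar vB a.toNat).setArr aBits j a.toNat) ?_ ?_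
    · simp [Cmd.wp, Instr.wp]
      omega
    rintro σ'' rfl hw'' -
    refine ih (by omega) _ (Function.update v i a) _ hw'' (by simp) (fun y hy hy' => ?_)
      (fun A hA => ?_) (fun l hl => ?_) hc hg (by simp; omega) fun w => ?_
    · simpa [Function.update_of_ne hy, Function.update_of_ne hy'] using hv y hy hy'
    · simpa [Function.update_of_ne hA] using ha A hA
    · rcases eq_or_ne l i with rfl | hne
      · simp [hi]
      · have hne' : (l : ℕ) ≠ j := fun h => hne (Fin.ext h)
        simpa [Function.update_of_ne hne, Function.update_of_ne hne'] using hb l (by omega)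
    · rw [qubitProj_conj_apply, hρ, agreeFrom_update i]
      simp only [hi]
      split_ifs <;> simp_all

end Quantum

end AgnosticFourier

namespace AgnosticFourier

variable {n k M S : ℕ} {ε δ : ℝ} {β : Limits}

/-! ### The two sampling phases -/

section Phases

variable {D : PMF (Cube n × Bool)} {τ : ℕ} {E : Set (State 32 n)}

theorem Ready.of_var {σ σ' : Conf 32} (h : Ready n k M S σ)
    (hv : ∀ y ≤ vSamples, σ'.var y = σ.var y) : Ready n k M S σ' := by
  constructor <;> rw [hv _ (by decide)]
  exacts [h.one, h.zero, h.size, h.qubits, h.scale, h.slots, h.samples]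

/-- A bound on the time for one sample of the search phase. -/
def searchCost (n k : ℕ) : ℕ := k * (14 * n + 40) + 22 * n + 80

/-- The invariant of the search phase, with samples `h` seen and `t` samples to come. -/
structure SearchInv (n k M S : ℕ) (σ₀ σ : Conf 32) (h : List (Cube (n + 1))) (t : ℕ) : Prop where
  ready : Ready n k M S σ
  counter : σ.var vT = t
  summary : Summary k h (σ.arr aCnt) (slotKey n (σ.arr aKey))
  key_le : ∀ p, σ.arr aKey p ≤ 1
  length : h.length + t = M
  copies : σ.copies + t = σ₀.copies + M
  gates : σ.gates + t * (n + 1) = σ₀.gates + M * (n + 1)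
  len : σ.var vLen = σ₀.var vLen
  arr : ∀ A, A ≠ aBits → A ≠ aKey → A ≠ aCnt → σ.arr A = σ₀.arr A
  time : σ.time + t * searchCost n k ≤ σ₀.time + 2 + M * searchCost n k

/-- `V h` is the fraction of its weight that the rest of the program guarantees after the samples
`h`. Each round replaces it by its average over one outcome, which is the recursion of `sampleExp`.
-/
theorem Ok.searchPhase {r : List (Cmd 32)} {σ₀ : Conf 32} {ρ : QOp (n + 1)} {w : ℝ}
    {V : List (Cube (n + 1)) → ℝ}
    (hβ : β.Large n k M S) (hσ₀ : σ₀.Within β) (hR₀ : Ready n k M S σ₀)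
    (hcnt : ∀ i, σ₀.arr aCnt i = 0) (hkey : ∀ p, σ₀.arr aKey p ≤ 1)
    (hc : σ₀.copies + M ≤ β.copies) (hg : σ₀.gates + M * (n + 1) ≤ β.gates)
    (hρ : ρ.trace = (w : ℂ)) (hw0 : 0 ≤ w)
    (hr : ∀ (σ : Conf 32) (h : List (Cube (n + 1))) (ρ' : QOp (n + 1)) (w' : ℝ), σ.Within β →
      SearchInv n k M S σ₀ σ h 0 → ρ'.trace = (w' : ℂ) → 0 ≤ w' →
      Ok D ε δ β τ E r σ.tick ρ' (w' * V h)) :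
    Ok D ε δ β τ E (AgnosticFourier.searchPhase :: r) σ₀ ρ
      (w * sampleExp (outcomeProb D (hadamardFrom (n + 1) 0)) M V []) := by
  have hwb := hβ.word_samples
  refine .seq hσ₀ (.of_wp hσ₀.tick (Q := fun σ' => σ' = σ₀.tick.setVar vT M) ?_ ?_)
  · simp [setTo, Cmd.wp, Instr.wp, BinOp.Fits, BinOp.eval, hR₀.samples, hR₀.zero]
    omega
  rintro σ₁ rfl hσ₁ -
  suffices H : ∀ t, ∀ (σ : Conf 32) (h : List (Cube (n + 1))) (ρ : QOp (n + 1)) (w : ℝ),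
      σ.Within β → SearchInv n k M S σ₀ σ h t → ρ.trace = (w : ℂ) → 0 ≤ w →
      Ok D ε δ β τ E (forLoop vOne vT
        (.prim .fresh ;; AgnosticFourier.applyHadamards ;; AgnosticFourier.measureAll ;;
          .prim (.read vY aBits vSize) ;; .ite vY updateCounters skipCmd) :: r) σ ρ
        (w * sampleExp (outcomeProb D (hadamardFrom (n + 1) 0)) t V h) by
    refine H M _ [] ρ w hσ₁ ⟨hR₀.tick.setVar (by decide), by simp, .nil k (fun i _ => ?_) _, hkey,
      by simp, by simp, by simp, rfl, fun _ _ _ _ => rfl, by simp⟩ hρ hw0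
    exact hcnt i
  intro t
  induction t with
  | zero =>
    intro σ h ρ w hσ hI hρ hw
    exact .loop_zero hσ hI.counter (hr σ h ρ w hσ hI hρ hw)
  | succ t ih =>
    intro σ h ρ w hσ hI hρ hw
    have hlen := hI.length
    have hcop := hI.copies
    have hgat : σ.gates + t * (n + 1) + (n + 1) = σ₀.gates + M * (n + 1) := by
      rw [← hI.gates]
      ring
    have htim : σ.time + t * searchCost n k + searchCost n k ≤
        σ₀.time + 2 + M * searchCost n k := by
      have := hI.time
      rw [add_mul] at this
      omega
    refine .forLoop_succ hσ hI.ready.one hI.counter fun hw₁ => ?_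
    have hR₁ : Ready n k M S (σ.enter vT t) := hI.ready.enter (by decide)
    refine .seq hw₁ (.fresh hw₁.tick (.seq (hw₁.tick.load (by simp; omega)) ?_))
    refine .applyHadamards hβ (hw₁.tick.load (by simp; omega)).tick
      ⟨hR₁.one, hR₁.zero, hR₁.size, hR₁.qubits, hR₁.scale, hR₁.slots, hR₁.samples⟩
      (by simp; omega) fun σ₂ hσ₂ hv₂ ha₂ hc₂ hg₂ ht₂ => ?_
    simp at hv₂ ha₂ hc₂ hg₂ ht₂
    have hR₂ : Ready n k M S σ₂ := hR₁.of_var fun y hy => hv₂ y (by rintro rfl; revert hy; decide)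
    rw [sampleExp, Finset.mul_sum]
    refine .seq hσ₂ (.measureAll hβ hσ₂.tick hR₂.tick
      fun σ₃ v ρ' hσ₃ hv₃ ha₃ hb₃ hc₃ hg₃ ht₃ hρ' => ?_)
    simp at hv₃ ha₃ hc₃ hg₃ ht₃
    have hR₃ : Ready n k M S σ₃ := hR₂.of_var fun y hy => hv₃ y
      (by rintro rfl; revert hy; decide) (by rintro rfl; revert hy; decide)
    have htr : ρ'.trace =
        ((w * outcomeProb D (hadamardFrom (n + 1) 0) v : ℝ) : ℂ) := by
      rw [hρ', hρ, Matrix.mul_smul, Matrix.smul_mul, Matrix.smul_apply,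
        conj_mixtureExample_apply, smul_eq_mul, Complex.ofReal_mul]
    have e1 : σ₃.arr aKey = σ.arr aKey := by rw [ha₃ _ (by decide), ha₂]
    have e2 : σ₃.arr aCnt = σ.arr aCnt := by rw [ha₃ _ (by decide), ha₂]
    have hs := hI.summary
    rw [← e1, ← e2] at hs
    have hk := hI.key_le
    rw [← e1] at hk
    have hlast : σ₃.arr aBits n = (v (Fin.last n)).toNat := hb₃ (Fin.last n)
    have hcost : searchCost n k = k * (14 * n + 40) + 22 * n + 80 := rfl
    rw [← mul_assoc]
    refine .of_wp hσ₃ (Q := fun σ' => (Summary k (v :: h) (σ'.arr aCnt)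
      (slotKey n (σ'.arr aKey)) ∧ ∀ p, σ'.arr aKey p ≤ 1) ∧
      σ'.time ≤ σ₃.time + k * (14 * n + 40) + 12 * n + 40) ?_ ?_
    · refine ⟨fun hy => ?_, fun hy => ?_⟩
      · refine Cmd.wp_mono (updateCounters_wp hβ ((hR₃.tick.setVar (by decide)).tick)
          (by simpa using hb₃) hk hs (by omega)) fun σ₄ h₄ => ⟨h₄.1, ?_⟩
        have := h₄.2
        simp at this
        omega
      · simp [hR₃.size, hlast] at hy
        simp [skipCmd, Cmd.wp, Instr.wp]
        -- Samples with label `0` carry no information about the coefficients. They only lengthen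
        -- the list.
        exact ⟨⟨hs.skip hy, hk⟩, by omega⟩
    · rintro σ₄ ⟨⟨h₄, h₅⟩, h₆⟩ hσ₄ hF
      refine ih σ₄ (v :: h) ρ' _ hσ₄ ⟨hR₃.frame hF rfl, ?_, h₄, h₅, ?_, ?_, ?_, ?_, ?_, ?_⟩ htr
        (mul_nonneg hw (outcomeProb_nonneg _ _ _))
      · rw [hF.var _ rfl, hv₃ _ (by decide) (by decide), hv₂ _ (by decide)]
        simp
      · simp
        omega
      · rw [hF.copies]
        omega
      · rw [hF.gates]
        omega
      · rw [hF.var _ rfl, hv₃ _ (by decide) (by decide), hv₂ _ (by decide)]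
        exact hI.len
      · intro A hA1 hA2 hA3
        rw [hF.arr A ?_, ha₃ A hA1, ha₂, hI.arr A hA1 hA2 hA3]
        revert A
        decide
      · omega

/-- A bound on the time for one sample of the estimation phase. -/
def estimateCost (n k : ℕ) : ℕ := k * (14 * n + 30) + 6 * n + 40

/-- The invariant of the estimation phase, with samples `h` seen and `t` samples to come. -/
structure EstimateInv (n k M S : ℕ) (σ₀ σ : Conf 32) (h : List (Cube (n + 1))) (t : ℕ) :
    Prop where
  ready : Ready n k M S σ
  counter : σ.var vT = t
  total : ∀ i < k, σ.arr aPos i + σ.arr aNeg i = h.length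
  diff : ∀ i < k, (σ.arr aPos i : ℝ) - σ.arr aNeg i =
    (h.map (exampleSign (slotKey n (σ₀.arr aKey) i))).sum
  length : h.length + t = M
  copies : σ.copies + t = σ₀.copies + M
  gates : σ.gates = σ₀.gates
  len : σ.var vLen = σ₀.var vLen
  arr : ∀ A, A ≠ aBits → A ≠ aPos → A ≠ aNeg → σ.arr A = σ₀.arr A
  time : σ.time + t * estimateCost n k ≤ σ₀.time + 2 + M * estimateCost n k

/-- The strings in the slots are those of `σ₀` and no longer change, so the fresh samples are
independent of the strings whose coefficients they estimate. -/
theorem Ok.estimatePhase {r : List (Cmd 32)} {σ₀ : Conf 32} {ρ : QOp (n + 1)} {w : ℝ}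
    {V : List (Cube (n + 1)) → ℝ}
    (hβ : β.Large n k M S) (hσ₀ : σ₀.Within β) (hR₀ : Ready n k M S σ₀)
    (hpos : ∀ i, σ₀.arr aPos i = 0) (hneg : ∀ i, σ₀.arr aNeg i = 0)
    (hkey : ∀ p, σ₀.arr aKey p ≤ 1) (hc : σ₀.copies + M ≤ β.copies)
    (hρ : ρ.trace = (w : ℂ)) (hw0 : 0 ≤ w)
    (hr : ∀ (σ : Conf 32) (h : List (Cube (n + 1))) (ρ' : QOp (n + 1)) (w' : ℝ), σ.Within β →
      EstimateInv n k M S σ₀ σ h 0 → ρ'.trace = (w' : ℂ) → 0 ≤ w' →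
      Ok D ε δ β τ E r σ.tick ρ' (w' * V h)) :
    Ok D ε δ β τ E (AgnosticFourier.estimatePhase :: r) σ₀ ρ
      (w * sampleExp (outcomeProb D 1) M V []) := by
  have hwb := hβ.word_samples
  refine .seq hσ₀ (.of_wp hσ₀.tick (Q := fun σ' => σ' = σ₀.tick.setVar vT M) ?_ ?_)
  · simp [setTo, Cmd.wp, Instr.wp, BinOp.Fits, BinOp.eval, hR₀.samples, hR₀.zero]
    omega
  rintro σ₁ rfl hσ₁ -
  suffices H : ∀ t, ∀ (σ : Conf 32) (h : List (Cube (n + 1))) (ρ : QOp (n + 1)) (w : ℝ),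
      σ.Within β → EstimateInv n k M S σ₀ σ h t → ρ.trace = (w : ℂ) → 0 ≤ w →
      Ok D ε δ β τ E
        (forLoop vOne vT
          (.prim .fresh ;; AgnosticFourier.measureAll ;; updateEstimates) :: r) σ ρ
        (w * sampleExp (outcomeProb D 1) t V h) by
    refine H M _ [] ρ w hσ₁ ⟨hR₀.tick.setVar (by decide), by simp, ?_, ?_, by simp, by simp, rfl,
      rfl, fun _ _ _ _ => rfl, by simp⟩ hρ hw0 <;>
    simp [hpos, hneg]
  intro t
  induction t with
  | zero =>
    intro σ h ρ w hσ hI hρ hw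
    exact .loop_zero hσ hI.counter (hr σ h ρ w hσ hI hρ hw)
  | succ t ih =>
    intro σ h ρ w hσ hI hρ hw
    have hlen := hI.length
    have hcop := hI.copies
    have hgat := hI.gates
    have htim : σ.time + t * estimateCost n k + estimateCost n k ≤
        σ₀.time + 2 + M * estimateCost n k := by
      have := hI.time
      rw [add_mul] at this
      omega
    refine .forLoop_succ hσ hI.ready.one hI.counter fun hw₁ => ?_
    have hR₁ : Ready n k M S (σ.enter vT t) := hI.ready.enter (by decide)
    have hw₂ := hw₁.tick.load (by simp; omega)
    refine .seq hw₁ (.fresh hw₁.tick (.seq hw₂ ?_))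
    rw [sampleExp, Finset.mul_sum]
    refine .measureAll hβ hw₂.tick
      ⟨hR₁.one, hR₁.zero, hR₁.size, hR₁.qubits, hR₁.scale, hR₁.slots, hR₁.samples⟩
      fun σ₃ v ρ' hσ₃ hv₃ ha₃ hb₃ hc₃ hg₃ ht₃ hρ' => ?_
    simp at hv₃ ha₃ hc₃ hg₃ ht₃
    have hR₃ : Ready n k M S σ₃ := hR₁.of_var fun y hy => hv₃ y
      (by rintro rfl; revert hy; decide) (by rintro rfl; revert hy; decide)
    have htr : ρ'.trace = ((w * outcomeProb D 1 v : ℝ) : ℂ) := by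
      have := conj_mixtureExample_apply D 1 v
      rw [Matrix.one_mul, Matrix.conjTranspose_one, Matrix.mul_one] at this
      rw [hρ', hρ, Matrix.smul_apply, this, smul_eq_mul, Complex.ofReal_mul]
    have e1 : σ₃.arr aKey = σ₀.arr aKey := by
      rw [ha₃ _ (by decide), hI.arr _ (by decide) (by decide) (by decide)]
    have e2 : σ₃.arr aPos = σ.arr aPos := ha₃ _ (by decide)
    have e3 : σ₃.arr aNeg = σ.arr aNeg := ha₃ _ (by decide)
    have hcost : estimateCost n k = k * (14 * n + 30) + 6 * n + 40 := rfl
    rw [← mul_assoc]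
    refine .of_wp hσ₃ (updateEstimates_wp hβ hR₃ hb₃ (e1 ▸ hkey) fun i hi => ?_) ?_
    · have := hI.total i hi
      rw [e2, e3]
      omega
    · rintro σ₄ ⟨h₄, h₅⟩ hσ₄ hF
      rw [e1, e2, e3] at h₄
      refine ih σ₄ (v :: h) ρ' _ hσ₄ ⟨hR₃.frame hF rfl, ?_, fun i hi => ?_, fun i hi => ?_, ?_, ?_,
        ?_, ?_, ?_, ?_⟩ htr (mul_nonneg hw (outcomeProb_nonneg _ _ _))
      · rw [hF.var _ rfl, hv₃ _ (by decide) (by decide)]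
        simp
      · have h₆ := hI.total i hi
        rw [List.length_cons, ← h₆]
        rcases eq_or_ne (exampleSign (slotKey n (σ₀.arr aKey) i) v) 1 with hs | hs
        · obtain ⟨h₇, h₈⟩ := (h₄ i hi).1 hs
          omega
        · obtain ⟨h₇, h₈⟩ := (h₄ i hi).2 hs
          omega
      · have h₆ := hI.diff i hi
        rw [List.map_cons, List.sum_cons, ← h₆]
        rcases eq_or_ne (exampleSign (slotKey n (σ₀.arr aKey) i) v) 1 with hs | hs
        · obtain ⟨h₇, h₈⟩ := (h₄ i hi).1 hs
          rw [h₇, h₈, hs]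
          push_cast
          ring
        · obtain ⟨h₇, h₈⟩ := (h₄ i hi).2 hs
          rw [h₇, h₈, (exampleSign_eq _ _).resolve_left hs]
          push_cast
          ring
      · simp
        omega
      · rw [hF.copies]
        omega
      · rw [hF.gates]
        omega
      · rw [hF.var _ rfl, hv₃ _ (by decide) (by decide)]
        exact hI.len
      · intro A hA1 hA2 hA3
        rw [hF.arr A ?_, ha₃ A hA1, hI.arr A hA1 hA2 hA3]
        revert A
        decide
      · omega

end Phases

end AgnosticFourier

namespace AgnosticFourier

variable {n k M S : ℕ} {ε δ : ℝ} {β : Limits}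

/-! ### Correctness of the output -/

/-- The success of the learner: the properties required of the final state. -/
def success {K : ℕ} (A : Algorithm K) (D : PMF (Cube n × Bool)) (ε : ℝ) : Set (State K n) :=
  {s | (∀ t, A.output s t ∈ Set.Icc (-1 : ℝ) 1) ∧
    (∀ t, |A.output s t - fourierCoeff (signMean D) t| ≤ ε) ∧
    (s.var A.len : ℝ) ≤ 16 * unifExp (fun x => signMean D x ^ 2) / ε ^ 2 ∧
    ({t | A.output s t ≠ 0}.ncard : ℝ) ≤ 16 * unifExp (fun x => signMean D x ^ 2) / ε ^ 2}

theorem abs_sub_eq_truncated (a b : ℕ) : |(a : ℝ) - b| = (((a - b) + (b - a) : ℕ) : ℝ) := by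
  rcases le_total a b with h | h
  · rw [Nat.sub_eq_zero_of_le h, zero_add, Nat.cast_sub h, abs_sub_comm,
      abs_of_nonneg (sub_nonneg.2 (Nat.cast_le.2 h))]
  · rw [Nat.sub_eq_zero_of_le h, add_zero, Nat.cast_sub h,
      abs_of_nonneg (sub_nonneg.2 (Nat.cast_le.2 h))]

/-- The deterministic part of the analysis. An error of `1/(4S)` on either side of the threshold
`3/(4S)` separates coefficients below `1/(2S)`, which are never listed, from those of at least
`1/S`, which always are. -/
theorem mem_success {D : PMF (Cube n × Bool)} (hε : 0 < ε) (hM : 0 < M)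
    (hS1 : 1 ≤ ε * S) (hS2 : ε * S < 2) {σ σ' : Conf 32} {ρ : QOp (n + 1)}
    (hC : Collected n k M S σ σ' 0)
    (hinj : ∀ i < k, ∀ j < k, 0 < σ.arr aCnt i → 0 < σ.arr aCnt j →
      slotKey n (σ.arr aKey) i = slotKey n (σ.arr aKey) j → i = j)
    (htot : ∀ i < k, σ.arr aPos i + σ.arr aNeg i = M)
    (hest : ∀ i < k, |(σ.arr aPos i : ℝ) - σ.arr aNeg i -
      M * fourierCoeff (signMean D) (slotKey n (σ.arr aKey) i)| ≤ M / (4 * S))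
    (hcap : ∀ s, 1 ≤ S * |fourierCoeff (signMean D) s| →
      ∃ i < k, 0 < σ.arr aCnt i ∧ slotKey n (σ.arr aKey) i = s) :
    σ'.toState [] ρ ∈ success learner D ε := by
  obtain ⟨g, -, h2, h3, h4⟩ := hC
  set φ := fourierCoeff (signMean D) with hφ
  set key := slotKey n (σ.arr aKey) with hkey
  set len := σ'.var vLen with hlen
  set s : State 32 n := σ'.toState [] ρ with hs
  have hM' : (0 : ℝ) < M := Nat.cast_pos.2 hM
  have hSpos : (0 : ℝ) < S := by
    by_contra h
    nlinarith [mul_nonpos_of_nonneg_of_nonpos hε.le (not_lt.1 h)]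
  set val : ℕ → ℝ := fun i => ((σ.arr aPos i : ℝ) - σ.arr aNeg i) / M with hval
  have hval_est : ∀ i < k, |val i - φ (key i)| ≤ 1 / (4 * S) := fun i hi => by
    have h5 := hest i hi
    have : val i - φ (key i) = ((σ.arr aPos i : ℝ) - σ.arr aNeg i - M * φ (key i)) / M := by
      rw [hval]
      field_simp
    rw [this, abs_div, abs_of_pos hM', div_le_iff₀ hM']
    calc _ ≤ _ := h5
      _ = _ := by ring
  have hval_le : ∀ i < k, |val i| ≤ 1 := fun i hi => by
    rw [hval, abs_div, abs_of_pos hM', div_le_one hM', ← htot i hi]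
    push_cast
    refine (abs_sub _ _).trans ?_
    simp
  have hsel : ∀ i, Selected M S σ i ↔ 0 < σ.arr aCnt i ∧ 3 / (4 * S) ≤ |val i| := fun i => by
    rw [Selected, ← Nat.pos_iff_ne_zero]
    refine and_congr_right fun _ => ?_
    rw [hval, abs_div, abs_of_pos hM', abs_sub_eq_truncated, div_le_div_iff₀ (by positivity) hM',
      ← Nat.cast_le (α := ℝ)]
    push_cast
    constructor <;> intro h <;> linarith
  have hentry : ∀ l < len, learner.entryKey s l = key (g l) := fun l hl => by
    funext j
    exact congrArg (fun m => decide (m ≠ 0)) ((h2 l hl).2.2.2.key j j.2)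
  have hvalue : ∀ l < len, learner.entryValue s l = val (g l) := fun l hl => by
    have h5 := (h2 l hl).2.2.2
    have e1 : s.arr learner.pos l = σ.arr aPos (g l) := h5.pos
    have e2 : s.arr learner.neg l = σ.arr aNeg (g l) := h5.neg
    have e3 : s.arr learner.den l = M := h5.den
    rw [Algorithm.entryValue, e1, e2, e3]
  -- Active slots hold distinct strings, so the values of several entries are never added up in the
  -- output function.
  have hkinj : ∀ l < len, ∀ l' < len, key (g l) = key (g l') → l = l' := fun l hl l' hl' h =>
    h3 l hl l' hl' (hinj _ (h2 l hl).2.1 _ (h2 l' hl').2.1 ((hsel _).1 (h2 l hl).2.2.1).1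
      ((hsel _).1 (h2 l' hl').2.2.1).1 h)
  have hout : ∀ t, learner.output s t =
      ∑ l ∈ Finset.range len, if key (g l) = t then val (g l) else 0 := fun t => by
    refine Finset.sum_congr rfl fun l hl => ?_
    rw [hentry l (Finset.mem_range.1 hl), hvalue l (Finset.mem_range.1 hl)]
  have hout_eq : ∀ l < len, learner.output s (key (g l)) = val (g l) := fun l hl => by
    rw [hout, Finset.sum_eq_single l]
    · rw [if_pos rfl]
    · intro l' hl' hne
      exact if_neg fun h => hne (hkinj l' (Finset.mem_range.1 hl') l hl h)
    · exact fun h => absurd (Finset.mem_range.2 hl) h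
  have hout_zero : ∀ t, (∀ l < len, key (g l) ≠ t) → learner.output s t = 0 := fun t ht => by
    rw [hout]
    exact Finset.sum_eq_zero fun l hl => if_neg (ht l (Finset.mem_range.1 hl))
  have hS4 : 1 / (4 * (S : ℝ)) ≤ ε := by
    rw [div_le_iff₀ (by positivity)]
    linarith
  have hlen_le : (len : ℝ) ≤ 16 * unifExp (fun x => signMean D x ^ 2) / ε ^ 2 := by
    have h5 : ∀ l ∈ Finset.range len, ε ^ 2 / 16 ≤ φ (key (g l)) ^ 2 := fun l hl => by
      have hl := Finset.mem_range.1 hl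
      have h6 := ((hsel _).1 (h2 l hl).2.2.1).2
      have h7 := hval_est _ (h2 l hl).2.1
      have h8 : |val (g l)| ≤ |val (g l) - φ (key (g l))| + |φ (key (g l))| := by
        simpa using abs_add_le (val (g l) - φ (key (g l))) (φ (key (g l)))
      have h9 : 3 / (4 * (S : ℝ)) - 1 / (4 * S) = 1 / (2 * S) := by
        field_simp
        norm_num
      have h10 : ε / 4 ≤ 1 / (2 * S) := by
        rw [div_le_div_iff₀ (by norm_num) (by positivity)]
        linarith
      have h11 : ε / 4 ≤ |φ (key (g l))| := by linarith
      rw [← sq_abs (φ _)]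
      calc ε ^ 2 / 16 = (ε / 4) ^ 2 := by ring
        _ ≤ _ := pow_le_pow_left₀ (by positivity) h11 2
    have h6 := Finset.card_nsmul_le_sum _ _ _ h5
    rw [Finset.card_range, nsmul_eq_mul] at h6
    have h7 : ∑ l ∈ Finset.range len, φ (key (g l)) ^ 2 ≤ ∑ t, φ t ^ 2 := by
      rw [← Finset.sum_image (f := fun t => φ t ^ 2) (g := fun l => key (g l))]
      · exact Finset.sum_le_univ_sum_of_nonneg fun t => sq_nonneg _
      · intro l hl l' hl' h
        exact hkinj l (by simpa using hl) l' (by simpa using hl') h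
    rw [hφ, sum_fourierCoeff_sq] at h7
    rw [le_div_iff₀ (by positivity)]
    linarith
  refine ⟨fun t => ?_, fun t => ?_, hlen_le, ?_⟩
  · rw [Set.mem_Icc, ← abs_le]
    by_cases ht : ∃ l < len, key (g l) = t
    · obtain ⟨l, hl, rfl⟩ := ht
      rw [hout_eq l hl]
      exact hval_le _ (h2 l hl).2.1
    · push Not at ht
      simp [hout_zero t ht]
  · by_cases ht : ∃ l < len, key (g l) = t
    · obtain ⟨l, hl, rfl⟩ := ht
      rw [hout_eq l hl]
      exact (hval_est _ (h2 l hl).2.1).trans hS4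
    · push Not at ht
      rw [hout_zero t ht, zero_sub, abs_neg]
      by_contra hgt
      rw [not_le] at hgt
      -- A coefficient above `ε ≥ 1/S` is heavy, so it was captured, and its estimate is large
      -- enough to be listed.
      have h5 : 1 ≤ S * |φ t| := by nlinarith
      obtain ⟨i, hi, hci, hki⟩ := hcap t h5
      have h6 := hval_est i hi
      rw [hki] at h6
      have h7 : 1 / (S : ℝ) ≤ |φ t| := by
        rw [div_le_iff₀ hSpos]
        linarith
      have h8 : |φ t| ≤ |val i| + |val i - φ t| := by
        have := abs_sub (val i) (val i - φ t)
        simpa using this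
      have h9 : 1 / (S : ℝ) - 1 / (4 * S) = 3 / (4 * S) := by
        field_simp
        norm_num
      obtain ⟨l, hl, hgl⟩ := h4 i (Nat.zero_le _) hi ((hsel i).2 ⟨hci, by linarith⟩)
      exact ht l hl (by rw [hgl, hki])
  · refine le_trans ?_ hlen_le
    have hsub : {t | learner.output s t ≠ 0} ⊆
        ((Finset.range len).image fun l => key (g l) : Finset (Cube n)) := fun t ht => by
      by_contra h
      refine ht (hout_zero t fun l hl hk => h ?_)
      rw [Finset.mem_coe, Finset.mem_image]
      exact ⟨l, Finset.mem_range.2 hl, hk⟩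
    have h5 := Set.ncard_le_ncard hsub (Finset.finite_toSet _)
    rw [Set.ncard_coe_finset] at h5
    exact_mod_cast h5.trans (Finset.card_image_le.trans (Finset.card_range _).le)

/-! ### Failure probabilities -/

section Sampling

variable {Ω : Type*} [Fintype Ω]

theorem sampleExp_nonneg {p : Ω → ℝ} (hp : ∀ v, 0 ≤ p v) {V : List Ω → ℝ} (hV : ∀ h, 0 ≤ V h)
    (t : ℕ) (h : List Ω) : 0 ≤ sampleExp p t V h := by
  induction t generalizing h with
  | zero => exact hV h
  | succ t ih => exact Finset.sum_nonneg fun v _ => mul_nonneg (hp v) (ih _)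

theorem sampleExp_const_mul (p : Ω → ℝ) (c : ℝ) (V : List Ω → ℝ) (t : ℕ) (h : List Ω) :
    sampleExp p t (fun h => c * V h) h = c * sampleExp p t V h := by
  induction t generalizing h with
  | zero => rfl
  | succ t ih =>
    simp only [sampleExp, ih, Finset.mul_sum]
    exact Finset.sum_congr rfl fun v _ => mul_left_comm _ _ _

end Sampling

theorem exp_neg_natCast_le (m : ℕ) : Real.exp (-m) ≤ (1 / 2) ^ m := by
  have h : Real.exp (-1) ≤ 1 / 2 := by
    rw [Real.exp_neg, one_div]
    exact inv_anti₀ (by norm_num) (by linarith [Real.add_one_le_exp 1])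
  calc Real.exp (-m) = Real.exp (-1) ^ m := by rw [← Real.exp_nat_mul, mul_neg_one]
    _ ≤ _ := pow_le_pow_left₀ (Real.exp_nonneg _) h m

/-- A power of two that is negligible in comparison with `δ`. -/
theorem half_pow_mul_le {a d m e : ℕ} (hδ : 1 ≤ δ * 2 ^ d) (hm : d + a + a + e ≤ m) :
    (2 ^ a * 2 ^ a : ℝ) * 2 ^ e * (1 / 2) ^ m ≤ δ := by
  have h1 : ((1 : ℝ) / 2) ^ m ≤ (1 / 2) ^ (d + a + a + e) :=
    pow_le_pow_of_le_one (by norm_num) (by norm_num) hm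
  calc (2 ^ a * 2 ^ a : ℝ) * 2 ^ e * (1 / 2) ^ m
      ≤ (2 ^ a * 2 ^ a : ℝ) * 2 ^ e * (1 / 2) ^ (d + a + a + e) :=
        mul_le_mul_of_nonneg_left h1 (by positivity)
    _ = (1 / 2) ^ d := by
        simp only [pow_add, one_div, inv_pow]
        field_simp
    _ ≤ δ := by
        rw [one_div, inv_pow, inv_le_iff_one_le_mul₀ (by positivity)]
        linarith

/-- By Parseval the squared coefficients sum to at most `1`, and each heavy one is at least `1/S²`.
-/
theorem card_heavy_le (D : PMF (Cube n × Bool)) (S : ℕ) :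
    ((Finset.univ.filter fun s => 1 ≤ S * |fourierCoeff (signMean D) s|).card : ℝ) ≤ S * S := by
  classical
  set H := Finset.univ.filter fun s => 1 ≤ S * |fourierCoeff (signMean D) s|
  have h1 : ∀ s ∈ H, (1 : ℝ) ≤ S * S * fourierCoeff (signMean D) s ^ 2 := fun s hs => by
    have h2 : 1 ≤ S * |fourierCoeff (signMean D) s| := (Finset.mem_filter.1 hs).2
    rw [← sq_abs]
    nlinarith
  have h2 := Finset.card_nsmul_le_sum _ _ _ h1
  rw [nsmul_eq_mul, mul_one, ← Finset.mul_sum] at h2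
  have h3 : ∑ s ∈ H, fourierCoeff (signMean D) s ^ 2 ≤ 1 :=
    (Finset.sum_le_univ_sum_of_nonneg fun s => sq_nonneg _).trans
      ((sum_fourierCoeff_sq _).le.trans (unifExp_signMean_sq_le_one D))
  nlinarith [mul_nonneg (Nat.cast_nonneg (α := ℝ) S) (Nat.cast_nonneg (α := ℝ) S)]

variable {D : PMF (Cube n × Bool)}

theorem search_success (hD : D.map Prod.fst = PMF.uniformOfFintype (Cube n)) {a d : ℕ}
    (ha : 1 ≤ a) (hδ : 1 ≤ δ * 2 ^ d) {V : List (Cube (n + 1)) → ℝ}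
    (hV0 : ∀ h, 0 ≤ V h)
    (hV : ∀ h : List (Cube (n + 1)), h.length = sampleCount a d →
      (∀ s, 1 ≤ (2 ^ a : ℕ) * |fourierCoeff (signMean D) s| → 32 * (d + a + a) < hits h s) →
      1 ≤ V h) :
    1 - δ / 2 ≤ sampleExp (outcomeProb D (hadamardFrom (n + 1) 0)) (sampleCount a d) V [] := by
  set H := Finset.univ.filter fun s => 1 ≤ ((2 ^ a : ℕ) : ℝ) * |fourierCoeff (signMean D) s|
  have h := one_sub_le_sampleExp_count (p := outcomeProb D (hadamardFrom (n + 1) 0))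
    (outcomeProb_nonneg D _) (sum_outcomeProb D (hadamardFrom_conjTranspose_mul_self 0))
    (t := sampleCount a d) (m := 32 * (d + a + a)) (q := 1 / (4 * (2 ^ a * 2 ^ a)))
    H (fun s => Fin.snoc s true) (fun s hs => ?_) hV0
    (fun h hh hc => hV h hh fun s hs => hc s (Finset.mem_filter.2 ⟨Finset.mem_univ _, hs⟩))
  · refine le_trans ?_ h
    -- The expected number of hits of a heavy string is at least `2 q M = 128 L`. The threshold `32
    -- L` costs a factor `2^(32 L)` against `exp (-64 L)`, leaving at most `2^(-32 L)` for each of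
    -- at most `S²` strings.
    have h1 : (1 : ℝ) / (4 * (2 ^ a * 2 ^ a)) * (sampleCount a d : ℕ) =
        ((64 * (d + a + a) : ℕ) : ℝ) := by
      rw [sampleCount]
      push_cast
      field_simp
      ring
    rw [h1]
    have h2 := exp_neg_natCast_le (64 * (d + a + a))
    have h3 := card_heavy_le D (2 ^ a)
    have h4 : (2 : ℝ) ^ (32 * (d + a + a)) * Real.exp (-((64 * (d + a + a) : ℕ) : ℝ)) ≤
        (1 / 2) ^ (32 * (d + a + a)) := by
      calc _ ≤ (2 : ℝ) ^ (32 * (d + a + a)) * (1 / 2) ^ (64 * (d + a + a)) :=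
            mul_le_mul_of_nonneg_left h2 (by positivity)
        _ = _ := by
            rw [show 64 * (d + a + a) = 32 * (d + a + a) + 32 * (d + a + a) by ring, pow_add,
              ← mul_assoc, ← mul_pow]
            norm_num
    have h5 := half_pow_mul_le (a := a) (e := 1) (m := 32 * (d + a + a)) hδ (by omega)
    have h6 : (H.card : ℝ) * ((2 : ℝ) ^ (32 * (d + a + a)) *
        Real.exp (-((64 * (d + a + a) : ℕ) : ℝ))) ≤
        2 ^ a * 2 ^ a * (1 / 2) ^ (32 * (d + a + a)) := by
      refine mul_le_mul ?_ h4 (by positivity) (by positivity)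
      exact_mod_cast h3
    linarith
  · have h1 := le_outcomeProb_hadamard hD s
    have h2 : 1 ≤ ((2 ^ a : ℕ) : ℝ) * |fourierCoeff (signMean D) s| := (Finset.mem_filter.1 hs).2
    refine le_trans ?_ h1
    push_cast at h2
    rw [← sq_abs, mul_one_div, div_le_div_iff₀ (by positivity) (by norm_num)]
    nlinarith

theorem estimate_success (hD : D.map Prod.fst = PMF.uniformOfFintype (Cube n)) {a d : ℕ}
    (ha : 1 ≤ a) (hd : 1 ≤ d) (hδ : 1 ≤ δ * 2 ^ d) (key : ℕ → Cube n)
    {V : List (Cube (n + 1)) → ℝ} (hV0 : ∀ h, 0 ≤ V h)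
    (hV : ∀ h : List (Cube (n + 1)), h.length = sampleCount a d →
      (∀ i < slotCount a, |(h.map (exampleSign (key i))).sum - (sampleCount a d : ℕ) *
        fourierCoeff (signMean D) (key i)| ≤ (sampleCount a d : ℕ) / (4 * (2 ^ a : ℕ))) →
      1 ≤ V h) :
    1 - δ / 2 ≤ sampleExp (outcomeProb D 1) (sampleCount a d) V [] := by
  have h2a : (2 : ℝ) ≤ 2 ^ a := by
    calc (2 : ℝ) = 2 ^ 1 := by norm_num
      _ ≤ 2 ^ a := pow_le_pow_right₀ (by norm_num) ha
  have h := one_sub_le_sampleExp_mean (p := outcomeProb D 1) (outcomeProb_nonneg D _)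
    (sum_outcomeProb D (by simp)) (t := sampleCount a d) (Finset.range (slotCount a))
    (Z := fun i => exampleSign (key i)) (fun i v => exampleSign_eq _ _)
    (c := 1 / (8 * 2 ^ a)) (by positivity) ?_ hV0 (fun h hh hc => hV h hh fun i hi => ?_)
  · refine le_trans ?_ h
    -- The choice `c = 1/(8S)` makes the allowed deviation `2 c M = M/(4S)` and the exponent `c² M =
    -- 4 L`. The `2k = 16 S²` tail events then have total probability at most `δ/2`.
    have h1 : ((1 : ℝ) / (8 * 2 ^ a)) ^ 2 * (sampleCount a d : ℕ) =
        ((4 * (d + a + a) : ℕ) : ℝ) := by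
      rw [sampleCount]
      push_cast
      field_simp
      ring
    rw [h1, Finset.card_range]
    have h2 := exp_neg_natCast_le (4 * (d + a + a))
    have h5 := half_pow_mul_le (a := a) (e := 5) (m := 4 * (d + a + a)) hδ (by omega)
    have h6 : (2 : ℝ) * (slotCount a : ℕ) * Real.exp (-((4 * (d + a + a) : ℕ) : ℝ)) ≤
        2 * (2 ^ a * 2 ^ a * 8) * (1 / 2) ^ (4 * (d + a + a)) := by
      rw [slotCount]
      push_cast
      push_cast at h2
      exact mul_le_mul_of_nonneg_left h2 (by positivity)
    linarith
  · rw [div_le_div_iff₀ (by positivity) (by norm_num)]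
    linarith
  · have h1 := hc i (Finset.mem_range.2 hi)
    rw [sum_outcomeProb_mul_exampleSign hD] at h1
    refine h1.trans (le_of_eq ?_)
    push_cast
    field_simp
    ring

end AgnosticFourier

namespace AgnosticFourier

variable {n : ℕ} {ε δ : ℝ}

/-! ### The learner -/

/-- The bounds respected by the learner. -/
def learnerLimits (n a d : ℕ) : Limits where
  word := 300 + n + slotCount a * n + slotCount a + 4 * sampleCount a d * 2 ^ a +
    4 * sampleCount a d + 1
  cell := sampleCount a d + 1
  len := (slotCount a + 1) * (n + 1)
  copies := 2 * sampleCount a d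
  gates := sampleCount a d * (n + 1)
  one_le_cell := Nat.le_add_left _ _
  cell_le_word := by omega

/-- A bound on the running time of the learner. -/
def learnerTime (n a d : ℕ) : ℕ :=
  8 * a + 6 * d + 80 + sampleCount a d * searchCost n (slotCount a) +
    sampleCount a d * estimateCost n (slotCount a) + slotCount a * (16 * n + 50)

theorem learnerLimits_large (n a d : ℕ) :
    (learnerLimits n a d).Large n (slotCount a) (sampleCount a d) (2 ^ a) := by
  have h : (slotCount a + 1) * (n + 1) = slotCount a * n + slotCount a + n + 1 := by ring
  constructor <;> simp only [learnerLimits, h] <;>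
    omega

/-- The parameters are tuned so that `M = 32 L k` exactly. More than `32 L` hits therefore exceed
what a summary with `k` counters can lose. -/
theorem sampleCount_lt (a d : ℕ) :
    sampleCount a d < (slotCount a + 1) * (32 * (d + a + a) + 1) := by
  have h : sampleCount a d = slotCount a * (32 * (d + a + a)) := by
    rw [sampleCount, slotCount]
    ring
  rw [h]
  nlinarith

/-- The configuration at the start. -/
def Conf.start (K : ℕ) : Conf K := ⟨fun _ => 0, fun _ _ => 0, fun _ => 0, 0, 0, 0⟩

theorem Conf.start_within (K : ℕ) (β : Limits) : (Conf.start K).Within β :=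
  ⟨fun _ => Nat.zero_le _, fun _ _ => Nat.zero_le _, fun _ => Nat.zero_le _, Nat.zero_le _,
    Nat.zero_le _⟩

theorem trace_zeroState (q : ℕ) : (zeroState q).trace = ((1 : ℝ) : ℂ) := by
  simp [zeroState, Matrix.trace_diagonal]

/-- The program is traversed once with `Ok`. The estimation phase succeeds with probability at least
`1 - δ/2` for any strings left by the search, so the two success probabilities multiply. -/
theorem learner_ok {D : PMF (Cube n × Bool)}
    (hD : D.map Prod.fst = PMF.uniformOfFintype (Cube n)) {a d : ℕ}
    (hε0 : 0 < ε) (ha : 1 ≤ a) (hS1 : 1 ≤ ε * 2 ^ a) (hS2 : ε * 2 ^ a < 2)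
    (hda : digit ε a = 1) (hda0 : ∀ i < a, digit ε i = 0)
    (hδ0 : 0 < δ) (hδ1 : δ < 1) (hd : 1 ≤ d) (hδ : 1 ≤ δ * 2 ^ d)
    (hdd : digit δ d = 1) (hdd0 : ∀ i < d, digit δ i = 0) :
    Ok D ε δ (learnerLimits n a d) (learnerTime n a d) (success learner D ε) [learner.body]
      (Conf.start 32) (zeroState (n + 1)) (1 - δ) := by
  classical
  have hβ := learnerLimits_large n a d
  have hM := (le_sampleCount (a := a) hd).2
  set k := slotCount a with hk
  set M := sampleCount a d with hMdef
  have hcopies : (learnerLimits n a d).copies = 2 * M := rfl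
  have hgates : (learnerLimits n a d).gates = M * (n + 1) := rfl
  have htime : learnerTime n a d = 8 * a + 6 * d + 80 + M * searchCost n k +
    M * estimateCost n k + k * (16 * n + 50) := rfl
  have hw := Conf.start_within 32 (learnerLimits n a d)
  refine .seq hw (.of_wp hw.tick (prepare_wp hβ rfl ha hda hda0 hd hdd hdd0)
    fun σ₁ ⟨hR₁, ht₁⟩ hσ₁ hF₁ => .seq hσ₁ ?_)
  have harr : ∀ A p, σ₁.arr A p = 0 := fun A p => by
    rw [hF₁.arr A (by revert A; decide)]
    rfl
  have hc₁ : σ₁.copies = 0 := hF₁.copies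
  have hg₁ : σ₁.gates = 0 := hF₁.gates
  have hl₁ : σ₁.var vLen = 0 := hF₁.var _ rfl
  simp [Conf.start] at ht₁
  let captured : List (Cube (n + 1)) → Prop := fun h =>
    ∀ s, 1 ≤ ((2 ^ a : ℕ) : ℝ) * |fourierCoeff (signMean D) s| → 32 * (d + a + a) < hits h s
  let V₁ : List (Cube (n + 1)) → ℝ := fun h => if captured h then 1 else 0
  have hV₁ : ∀ h, 0 ≤ V₁ h := fun h => by
    simp only [V₁]
    split_ifs <;> norm_num
  -- If the search captured all heavy strings, the rest guarantees the fraction `1 - δ/2`; otherwise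
  -- nothing is claimed. Averaging gives at least `(1 - δ/2)²`.
  refine .mono (b := 1 * sampleExp (outcomeProb D (hadamardFrom (n + 1) 0)) M
    (fun h => (1 - δ / 2) * V₁ h) []) (.searchPhase hβ hσ₁.tick hR₁.tick (fun i => harr _ _)
      (fun p => (harr _ _).le.trans zero_le_one) (by simp [hc₁, hcopies]; omega)
      (by simp [hg₁, hgates]) (trace_zeroState _) zero_le_one
      fun σ₂ h ρ₂ w₂ hσ₂ hI₂ hρ₂ hw₂ => .seq hσ₂.tick ?_) ?_
  swap
  · have h1 := search_success hD ha hδ hV₁ (V := V₁) fun h _ hc =>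
      (if_pos (show captured h from hc)).ge
    rw [one_mul, sampleExp_const_mul]
    nlinarith [sq_nonneg δ]
  have hR₂ := hI₂.ready
  have hc₂ : σ₂.copies = M := by simpa [hc₁] using hI₂.copies
  have ht₂ : σ₂.time ≤ σ₁.time + 1 + 2 + M * searchCost n k := by simpa using hI₂.time
  have hl₂ : σ₂.var vLen = 0 := hI₂.len.trans hl₁
  have hlen₂ : h.length = M := hI₂.length
  set key := slotKey n (σ₂.arr aKey) with hkey
  let good : List (Cube (n + 1)) → Prop := fun g =>
    ∀ i < k, |(g.map (exampleSign (key i))).sum - (M : ℕ) *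
        fourierCoeff (signMean D) (key i)| ≤ (M : ℕ) / (4 * (2 ^ a : ℕ))
  let V₂ : List (Cube (n + 1)) → ℝ := fun g => if captured h ∧ good g then 1 else 0
  have hV₂ : ∀ g, 0 ≤ V₂ g := fun g => by
    simp only [V₂]
    split_ifs <;> norm_num
  refine .mono (b := w₂ * sampleExp (outcomeProb D 1) M V₂ [])
    (.estimatePhase hβ hσ₂.tick.tick hR₂.tick.tick ?_ ?_ hI₂.key_le
      (by simp [hc₂, hcopies]; omega) hρ₂ hw₂
      fun σ₃ g ρ₃ w₃ hσ₃ hI₃ hρ₃ hw₃ => ?_) ?_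
  · intro i
    exact (congrFun (hI₂.arr aPos (by decide) (by decide) (by decide)) i).trans (harr _ _)
  · intro i
    exact (congrFun (hI₂.arr aNeg (by decide) (by decide) (by decide)) i).trans (harr _ _)
  swap
  · refine mul_le_mul_of_nonneg_left ?_ hw₂
    by_cases hcap : captured h
    · simp only [V₁, if_pos hcap, mul_one]
      exact estimate_success hD ha hd hδ key hV₂ fun g _ hg =>
        (if_pos (show captured h ∧ good g from ⟨hcap, hg⟩)).ge
    · simp only [V₁, if_neg hcap, mul_zero]
      exact sampleExp_nonneg (outcomeProb_nonneg D _) hV₂ _ _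
  have ht₃ : σ₃.time ≤ σ₂.time + 1 + 1 + 2 + M * estimateCost n k := by simpa using hI₃.time
  have ekey : σ₃.arr aKey = σ₂.arr aKey := hI₃.arr _ (by decide) (by decide) (by decide)
  have ecnt : σ₃.arr aCnt = σ₂.arr aCnt := hI₃.arr _ (by decide) (by decide) (by decide)
  have htot : ∀ i < k, σ₃.arr aPos i + σ₃.arr aNeg i = M := fun i hi =>
    (hI₃.total i hi).trans hI₃.length
  have hk2 := hI₂.key_le
  rw [← ekey] at hk2
  refine .of_wp hσ₃.tick (outputSlots_wp hβ hI₃.ready.tick hk2 (hI₃.len.trans hl₂)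
    fun i hi => (htot i hi).le) fun σ₄ ⟨hC, ht₄⟩ hσ₄ _ => .nil ?_ hσ₄ ?_
  · simp at ht₄
    omega
  by_cases hgood : captured h ∧ good g
  · rw [Set.indicator_of_mem, State.weight]
    · simp only [V₂, if_pos hgood, mul_one]
      change w₃ ≤ ρ₃.trace.re
      rw [hρ₃, Complex.ofReal_re]
    · refine mem_success (σ := σ₃.tick) hε0 (by omega) (by exact_mod_cast hS1)
        (by exact_mod_cast hS2) hC ?_ htot ?_ ?_
      · rw [Conf.tick_arr, ecnt, ekey]
        exact hI₂.summary.inj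
      · intro i hi
        rw [Conf.tick_arr, hI₃.diff i hi, ekey]
        exact hgood.2 i hi
      · intro s hs
        rw [Conf.tick_arr, ecnt, ekey]
        exact hI₂.summary.exists_of_lt_hits (hlen₂ ▸ sampleCount_lt a d) (hgood.1 s hs)
  · simp only [V₂, if_neg hgood, mul_zero]
    refine Set.indicator_apply_nonneg fun _ => ?_
    change 0 ≤ ρ₃.trace.re
    rwa [hρ₃, Complex.ofReal_re]

end AgnosticFourier

namespace AgnosticFourier

/-! ### Asymptotic bounds -/

/-- The binary length is at most `1 + log₂ m`, and `log 2 ≥ 1/2`. -/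
theorem size_le_of_log_le {m : ℕ} {x : ℝ} (hx : Real.log m ≤ x) (hx0 : 0 ≤ x) :
    (Nat.size m : ℝ) ≤ 2 * x + 1 := by
  rcases Nat.eq_zero_or_pos m with rfl | hm
  · simp only [Nat.size_zero, Nat.cast_zero]
    linarith
  have h0 : 0 < Nat.size m := Nat.size_pos.2 hm
  have h1 : 2 ^ (Nat.size m - 1) ≤ m := Nat.lt_size.1 (by omega)
  have h2 : Real.log ((2 : ℝ) ^ (Nat.size m - 1)) ≤ Real.log m :=
    Real.log_le_log (by positivity) (by exact_mod_cast h1)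
  rw [Real.log_pow, Nat.cast_sub h0, Nat.cast_one] at h2
  have h3 : (1 : ℝ) ≤ Nat.size m := by exact_mod_cast h0
  nlinarith [Real.log_two_gt_d9]

theorem Limits.Holds.space_le {K n : ℕ} {β : Limits} {s : State K n} (h : β.Holds s) :
    s.space ≤ K * (Nat.size β.word + 1) + K * (β.len * (Nat.size β.cell + 1)) := by
  refine add_le_add ?_ ?_
  · refine (Finset.sum_le_card_nsmul _ _ _ fun x _ =>
      Nat.succ_le_succ (Nat.size_le_size (h.1 x))).trans ?_
    simp
  · refine (Finset.sum_le_card_nsmul _ _ (β.len * (Nat.size β.cell + 1)) fun A _ => ?_).trans ?_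
    · refine (Finset.sum_le_card_nsmul _ _ _ fun i _ =>
        Nat.succ_le_succ (Nat.size_le_size (h.2.1 A i))).trans ?_
      rw [Finset.card_range, smul_eq_mul]
      exact Nat.mul_le_mul_right _ (h.2.2.1 A)
    · simp

section Parameters

variable {ε δ : ℝ} {a d n : ℕ}

theorem mul_log_two_le {r : ℝ} {m : ℕ} (hr : 0 < r) (h : r * 2 ^ m < 2) :
    m * Real.log 2 ≤ Real.log 2 + Real.log (1 / r) := by
  rw [← Real.log_pow, ← Real.log_mul (by norm_num) (by positivity)]
  refine Real.log_le_log (by positivity) ?_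
  rw [mul_one_div, le_div_iff₀ hr]
  linarith

theorem log_one_div_pos {r : ℝ} (hr : 0 < r) (hr1 : r < 1) : 0 < Real.log (1 / r) :=
  Real.log_pos (by rw [lt_div_iff₀ hr]; linarith)

theorem log_copies_eq (hε : 0 < ε) (hδ : 0 < δ) :
    Real.log (2 / (δ * ε ^ 2)) = Real.log 2 + Real.log (1 / δ) + 2 * Real.log (1 / ε) := by
  rw [Real.log_div (by norm_num) (by positivity), Real.log_mul (by positivity) (by positivity),
    Real.log_pow, one_div, one_div, Real.log_inv, Real.log_inv]
  push_cast
  ring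

theorem le_softFactor (hε : 0 < ε) (hε1 : ε < 1) (hδ : 0 < δ) (hδ1 : δ < 1) :
    1 ≤ softFactor ε δ ∧ Real.log (1 / ε) ≤ softFactor ε δ := by
  have h1 := log_one_div_pos hε hε1
  have h2 := log_one_div_pos hδ hδ1
  have h3 : 0 ≤ Real.log (1 + Real.log (1 / δ)) := Real.log_nonneg (by linarith)
  unfold softFactor
  constructor <;> linarith

/-- The number `a` is the position of the first nonzero binary digit of `r`. -/
structure LeadingDigit (r : ℝ) (a : ℕ) : Prop where
  pos : 0 < r
  lt_one : r < 1
  one_le : 1 ≤ a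
  one_le_mul : 1 ≤ r * 2 ^ a
  mul_lt_two : r * 2 ^ a < 2

/-- The second bound is the source of the doubly logarithmic dependence on `1/δ`: the digit position
`d` is of order `1 + log (1/δ)`, but only its logarithm enters the word length. -/
theorem digits_le (hε : LeadingDigit ε a) (hδ : LeadingDigit δ d) :
    ((d + a + a : ℕ) : ℝ) ≤ 5 * Real.log (2 / (δ * ε ^ 2)) ∧
      Real.log ((d + a + a : ℕ) : ℝ) ≤ 1 + softFactor ε δ := by
  have h1 := log_one_div_pos hε.pos hε.lt_one
  have h2 := log_one_div_pos hδ.pos hδ.lt_one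
  have h3 := mul_log_two_le hε.pos hε.mul_lt_two
  have h4 := mul_log_two_le hδ.pos hδ.mul_lt_two
  have h5 := Real.log_two_gt_d9
  have h6 := Real.log_two_lt_d9
  have ha : (1 : ℝ) ≤ a := by exact_mod_cast hε.one_le
  have hd : (1 : ℝ) ≤ d := by exact_mod_cast hδ.one_le
  rw [log_copies_eq hε.pos hδ.pos]
  push_cast
  constructor
  · nlinarith
  · set u := Real.log (1 / ε)
    set v := Real.log (1 / δ)
    have h7 : (d : ℝ) + a + a ≤ 4 * ((1 + v) * (1 + u)) := by
      nlinarith [mul_pos h1 h2]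
    calc Real.log ((d : ℝ) + a + a) ≤ Real.log (4 * ((1 + v) * (1 + u))) :=
          Real.log_le_log (by linarith) h7
      _ = 2 * Real.log 2 + (Real.log (1 + v) + Real.log (1 + u)) := by
          rw [Real.log_mul (by norm_num) (by positivity), Real.log_mul (by positivity)
            (by positivity), show (4 : ℝ) = 2 ^ 2 by norm_num, Real.log_pow]
          norm_num
      _ ≤ _ := by
          have h8 : Real.log (1 + u) ≤ u := by
            linarith [Real.log_le_sub_one_of_pos (show 0 < 1 + u by linarith)]
          have h9 : softFactor ε δ = 1 + u + Real.log (1 + v) := rfl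
          linarith

/-- Since `Mk = 2048 S⁴ L` with `εS < 2` and `L` at most five times the logarithm, the first
constant is `2048 · 16 · 5`. In the same way the second is `256 · 4 · 5`, where the spare factor `ε²
≤ 1` is dropped. -/
theorem sampleCount_mul_slotCount_le (hε : LeadingDigit ε a) (hδ : LeadingDigit δ d) :
    (sampleCount a d : ℝ) * slotCount a ≤ 163840 * copyBound ε δ ∧
      (sampleCount a d : ℝ) ≤ 5120 * copyBound ε δ ∧ 1 ≤ 2 * copyBound ε δ := by
  have h1 := (digits_le hε hδ).1
  have hpos := hε.pos
  set l := Real.log (2 / (δ * ε ^ 2)) with hl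
  have hl2 : 1 / 2 ≤ l := by
    have := log_one_div_pos hε.pos hε.lt_one
    have := log_one_div_pos hδ.pos hδ.lt_one
    rw [hl, log_copies_eq hε.pos hδ.pos]
    linarith [Real.log_two_gt_d9]
  have h2 : (ε * 2 ^ a) * (ε * 2 ^ a) ≤ 2 * 2 :=
    mul_le_mul hε.mul_lt_two.le hε.mul_lt_two.le (by positivity) (by norm_num)
  have h3 : ((ε * 2 ^ a) * (ε * 2 ^ a)) * ((ε * 2 ^ a) * (ε * 2 ^ a)) ≤ 4 * 4 := by
    refine mul_le_mul ?_ ?_ (by positivity) (by norm_num) <;> linarith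
  have h4 : ε ^ 2 ≤ 1 := pow_le_one₀ hpos.le hε.lt_one.le
  have h5 : ε ^ 4 ≤ 1 := pow_le_one₀ hpos.le hε.lt_one.le
  have hX : copyBound ε δ = l / ε ^ 4 := rfl
  have hL : (0 : ℝ) ≤ ((d + a + a : ℕ) : ℝ) := Nat.cast_nonneg _
  rw [hX]
  refine ⟨?_, ?_, ?_⟩
  · rw [mul_div_assoc', le_div_iff₀ (by positivity)]
    calc (sampleCount a d : ℝ) * slotCount a * ε ^ 4
        = 2048 * (((ε * 2 ^ a) * (ε * 2 ^ a)) * ((ε * 2 ^ a) * (ε * 2 ^ a)) *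
          ((d + a + a : ℕ) : ℝ)) := by
          rw [sampleCount, slotCount]
          push_cast
          ring
      _ ≤ 2048 * ((4 * 4) * (5 * l)) := by gcongr
      _ = 163840 * l := by ring
  · rw [mul_div_assoc', le_div_iff₀ (by positivity)]
    calc (sampleCount a d : ℝ) * ε ^ 4
        = 256 * (((ε * 2 ^ a) * (ε * 2 ^ a)) * ((d + a + a : ℕ) : ℝ)) * ε ^ 2 := by
          rw [sampleCount]
          push_cast
          ring
      _ ≤ 256 * ((2 * 2) * (5 * l)) * 1 := by gcongr
      _ = 5120 * l := by ring
  · rw [mul_div_assoc', le_div_iff₀ (by positivity)]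
    linarith

/-- Every contribution is absorbed into `n M k`: 156 for the search, 90 for the estimation, 66 for
the output, and 9 left for the preparation. -/
theorem learnerTime_le (hn : 1 ≤ n) (hd : 1 ≤ d) :
    learnerTime n a d ≤ 321 * (n * (sampleCount a d * slotCount a)) := by
  obtain ⟨h1, h2⟩ := le_sampleCount (a := a) hd
  have h3 : 1 ≤ 2 ^ a * 2 ^ a := Nat.one_le_iff_ne_zero.2 (by positivity)
  have h4 : 1 ≤ slotCount a := by
    rw [slotCount]
    omega
  set M := sampleCount a d
  set k := slotCount a
  have h5 : M ≤ n * (M * k) := by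
    calc M ≤ M * k := Nat.le_mul_of_pos_right _ h4
      _ ≤ _ := Nat.le_mul_of_pos_left _ hn
  have h6 : searchCost n k ≤ 156 * (n * k) := by
    have : k ≤ n * k := Nat.le_mul_of_pos_left _ hn
    have : n ≤ n * k := Nat.le_mul_of_pos_right _ h4
    have e : k * (14 * n + 40) = 14 * (n * k) + 40 * k := by ring
    rw [searchCost, e]
    omega
  have h7 : estimateCost n k ≤ 90 * (n * k) := by
    have : k ≤ n * k := Nat.le_mul_of_pos_left _ hn
    have : n ≤ n * k := Nat.le_mul_of_pos_right _ h4
    have e : k * (14 * n + 30) = 14 * (n * k) + 30 * k := by ring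
    rw [estimateCost, e]
    omega
  have h8 : k * (16 * n + 50) ≤ 66 * (n * (M * k)) := by
    have h9 : k ≤ n * k := Nat.le_mul_of_pos_left _ hn
    have e : k * (16 * n + 50) = 16 * (n * k) + 50 * k := by ring
    have : n * k ≤ n * (M * k) := Nat.mul_le_mul_left _ (Nat.le_mul_of_pos_left _ (by omega))
    omega
  have h9 := Nat.mul_le_mul_left M h6
  have h10 := Nat.mul_le_mul_left M h7
  have e1 : M * (156 * (n * k)) = 156 * (n * (M * k)) := by ring
  have e2 : M * (90 * (n * k)) = 90 * (n * (M * k)) := by ring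
  have h11 : learnerTime n a d = 8 * a + 6 * d + 80 + M * searchCost n k +
    M * estimateCost n k + k * (16 * n + 50) := rfl
  omega

theorem log_two_pow_le (hε : LeadingDigit ε a) (hδ : LeadingDigit δ d) :
    Real.log (2 ^ a) ≤ 1 + softFactor ε δ := by
  have h1 := mul_log_two_le hε.pos hε.mul_lt_two
  have h2 := (le_softFactor hε.pos hε.lt_one hδ.pos hδ.lt_one).2
  rw [Real.log_pow]
  linarith [Real.log_two_lt_d9]

theorem log_word_le (hn : 1 ≤ n) (hε : LeadingDigit ε a) (hδ : LeadingDigit δ d) :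
    Real.log (learnerLimits n a d).word ≤ Real.log n + 26 * softFactor ε δ := by
  obtain ⟨h1, h2⟩ := le_sampleCount (a := a) hδ.one_le
  have h3 : 1 ≤ 2 ^ a * 2 ^ a := Nat.one_le_iff_ne_zero.2 (by positivity)
  have hS : 1 ≤ 2 ^ a := Nat.one_le_two_pow
  have hL : 1 ≤ d + a + a := by linarith [hδ.one_le]
  have h4 : 1 ≤ slotCount a := by
    rw [slotCount]
    omega
  have hw : (learnerLimits n a d).word ≤
      2 ^ 20 * (n * ((2 ^ a) ^ 5 * (d + a + a))) := by
    have e1 : (learnerLimits n a d).word = 300 + n + slotCount a * n + slotCount a +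
      4 * sampleCount a d * 2 ^ a + 4 * sampleCount a d + 1 := rfl
    have e2 : 2048 * (n * ((2 ^ a) ^ 5 * (d + a + a))) =
        n * (slotCount a * (sampleCount a d * 2 ^ a)) := by
      rw [slotCount, sampleCount]
      ring
    set S := 2 ^ a
    set M := sampleCount a d
    set k := slotCount a
    have hM : 1 ≤ M := by omega
    have g1 : M ≤ M * S := Nat.le_mul_of_pos_right _ hS
    have g2 : M * S ≤ k * (M * S) := Nat.le_mul_of_pos_left _ h4
    have g3 : k ≤ k * (M * S) := Nat.le_mul_of_pos_right _ (by omega)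
    have g4 : k * (M * S) ≤ n * (k * (M * S)) := Nat.le_mul_of_pos_left _ hn
    have g5 : n ≤ n * (k * (M * S)) := Nat.le_mul_of_pos_right _ (by omega)
    have g6 : k * n ≤ n * (k * (M * S)) := by
      rw [mul_comm k n]
      exact Nat.mul_le_mul_left _ g3
    have e3 : 4 * M * S = 4 * (M * S) := mul_assoc _ _ _
    omega
  have hn' : (1 : ℝ) ≤ n := by exact_mod_cast hn
  have hL' : (0 : ℝ) < ((d + a + a : ℕ) : ℝ) := by exact_mod_cast hL
  have hw0 : (0 : ℝ) < (learnerLimits n a d).word := by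
    exact_mod_cast (learnerLimits n a d).one_le_word
  have hw' : ((learnerLimits n a d).word : ℝ) ≤
      2 ^ 20 * (n * ((2 ^ a) ^ 5 * ((d + a + a : ℕ) : ℝ))) := by exact_mod_cast hw
  have h5 := Real.log_le_log hw0 hw'
  rw [Real.log_mul (by positivity) (by positivity), Real.log_mul (by positivity) (by positivity),
    Real.log_mul (by positivity) (by positivity), Real.log_pow, Real.log_pow] at h5
  have h6 := log_two_pow_le hε hδ
  have h7 := (digits_le hε hδ).2
  have h8 := (le_softFactor hε.pos hε.lt_one hδ.pos hδ.lt_one).1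
  have h9 := Real.log_two_lt_d9
  push_cast at h5 h7
  linarith

/-- In contrast to the word length, this bound does not involve `n`. The `O(nk)` array cells
therefore contribute no factor `log n` to the space; only the fixed number of scalar variables need
`log n` bits. -/
theorem log_cell_le (hε : LeadingDigit ε a) (hδ : LeadingDigit δ d) :
    Real.log (learnerLimits n a d).cell ≤ 13 * softFactor ε δ := by
  obtain ⟨h1, h2⟩ := le_sampleCount (a := a) hδ.one_le
  have hL : 1 ≤ d + a + a := by linarith [hδ.one_le]
  have hw : (learnerLimits n a d).cell ≤ 2 ^ 9 * ((2 ^ a) ^ 2 * (d + a + a)) := by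
    have e1 : (learnerLimits n a d).cell = sampleCount a d + 1 := rfl
    have e2 : 2 ^ 9 * ((2 ^ a) ^ 2 * (d + a + a)) = 2 * sampleCount a d := by
      rw [sampleCount]
      ring
    omega
  have hL' : (0 : ℝ) < ((d + a + a : ℕ) : ℝ) := by exact_mod_cast hL
  have hw0 : (0 : ℝ) < (learnerLimits n a d).cell := by
    exact_mod_cast (learnerLimits n a d).one_le_cell
  have hw' : ((learnerLimits n a d).cell : ℝ) ≤
      2 ^ 9 * ((2 ^ a) ^ 2 * ((d + a + a : ℕ) : ℝ)) := by exact_mod_cast hw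
  have h5 := Real.log_le_log hw0 hw'
  rw [Real.log_mul (by positivity) (by positivity), Real.log_mul (by positivity) (by positivity),
    Real.log_pow, Real.log_pow] at h5
  have h6 := log_two_pow_le hε hδ
  have h7 := (digits_le hε hδ).2
  have h8 := (le_softFactor hε.pos hε.lt_one hδ.pos hδ.lt_one).1
  have h9 := Real.log_two_lt_d9
  push_cast at h5 h7
  linarith

end Parameters

end AgnosticFourier

/-! ### Resources of reachable configurations -/

namespace AgnosticFourier

theorem holds_bounds {K n a d : ℕ} {ε δ : ℝ} (hn : 1 ≤ n) (hε : LeadingDigit ε a)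
    (hδ : LeadingDigit δ d) {s : State K n} (hs : (learnerLimits n a d).Holds s) :
    (s.copies : ℝ) ≤ 10240 * copyBound ε δ ∧
    (s.gates : ℝ) ≤ 10240 * (n * copyBound ε δ) ∧
    (s.space : ℝ) ≤ K * 20000000 * (n * copyBound ε δ) * softFactor ε δ ∧
    s.FitsWords (53 * (Real.log n + softFactor ε δ)) := by
  obtain ⟨hMk, hM, hX⟩ := sampleCount_mul_slotCount_le hε hδ
  have hsoft := (le_softFactor hε.pos hε.lt_one hδ.pos hδ.lt_one).1
  have hn' : (1 : ℝ) ≤ n := by exact_mod_cast hn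
  have hlogn : 0 ≤ Real.log n := Real.log_nonneg hn'
  have hlogn' : Real.log n ≤ n := (Real.log_le_sub_one_of_pos (by linarith)).trans (by linarith)
  have hword := size_le_of_log_le (log_word_le hn hε hδ) (by linarith)
  have hcell := size_le_of_log_le (log_cell_le (n := n) hε hδ) (by linarith)
  have hspace := hs.space_le
  set X := copyBound ε δ
  set F := softFactor ε δ
  have hX0 : 0 ≤ X := by linarith
  have hF0 : 0 ≤ F := by linarith
  have hk : (slotCount a : ℝ) ≤ 163840 * X := by
    refine le_trans ?_ hMk
    have h1 : (1 : ℝ) ≤ sampleCount a d := by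
      have := (le_sampleCount (a := a) hδ.one_le).2
      have := hε.one_le
      exact_mod_cast (by omega : 1 ≤ sampleCount a d)
    exact le_mul_of_one_le_left (Nat.cast_nonneg _) h1
  obtain ⟨hvar, harr, -, hcop, hgat⟩ := hs
  have hfit : (Nat.size (learnerLimits n a d).word : ℝ) ≤ 53 * (Real.log n + F) := by linarith
  refine ⟨?_, ?_, ?_, fun x => ?_, fun A i => ?_⟩
  · have h1 : (s.copies : ℝ) ≤ 2 * sampleCount a d := by exact_mod_cast hcop
    linarith
  · have h1 : (s.gates : ℝ) ≤ sampleCount a d * (n + 1) := by exact_mod_cast hgat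
    calc (s.gates : ℝ) ≤ sampleCount a d * (n + 1) := h1
      _ ≤ 5120 * X * (n + n) := by gcongr
      _ = _ := by ring
  · have h1 : (s.space : ℝ) ≤ K * ((Nat.size (learnerLimits n a d).word : ℝ) + 1) +
        K * (((slotCount a : ℝ) + 1) * (n + 1) *
          ((Nat.size (learnerLimits n a d).cell : ℝ) + 1)) := by exact_mod_cast hspace
    have h2 : (Nat.size (learnerLimits n a d).word : ℝ) + 1 ≤ 216 * (n * X * F) := by
      -- The term `log n` of the few scalar variables is absorbed by `log n ≤ n`, as the bound
      -- already contains a factor `n`.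
      calc (Nat.size (learnerLimits n a d).word : ℝ) + 1 ≤ 54 * (n * F + n * F) := by
            nlinarith
        _ = 108 * (n * 1 * F) := by ring
        _ ≤ 108 * (n * (2 * X) * F) := by gcongr
        _ = _ := by ring
    have h3 : ((slotCount a : ℝ) + 1) * (n + 1) *
        ((Nat.size (learnerLimits n a d).cell : ℝ) + 1) ≤ 10000000 * (n * X * F) := by
      calc _ ≤ (163840 * X + 2 * X) * (n + n) * (28 * F) := by
            gcongr
            linarith
        _ = 9175152 * (n * X * F) := by ring
        _ ≤ _ := by gcongr; norm_num
    calc (s.space : ℝ) ≤ _ := h1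
      _ ≤ K * (216 * (n * X * F)) + K * (10000000 * (n * X * F)) := by gcongr
      _ = K * 10000216 * (n * X * F) := by ring
      _ ≤ K * 20000000 * (n * X * F) := by gcongr; norm_num
      _ = _ := by ring
  · exact le_trans (Nat.cast_le.2 (Nat.size_le_size (hvar x))) hfit
  · exact le_trans (Nat.cast_le.2 (Nat.size_le_size
      ((harr A i).trans (learnerLimits n a d).cell_le_word))) hfit

end AgnosticFourier

end

/-! ### Assembly of the main theorem -/

theorem mainTheorem2 :
    ∃ (K : ℕ) (A : AgnosticFourier.Algorithm K) (C : ℝ) (k : ℕ),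
      ∀ (n : ℕ) (δ ε : ℝ), 0 < n → 0 < δ → δ < 1 → 0 < ε → ε < 1 →
        (2 : ℝ) ^ (-((n : ℝ) / 2 - 2)) < ε →
        ∃ T : ℕ,
          (T : ℝ) ≤ C * (n * AgnosticFourier.copyBound ε δ)
            * AgnosticFourier.softFactor ε δ ^ k ∧
          ∀ D : PMF (AgnosticFourier.Cube n × Bool),
            D.map Prod.fst = PMF.uniformOfFintype (AgnosticFourier.Cube n) →
            (∀ s ∈ AgnosticFourier.branches D ε δ T (A.init n), s.todo = []) ∧
            (∀ t : ℕ, ∀ s ∈ AgnosticFourier.branches D ε δ t (A.init n),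
              (s.copies : ℝ) ≤ C * AgnosticFourier.copyBound ε δ ∧
              (s.gates : ℝ) ≤ C * (n * AgnosticFourier.copyBound ε δ) ∧
              (s.space : ℝ) ≤ C * (n * AgnosticFourier.copyBound ε δ)
                * AgnosticFourier.softFactor ε δ ^ k ∧
              s.FitsWords (C * (Real.log n + AgnosticFourier.softFactor ε δ))) ∧
            1 - δ ≤ AgnosticFourier.prob D ε δ T (A.init n)
              {s | (∀ t, A.output s t ∈ Set.Icc (-1 : ℝ) 1) ∧
                (∀ t, |A.output s t
                  - AgnosticFourier.fourierCoeff (AgnosticFourier.signMean D) t| ≤ ε) ∧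
                (s.var A.len : ℝ) ≤ 16 * AgnosticFourier.unifExp
                  (fun x => AgnosticFourier.signMean D x ^ 2) / ε ^ 2 ∧
                ({t | A.output s t ≠ 0}.ncard : ℝ) ≤ 16 * AgnosticFourier.unifExp
                  (fun x => AgnosticFourier.signMean D x ^ 2) / ε ^ 2} ∧
            16 * AgnosticFourier.unifExp (fun x => AgnosticFourier.signMean D x ^ 2) / ε ^ 2
              ≤ 16 / ε ^ 2 := by
  -- The largest constant needed is `32 · 20000000` for the space, and one power of the soft factor
  -- suffices, namely for the length of the array entries.
  refine ⟨32, AgnosticFourier.learner, 10 ^ 9, 1, ?_⟩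
  intro n δ ε hn hδ hδ1 hε hε1 _
  obtain ⟨a, ha, ha1, ha2, hda, hda0⟩ := AgnosticFourier.exists_first_digit hε hε1
  obtain ⟨d, hd, hd1, hd2, hdd, hdd0⟩ := AgnosticFourier.exists_first_digit hδ hδ1
  have hA : AgnosticFourier.LeadingDigit ε a := ⟨hε, hε1, ha, ha1, ha2⟩
  have hB : AgnosticFourier.LeadingDigit δ d := ⟨hδ, hδ1, hd, hd1, hd2⟩
  obtain ⟨hMk, -, hX⟩ := AgnosticFourier.sampleCount_mul_slotCount_le hA hB
  have hsoft := (AgnosticFourier.le_softFactor hε hε1 hδ hδ1).1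
  have hX0 : 0 ≤ AgnosticFourier.copyBound ε δ := by linarith
  refine ⟨AgnosticFourier.learnerTime n a d, ?_, fun D hD => ?_⟩
  · have h1 : (AgnosticFourier.learnerTime n a d : ℝ) ≤ 321 * (n *
        (AgnosticFourier.sampleCount a d * AgnosticFourier.slotCount a)) := by
      exact_mod_cast AgnosticFourier.learnerTime_le (a := a) hn hd
    calc _ ≤ _ := h1
      _ ≤ 321 * (n * (163840 * AgnosticFourier.copyBound ε δ)) := by gcongr
      _ = 52592640 * (n * AgnosticFourier.copyBound ε δ) * 1 := by ring
      _ ≤ _ := by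
        rw [pow_one]
        gcongr
        norm_num
  have hok := AgnosticFourier.learner_ok hD hε ha ha1 ha2 hda hda0 hδ hδ1 hd hd1 hdd hdd0
  refine ⟨hok.halts, fun t s hs => ?_, hok.prob, ?_⟩
  · obtain ⟨h1, h2, h3, h4⟩ := AgnosticFourier.holds_bounds hn hA hB (hok.holds t s hs)
    have hlog : 0 ≤ Real.log n := Real.log_nonneg (by exact_mod_cast hn)
    have hw : 53 * (Real.log n + AgnosticFourier.softFactor ε δ) ≤
        10 ^ 9 * (Real.log n + AgnosticFourier.softFactor ε δ) := by
      gcongr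
      norm_num
    refine ⟨h1.trans ?_, h2.trans ?_, h3.trans ?_, fun x => (h4.1 x).trans hw,
      fun A i => (h4.2 A i).trans hw⟩
    · gcongr
      norm_num
    · gcongr
      norm_num
    · rw [pow_one]
      gcongr
      norm_num
  · gcongr
    linarith [AgnosticFourier.unifExp_signMean_sq_le_one D]
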